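/- **Spectral validity of the second-order (viscous) Whitham equations.** Fix $\delta>0$ and write $\langle f\rangle=\int_0^1 f$ for $1$-periodic $f$. Let $K\subset(0,\infty)$ be open and let $U(\cdot;k,M)$, $c(k,M)$ ($k\in K$, $M\in\mathbb R$) be a smooth family of real $1$-periodic wave profiles and speeds of $\partial_tu+6u\,\partial_xu+\partial_x^3u+\delta(\partial_x^2u+\partial_x^4u)=0$, i.e. $k(3U^2-cU)+k^3U''+\delta(k^2U'+k^4U''')$ is constant and $\langle U\rangle=M$, with $U(\cdot;k,M)=M+U(\cdot;k,0)$, and such that the kernel, on $1$-periodic functions, of $$\mathcal L_{k,M}f=k((6U-c)f)'+k^3f'''+\delta(k^2f''+k^4f'''')$$ is spanned by $U'$. Fix $k\in K$, $M\in\mathbb R$ and evaluate everything at $(k,M)$. For a function $G$ of $(k,M)$ put $\mathrm dG(a,b)=a\,\partial_kG+b\,\partial_MG$. *Two-mode systems.* For $\Lambda_0\in\mathbb C$ let $f^k,f^M$ be the $1$-periodic solutions of $\mathcal L f^k=kv^k$, $\mathcal L f^M=kv^M$ with $\langle f^kU'\rangle=\langle f^MU'\rangle=0$, where $$v^k=(\Lambda_0-c)\partial_kU+3\partial_k(U^2-\langle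 U^2\rangle)+3k(U+k\partial_kU)''+\delta\big(U'+6k^2U'''+2k(\partial_kU)'+4k^3(\partial_kU)'''\big),$$ $$v^M=(\Lambda_0-c)\partial_M(U-\langle U\rangle)+3\partial_M(U^2-\langle U^2\rangle).$$ System (I) for $(k_0,M_0)\in\mathbb C^2$ is $$\Lambda_0k_0+k\,\mathrm dc(k_0,M_0)=0,\qquad (\Lambda_0-c)M_0+\mathrm d\langle3U^2\rangle(k_0,M_0)=0,$$ and system (II) for $(\Lambda_1,k_1,M_1)\in\mathbb C^3$ is $$\Lambda_1k_0+\Lambda_0k_1+k\,\mathrm dc(k_1,M_1)=-6k\big(k_0\langle f^k\rangle+M_0\langle f^M\rangle\big),$$ $$(\Lambda_0-c)M_1+\Lambda_1M_0+\mathrm d\langle 3U^2\rangle(k_1,M_1)=-\delta kM_0+\langle6U(f^k-\langle f^k\rangle)\rangle k_0+\langle6U(f^M-\langle f^M\rangle)\rangle M_0 .$$ *Bloch problem.* For $\nu\in i\mathbb R$ let $\mathcal L_\nu$ be $\mathcal L$ with $\frac{d}{dx}$ replaced by $\frac d{dx}+\nu$. A *spectral curve* is a pair $(\lambda(\nu),\hat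 u_\nu)$, defined for small $\nu\in i\mathbb R\setminus\{0\}$, with $\hat u_\nu$ $1$-periodic of class $C^4$, $\mathcal L_\nu\hat u_\nu=-\lambda(\nu)\hat u_\nu$, $\lambda=\nu k\Lambda_0+\nu^2k\Lambda_1+O(\nu^3)$ and $\hat u_\nu=\hat u_0+\nu\hat u_1+\nu^2\hat u_2+O(\nu^3)$ in the $C^4$ norm, with $\hat u_0,\hat u_1,\hat u_2$ $1$-periodic of class $C^4$. *Viscous Whitham system.* $$\partial_Tk+\partial_X(k\,c)=-\partial_X\langle6kf\rangle,\qquad \partial_TM+\partial_X\langle3U^2\rangle=\partial_X\langle6U(f-\langle f\rangle)\rangle-\delta\,\partial_{XX}M,$$ where $f=f(k,M,\partial_Tk,\partial_Xk,\partial_TM,\partial_XM)$ is the $1$-periodic function of $y$ with $\langle fU'\rangle=0$ and $$\mathcal L_{k,M}f=\partial_T(U-\langle U\rangle)+3\partial_X(U^2-\langle U^2\rangle)+3\big(k^2\partial^3_{Xyy}U+k\,\partial_Xk\,\partial_y^2U\big)$$ $$+\delta\big(2k\partial^2_{Xy}U+\partial_Xk\,\partial_yU\big)+\delta\big(4k^3\partial^4_{Xyyy}U+6k^2\partial_Xk\,\partial_y^3U\big).$$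 It is of the form $\partial_Tk+\partial_X\Phi_1=0$, $\partial_TM+\partial_X\Phi_2=0$, with fluxes $\Phi_1,\Phi_2$ depending on $(k,M,\partial_Tk,\partial_Xk,\partial_TM,\partial_XM)$. Its linearization about the constant state $(k,M)$ is obtained by replacing the fluxes by their differentials at $(k,M,0,0,0,0)$, and is written in the co-moving frame $(X-cT,T)$. *Claim.* 1. $f$ (for all values of its six arguments, with wavenumber argument in $K$), and $f^k,f^M$ (for all $\Lambda_0\in\mathbb C$), exist and are unique, and $\Phi_1,\Phi_2$ are differentiable at $(k,M,0,0,0,0)$. 2. For every spectral curve there are constants $k_0,M_0,k_1,M_1,k_2\in\mathbb C$ with $$\hat u_0=\tfrac{k_0}{k}U',\qquad \hat u_1=k_0\partial_kU+M_0\partial_MU+\tfrac{k_1}{k}U',$$ $$\hat u_2=k_1\partial_kU+M_1\partial_MU+k_0(\langle f^k\rangle-f^k)+M_0(\langle f^M\rangle-f^M)+\tfrac{k_2}{k}U',$$ $M_0=\langle\hat u_1\rangle$, $M_1=\langle\hat u_2\rangle$, and (I), (II) hold. Conversely, given any $\Lambda_0,\Lambda_1,k_0,M_0,k_1,M_1\in\mathbb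 C$ and $\hat u_0,\hat u_1$ defined by the formulas above, (I) and (II) hold if and only if there are $\lambda_2\in\mathbb C$ and $1$-periodic $\hat u_2,\hat u_3$ of class $C^4$ with $\langle\hat u_2\rangle=M_1$ such that $\hat u_0+\nu\hat u_1+\nu^2\hat u_2+\nu^3\hat u_3$ and $\nu k\Lambda_0+\nu^2k\Lambda_1+\nu^3\lambda_2$ solve the Bloch problem up to $O(\nu^4)$, uniformly in $x$. 3. If $\hat\lambda(\nu)=\nu k\Lambda_0+\nu^2k\Lambda_1+O(\nu^3)$, $\hat k(\nu)=k_0+\nu k_1+O(\nu^2)$ and $\hat M(\nu)=M_0+\nu M_1+O(\nu^2)$, then the plane waves $e^{\hat\lambda(\nu)t+\nu kx}(\hat k(\nu),\hat M(\nu))$ solve the linearized viscous Whitham system up to $O(\nu^3)$ (at each $(x,t)$) if and only if (I) and (II) hold. 4. Consequently, if $\Lambda_0$ is a simple root of the determinant of system (I), then for every spectral curve with this $\Lambda_0$ and $\hat u_0\neq0$, and every family of plane waves as in 3 with the same $\Lambda_0$ and $(k_0,M_0)\ne(0,0)$ that solves the linearized viscous Whitham system up to $O(\nu^3)$, the coefficients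 $\Lambda_1$ agree, that is, $\lambda(\nu)-\hat\lambda(\nu)=O(\nu^3)$: the curvature of the spectral curve is the one given by the second-order modulation system. -/

import Mathlib

open scoped ContDiff Topology
open Filter Asymptotics

noncomputable section

namespace GKS

/-- The average `<f>` over one period of a `1`-periodic function. -/
def mean {E : Type*} [NormedAddCommGroup E] [NormedSpace ℝ E] (f : ℝ → E) : E :=
  ∫ y in (0 : ℝ)..1, f y

/-- Partial derivative with respect to the wavenumber `k` of a quantity depending on `(k, M)`. -/
def dk (G : ℝ → ℝ → ℝ) (k M : ℝ) : ℝ := deriv (fun s => G s M) k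

/-- Partial derivative with respect to the mean `M` of a quantity depending on `(k, M)`. -/
def dM (G : ℝ → ℝ → ℝ) (k M : ℝ) : ℝ := deriv (fun s => G k s) M

/-- `∂[G(k, M)]` when the parameters `k`, `M` are themselves fields, with slopes `∂k = p`,
`∂M = q` in the variable of differentiation. -/
def chain (G : ℝ → ℝ → ℝ) (k M p q : ℝ) : ℝ := dk G k M * p + dM G k M * q

/-- The profile derivative `∂_k U(k, M)` as a function of the phase. -/
def dkU (U : ℝ → ℝ → ℝ → ℝ) (k M : ℝ) : ℝ → ℝ := fun y => dk (fun k M => U k M y) k M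

/-- The profile derivative `∂_M U(k, M)` as a function of the phase. -/
def dMU (U : ℝ → ℝ → ℝ → ℝ) (k M : ℝ) : ℝ → ℝ := fun y => dM (fun k M => U k M y) k M

/-- `U² - <U²>`, at the phase `y`. -/
def sqFluct (U : ℝ → ℝ → ℝ → ℝ) (y : ℝ) : ℝ → ℝ → ℝ :=
  fun k M => U k M y ^ 2 - mean (fun z => U k M z ^ 2)

/-- `<3 U²>`. -/
def meanSq (U : ℝ → ℝ → ℝ → ℝ) : ℝ → ℝ → ℝ := fun k M => mean (fun y => 3 * U k M y ^ 2)

/-- The linearization about the wave `V` with speed `c` of the differentiated profile equation: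
`L f = k ((6V - c) f)' + k³ f''' + δ (k² f'' + k⁴ f'''')`. -/
def linOp {𝕜 : Type*} [RCLike 𝕜] (δ k c : ℝ) (V : ℝ → ℝ) (f : ℝ → 𝕜) (y : ℝ) : 𝕜 :=
  (k : 𝕜) * deriv (fun z => ((6 * V z - c : ℝ) : 𝕜) * f z) y
    + (k : 𝕜) ^ 3 * iteratedDeriv 3 f y
    + (δ : 𝕜) * ((k : 𝕜) ^ 2 * iteratedDeriv 2 f y + (k : 𝕜) ^ 4 * iteratedDeriv 4 f y)

/-- The operator `d/dx + ν`. -/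
def bd (ν : ℂ) (u : ℝ → ℂ) : ℝ → ℂ := fun x => deriv u x + ν * u x

/-- The Bloch operator: `linOp` with `d/dx` replaced by `d/dx + ν`. -/
def blochOp (δ k c : ℝ) (V : ℝ → ℝ) (ν : ℂ) (u : ℝ → ℂ) (x : ℝ) : ℂ :=
  (k : ℂ) * bd ν (fun z => ((6 * V z - c : ℝ) : ℂ) * u z) x
    + (k : ℂ) ^ 3 * (bd ν)^[3] u x
    + (δ : ℂ) * ((k : ℂ) ^ 2 * (bd ν)^[2] u x + (k : ℂ) ^ 4 * (bd ν)^[4] u x)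

/-- A smooth family `U(·; k, M)`, `k ∈ K`, `M ∈ ℝ`, of `1`-periodic wave trains of the
generalized Kuramoto-Sivashinsky equation, with speed `c(k, M)`, parametrized by wavenumber and
mean (with the phases chosen compatibly with the Galilean invariance, so that `U(k, M) - M` does
not depend on `M`), and such that the kernel of the linearization is spanned by the
translation mode `U'`. -/
structure IsWaveFamily (δ : ℝ) (K : Set ℝ) (U : ℝ → ℝ → ℝ → ℝ) (c : ℝ → ℝ → ℝ) : Prop where
  isOpen : IsOpen K
  pos : ∀ k ∈ K, 0 < k
  smooth_U : ContDiffOn ℝ ∞ (fun p : ℝ × ℝ × ℝ => U p.1 p.2.1 p.2.2) (K ×ˢ Set.univ)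
  smooth_c : ContDiffOn ℝ ∞ (fun p : ℝ × ℝ => c p.1 p.2) (K ×ˢ Set.univ)
  periodic : ∀ k ∈ K, ∀ M, Function.Periodic (U k M) 1
  mean_eq : ∀ k ∈ K, ∀ M, mean (U k M) = M
  galilean : ∀ k ∈ K, ∀ M y, U k M y = M + U k 0 y
  profile : ∀ k ∈ K, ∀ M, ∃ q : ℝ, ∀ y,
    k * (3 * U k M y ^ 2 - c k M * U k M y) + k ^ 3 * iteratedDeriv 2 (U k M) y
      + δ * (k ^ 2 * deriv (U k M) y + k ^ 4 * iteratedDeriv 3 (U k M) y) = q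
  kernel : ∀ k ∈ K, ∀ M, ∀ f : ℝ → ℝ, ContDiff ℝ 4 f → Function.Periodic f 1 →
    (∀ y, linOp δ k (c k M) (U k M) f y = 0) → ∃ a : ℝ, ∀ y, f y = a * deriv (U k M) y

/-- `f` is the `1`-periodic solution of `L_{k,M} f = r` with `<f U'> = 0`. -/
def IsCorrector {𝕜 : Type*} [RCLike 𝕜] (δ : ℝ) (U : ℝ → ℝ → ℝ → ℝ) (c : ℝ → ℝ → ℝ) (k M : ℝ)
    (r f : ℝ → 𝕜) : Prop :=
  ContDiff ℝ 4 f ∧ Function.Periodic f 1 ∧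
    (∀ y, linOp δ k (c k M) (U k M) f y = r y) ∧
    mean (fun y => f y * ((deriv (U k M) y : ℝ) : 𝕜)) = 0

/-- The solution of `L_{k,M} f = r`, `<f U'> = 0` (whenever there is exactly one). -/
def corrector {𝕜 : Type*} [RCLike 𝕜] (δ : ℝ) (U : ℝ → ℝ → ℝ → ℝ) (c : ℝ → ℝ → ℝ) (k M : ℝ)
    (r : ℝ → 𝕜) : ℝ → 𝕜 :=
  Classical.epsilon (IsCorrector δ U c k M r)

/-! ### The two-mode linear systems -/

/-- The source `v^k`, with `Λ₀` the first order coefficient of the (rescaled) eigenvalue. -/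
def vk (δ : ℝ) (U : ℝ → ℝ → ℝ → ℝ) (c : ℝ → ℝ → ℝ) (k M : ℝ) (Λ₀ : ℂ) (y : ℝ) : ℂ :=
  (Λ₀ - (c k M : ℂ)) * ((dkU U k M y : ℝ) : ℂ)
    + ((3 * dk (sqFluct U y) k M
      + 3 * k * iteratedDeriv 2 (fun z => U k M z + k * dkU U k M z) y
      + δ * (deriv (U k M) y + 6 * k ^ 2 * iteratedDeriv 3 (U k M) y
        + 2 * k * deriv (dkU U k M) y + 4 * k ^ 3 * iteratedDeriv 3 (dkU U k M) y) : ℝ) : ℂ)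

/-- The source `v^M`. -/
def vM (U : ℝ → ℝ → ℝ → ℝ) (c : ℝ → ℝ → ℝ) (k M : ℝ) (Λ₀ : ℂ) (y : ℝ) : ℂ :=
  (Λ₀ - (c k M : ℂ)) * ((dM (fun k M => U k M y - mean (U k M)) k M : ℝ) : ℂ)
    + ((3 * dM (sqFluct U y) k M : ℝ) : ℂ)

/-- `f^k`: the solution of `L f^k = k v^k`. -/
def fk (δ : ℝ) (U : ℝ → ℝ → ℝ → ℝ) (c : ℝ → ℝ → ℝ) (k M : ℝ) (Λ₀ : ℂ) : ℝ → ℂ :=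
  corrector δ U c k M (fun y => (k : ℂ) * vk δ U c k M Λ₀ y)

/-- `f^M`: the solution of `L f^M = k v^M`. -/
def fM (δ : ℝ) (U : ℝ → ℝ → ℝ → ℝ) (c : ℝ → ℝ → ℝ) (k M : ℝ) (Λ₀ : ℂ) : ℝ → ℂ :=
  corrector δ U c k M (fun y => (k : ℂ) * vM U c k M Λ₀ y)

/-- `<6 U (f - <f>)>`. -/
def fluxMean (V : ℝ → ℝ) (f : ℝ → ℂ) : ℂ :=
  mean (fun y => ((6 * V y : ℝ) : ℂ) * (f y - mean f))

/-- The first order two-mode system for `(k₀, M₀)`. -/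
def FirstOrderSystem (U : ℝ → ℝ → ℝ → ℝ) (c : ℝ → ℝ → ℝ) (k M : ℝ) (Λ₀ k₀ M₀ : ℂ) : Prop :=
  Λ₀ * k₀ + (k : ℂ) * ((dk c k M : ℂ) * k₀ + (dM c k M : ℂ) * M₀) = 0 ∧
  (dk (meanSq U) k M : ℂ) * k₀ + (Λ₀ - (c k M : ℂ) + (dM (meanSq U) k M : ℂ)) * M₀ = 0

/-- The second order two-mode system for `(Λ₁, k₁, M₁)`. -/
def SecondOrderSystem (δ : ℝ) (U : ℝ → ℝ → ℝ → ℝ) (c : ℝ → ℝ → ℝ) (k M : ℝ)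
    (Λ₀ k₀ M₀ Λ₁ k₁ M₁ : ℂ) : Prop :=
  Λ₁ * k₀ + Λ₀ * k₁ + (k : ℂ) * ((dk c k M : ℂ) * k₁ + (dM c k M : ℂ) * M₁)
    = -6 * (k : ℂ) * (k₀ * mean (fk δ U c k M Λ₀) + M₀ * mean (fM δ U c k M Λ₀)) ∧
  (Λ₀ - (c k M : ℂ)) * M₁ + Λ₁ * M₀
      + ((dk (meanSq U) k M : ℂ) * k₁ + (dM (meanSq U) k M : ℂ) * M₁)
    = -(δ : ℂ) * (k : ℂ) * M₀
      + fluxMean (U k M) (fk δ U c k M Λ₀) * k₀ + fluxMean (U k M) (fM δ U c k M Λ₀) * M₀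

/-- `Λ₀` is a simple root of the dispersion relation, i.e. of the determinant
`(Λ + k ∂_k c)(Λ - c + ∂_M <3U²>) - k ∂_M c ∂_k <3U²>` of the first order system. -/
def IsSimpleDispersionRoot (U : ℝ → ℝ → ℝ → ℝ) (c : ℝ → ℝ → ℝ) (k M : ℝ) (Λ₀ : ℂ) : Prop :=
  let D : ℂ → ℂ := fun Λ =>
    (Λ + (k : ℂ) * (dk c k M : ℂ)) * (Λ - (c k M : ℂ) + (dM (meanSq U) k M : ℂ))
      - (k : ℂ) * (dM c k M : ℂ) * (dk (meanSq U) k M : ℂ)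
  D Λ₀ = 0 ∧ deriv D Λ₀ ≠ 0

/-! ### Low-frequency spectral curves. Wavenumbers are `ν = i ξ` with `ξ` real, `ξ → 0`. -/

/-- `λ(ν) = ν k Λ₀ + ν² k Λ₁ + O(ν³)`. -/
def EigenvalueExpansion (k : ℝ) (l : ℝ → ℂ) (Λ₀ Λ₁ : ℂ) : Prop :=
  (fun ξ : ℝ => l ξ - (Complex.I * ξ * (k * Λ₀) + (Complex.I * ξ) ^ 2 * (k * Λ₁)))
    =O[𝓝[≠] (0 : ℝ)] fun ξ => ξ ^ 3

/-- `ξ ↦ (l ξ, u ξ)` is a curve of Bloch modes `e^{λ t + ν x} û_ν(x)`, `ν = i ξ`, of the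
linearized equation, with expansions `λ(ν) = ν k Λ₀ + ν² k Λ₁ + O(ν³)` and
`û_ν = û₀ + ν û₁ + ν² û₂ + O(ν³)` in the `C⁴` norm. -/
structure IsSpectralCurve (δ : ℝ) (U : ℝ → ℝ → ℝ → ℝ) (c : ℝ → ℝ → ℝ) (k M : ℝ)
    (l : ℝ → ℂ) (u : ℝ → ℝ → ℂ) (Λ₀ Λ₁ : ℂ) (u₀ u₁ u₂ : ℝ → ℂ) : Prop where
  mode_smooth : ∀ᶠ ξ : ℝ in 𝓝[≠] (0 : ℝ), ContDiff ℝ 4 (u ξ)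
  mode_periodic : ∀ᶠ ξ : ℝ in 𝓝[≠] (0 : ℝ), Function.Periodic (u ξ) 1
  mode_eq : ∀ᶠ ξ : ℝ in 𝓝[≠] (0 : ℝ), ∀ x,
    blochOp δ k (c k M) (U k M) (Complex.I * ξ) (u ξ) x = -l ξ * u ξ x
  coeff_smooth : ContDiff ℝ 4 u₀ ∧ ContDiff ℝ 4 u₁ ∧ ContDiff ℝ 4 u₂
  coeff_periodic :
    Function.Periodic u₀ 1 ∧ Function.Periodic u₁ 1 ∧ Function.Periodic u₂ 1
  eigenvalue : EigenvalueExpansion k l Λ₀ Λ₁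
  eigenvector : ∀ j ≤ 4, ∃ C : ℝ, ∀ᶠ ξ : ℝ in 𝓝[≠] (0 : ℝ), ∀ x,
    ‖iteratedDeriv j (fun z => u ξ z
      - (u₀ z + Complex.I * ξ * u₁ z + (Complex.I * ξ) ^ 2 * u₂ z)) x‖ ≤ C * |ξ| ^ 3

/-- The leading part `û₀ = (k₀ / k) U'` of a mode. -/
def mode₀ (U : ℝ → ℝ → ℝ → ℝ) (k M : ℝ) (k₀ : ℂ) (x : ℝ) : ℂ :=
  k₀ / k * ((deriv (U k M) x : ℝ) : ℂ)

/-- The first correction `û₁ = k₀ ∂_k U + M₀ ∂_M U + (k₁ / k) U'`. -/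
def mode₁ (U : ℝ → ℝ → ℝ → ℝ) (k M : ℝ) (k₀ M₀ k₁ : ℂ) (x : ℝ) : ℂ :=
  k₀ * ((dkU U k M x : ℝ) : ℂ) + M₀ * ((dMU U k M x : ℝ) : ℂ)
    + k₁ / k * ((deriv (U k M) x : ℝ) : ℂ)

/-- The second correction
`û₂ = k₁ ∂_k U + M₁ ∂_M U + k₀ (<f^k> - f^k) + M₀ (<f^M> - f^M) + (k₂ / k) U'`. -/
def mode₂ (δ : ℝ) (U : ℝ → ℝ → ℝ → ℝ) (c : ℝ → ℝ → ℝ) (k M : ℝ) (Λ₀ k₀ M₀ k₁ M₁ k₂ : ℂ)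
    (x : ℝ) : ℂ :=
  k₁ * ((dkU U k M x : ℝ) : ℂ) + M₁ * ((dMU U k M x : ℝ) : ℂ)
    + k₀ * (mean (fk δ U c k M Λ₀) - fk δ U c k M Λ₀ x)
    + M₀ * (mean (fM δ U c k M Λ₀) - fM δ U c k M Λ₀ x)
    + k₂ / k * ((deriv (U k M) x : ℝ) : ℂ)

/-- `û₀ + ν û₁ + ν² û₂ + ν³ û₃`, with eigenvalue `ν k Λ₀ + ν² k Λ₁ + ν³ l₂`, solves the Bloch
spectral problem up to `O(ν⁴)`. -/
def IsQuasiMode (δ : ℝ) (U : ℝ → ℝ → ℝ → ℝ) (c : ℝ → ℝ → ℝ) (k M : ℝ)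
    (Λ₀ Λ₁ l₂ : ℂ) (u₀ u₁ u₂ u₃ : ℝ → ℂ) : Prop :=
  ∃ C : ℝ, ∀ᶠ ξ : ℝ in 𝓝[≠] (0 : ℝ), ∀ x,
    let ν : ℂ := Complex.I * ξ
    let u : ℝ → ℂ := fun z => u₀ z + ν * u₁ z + ν ^ 2 * u₂ z + ν ^ 3 * u₃ z
    ‖blochOp δ k (c k M) (U k M) ν u x
      + (ν * (k * Λ₀) + ν ^ 2 * (k * Λ₁) + ν ^ 3 * l₂) * u x‖ ≤ C * |ξ| ^ 4

/-! ### The viscous Whitham system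

In the original variables it is the system of conservation laws
`∂_T k + ∂_X (k c(k, M) + <6 k f>) = 0`,
`∂_T M + ∂_X (<3U²> - <6 U (f - <f>)> + δ ∂_X M) = 0`,
where `f = f(k, M, ∂_T k, ∂_X k, ∂_T M, ∂_X M)`. -/

/-- The right hand side of the equation `L_{k,M} f = …` defining `f`. -/
def whithamSource (δ : ℝ) (U : ℝ → ℝ → ℝ → ℝ) (k M kT kX MT MX : ℝ) (y : ℝ) : ℝ :=
  let UX : ℝ → ℝ := fun z => chain (fun k M => U k M z) k M kX MX
  chain (fun k M => U k M y - mean (U k M)) k M kT MT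
    + 3 * chain (sqFluct U y) k M kX MX
    + 3 * (k ^ 2 * iteratedDeriv 2 UX y + k * kX * iteratedDeriv 2 (U k M) y)
    + δ * (2 * k * deriv UX y + kX * deriv (U k M) y)
    + δ * (4 * k ^ 3 * iteratedDeriv 3 UX y + 6 * k ^ 2 * kX * iteratedDeriv 3 (U k M) y)

/-- The function `f(k, M, ∂_T k, ∂_X k, ∂_T M, ∂_X M)`. -/
def whithamF (δ : ℝ) (U : ℝ → ℝ → ℝ → ℝ) (c : ℝ → ℝ → ℝ) (k M kT kX MT MX : ℝ) : ℝ → ℝ :=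
  corrector δ U c k M (whithamSource δ U k M kT kX MT MX)

/-- The local state `(k, M, ∂_T k, ∂_X k, ∂_T M, ∂_X M)`. -/
abbrev Jet : Type := ℝ × ℝ × ℝ × ℝ × ℝ × ℝ

/-- The flux `k c(k, M) + <6 k f>` of the wavenumber. -/
def fluxK (δ : ℝ) (U : ℝ → ℝ → ℝ → ℝ) (c : ℝ → ℝ → ℝ) : Jet → ℝ
  | (k, M, kT, kX, MT, MX) =>
    k * c k M + mean (fun y => 6 * k * whithamF δ U c k M kT kX MT MX y)

/-- The flux `<3U²> - <6 U (f - <f>)> + δ ∂_X M` of the mean. -/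
def fluxM (δ : ℝ) (U : ℝ → ℝ → ℝ → ℝ) (c : ℝ → ℝ → ℝ) : Jet → ℝ
  | (k, M, kT, kX, MT, MX) =>
    meanSq U k M
      - mean (fun y => 6 * U k M y * (whithamF δ U c k M kT kX MT MX y
          - mean (whithamF δ U c k M kT kX MT MX)))
      + δ * MX

/-- `∂_x` of a field in the frame moving with the wave. -/
def Dx (w : ℝ → ℝ → ℝ) (x t : ℝ) : ℝ := deriv (fun x' => w x' t) x

/-- The laboratory time derivative `∂_T = ∂_t - cs ∂_x`, for a field written in the frame
`x = X - cs T`, `t = T`. -/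
def DT (cs : ℝ) (w : ℝ → ℝ → ℝ) (x t : ℝ) : ℝ := deriv (fun t' => w x t') t - cs * Dx w x t

/-- Left hand side, in the frame moving with speed `cs` and at the perturbation `(κ, m)`, of the
linearization about the constant state `(k, M) = (ks, Ms)` of a conservation law
`∂_T w + ∂_X Φ(k, M, ∂_T k, ∂_X k, ∂_T M, ∂_X M) = 0`
(`w` being the component of the perturbation that belongs to the law). -/
def linLaw (Φ : Jet → ℝ) (ks Ms cs : ℝ) (w κ m : ℝ → ℝ → ℝ) (x t : ℝ) : ℝ :=
  DT cs w x t + deriv (fun x' => fderiv ℝ Φ (ks, Ms, 0, 0, 0, 0)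
    (κ x' t, m x' t, DT cs κ x' t, Dx κ x' t, DT cs m x' t, Dx m x' t)) x

/-- The extension of `linLaw` to complex perturbations by complex linearity. -/
def linLawC (Φ : Jet → ℝ) (ks Ms cs : ℝ) (w κ m : ℝ → ℝ → ℂ) (x t : ℝ) : ℂ :=
  (linLaw Φ ks Ms cs (fun x t => (w x t).re) (fun x t => (κ x t).re) (fun x t => (m x t).re) x t
    : ℂ)
  + Complex.I *
  (linLaw Φ ks Ms cs (fun x t => (w x t).im) (fun x t => (κ x t).im) (fun x t => (m x t).im) x t
    : ℂ)

/-- The plane wave `a e^{l t + i ξ k x}`. -/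
def planeWave (k ξ : ℝ) (l a : ℂ) (x t : ℝ) : ℂ :=
  a * Complex.exp (l * t + Complex.I * ξ * (k * x))

/-- The plane waves `e^{λ(ν) t + ν k x} (kh(ν), Mh(ν))`, `ν = i ξ`, solve both equations of the
linearized viscous Whitham system up to `O(ν³)`, i.e. the `O(ν)` and `O(ν²)` terms balance. -/
def WhithamPlaneWave (δ : ℝ) (U : ℝ → ℝ → ℝ → ℝ) (c : ℝ → ℝ → ℝ) (k M : ℝ)
    (l kh Mh : ℝ → ℂ) : Prop :=
  ∀ x t : ℝ,
    ((fun ξ : ℝ => linLawC (fluxK δ U c) k M (c k M) (planeWave k ξ (l ξ) (kh ξ))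
        (planeWave k ξ (l ξ) (kh ξ)) (planeWave k ξ (l ξ) (Mh ξ)) x t)
      =O[𝓝[≠] (0 : ℝ)] fun ξ => ξ ^ 3) ∧
    ((fun ξ : ℝ => linLawC (fluxM δ U c) k M (c k M) (planeWave k ξ (l ξ) (Mh ξ))
        (planeWave k ξ (l ξ) (kh ξ)) (planeWave k ξ (l ξ) (Mh ξ)) x t)
      =O[𝓝[≠] (0 : ℝ)] fun ξ => ξ ^ 3)

/-- `a(ν) = a₀ + ν a₁ + O(ν²)`. -/
def AmplitudeExpansion (a : ℝ → ℂ) (a₀ a₁ : ℂ) : Prop :=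
  (fun ξ : ℝ => a ξ - (a₀ + Complex.I * ξ * a₁)) =O[𝓝[≠] (0 : ℝ)] fun ξ => ξ ^ 2

end GKS

end

open GKS

/-! The Bloch operator is a polynomial in `ν`, namely `L + ν B₁ + ν² B₂ + ν³ B₃ + ν⁴ δ k⁴`
(`blochOp_eq`), and two facts about `L` decide what the spectral problem imposes. First, `L` is a
total derivative, so everything in its range has zero average (`mean_linOp`). Second, its kernel is
spanned by `U'`, and there is a Jordan chain `L 1 = 6 k U'` (`linOp_one`), the infinitesimal form of
Galilean invariance. Hence `U'` lies in the range of `L`, but not in the range of `L` on functions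
of zero average (`eq_zero_of_linOp_eq`). Once the averages `M₀`, `M₁` of the corrections are
prescribed, an order of the expansion can therefore impose two scalar conditions: its average must
vanish, and so must the coefficient of `U'` left over.

Differentiating the profile equation in `k` expresses `B₁ U'` through `L ∂_k U` and `U'`
(`linOp_ofReal_dkU`), and `f^k`, `f^M` are the correctors that absorb the zero-average remainder of
order two. What is left is explicit (`linOp_mode₁`, `linOp_mode₂`, `mean_order_three`): the
coefficient of `U'` at order one and the average at order two form system (I); the coefficient of
`U'` at order two and the average at order three form system (II).

For the modulation system, Galilean invariance gives `c(k, M) = c(k, 0) + 6 M`, so `L` depends on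
`k` only. Every corrector is then a combination of the responses to three sources, `∂_k U`, `srcX`
and `U(k, 0)`, and `∂_T M` drops out (`whithamSource_eq`, `vk_eq`, `vM_eq`). On a plane wave in the
co-moving frame `∂_T` acts as `ν k (Λ₀ - c)` to leading order and `∂_X` as `ν k`, which turns the
linearized corrector into `ν (k₀ f^k + M₀ f^M)` up to `O(ν²)`. The coefficients of `ν` and `ν²` in
the symbol are again (I) and (II) (`whithamPlaneWave_iff`).

Three analytic points support the algebra. A periodic `f` is encoded by `w = f'''' + <f>`; then `f ↦
L f + <f U'>` is a nonzero multiple of the identity plus a compact operator, and it is injective, so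
the Fredholm alternative inverts it (`isUnit_augOp`). The fluxes are affine in the slopes with
coefficients that are only shown to be continuous in `k`, which suffices for differentiability where
the slopes vanish (`hasFDerivAt_flux`). Finally, the average at order three is accessible although
modes are known only up to `O(ν³)`, because averaging removes `L` and leaves a factor `ν` in front
(`orderEqs_of_isApproxCurve`).

At a simple root of the determinant, pairing (II) with a left null vector of the matrix of (I)
eliminates `k₁`, `M₁` and leaves a nonzero multiple of `Λ₁`, so (I) and (II) determine `Λ₁`
(`eq_of_secondOrderSystem`). -/

namespace GKS

/-! ### Periodic primitives and their compactness. -/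

/-- Continuous `1`-periodic real functions, as functions on the circle. -/
abbrev PerC : Type := C(AddCircle (1 : ℝ), ℝ)

/-- The function on the circle induced by a continuous periodic function. -/
def toPerC (f : ℝ → ℝ) (hf : Continuous f) (hp : Function.Periodic f 1) : PerC :=
  ⟨hp.lift, continuous_coinduced_dom.mpr hf⟩

@[simp] lemma toPerC_coe (f : ℝ → ℝ) (hf : Continuous f) (hp : Function.Periodic f 1) (y : ℝ) :
    toPerC f hf hp (y : AddCircle (1 : ℝ)) = f y := rfl

lemma PerC.continuous_coe (w : PerC) : Continuous fun y : ℝ => w (y : AddCircle (1 : ℝ)) :=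
  w.continuous.comp (AddCircle.continuous_mk' 1)

lemma PerC.periodic_coe (w : PerC) :
    Function.Periodic (fun y : ℝ => w (y : AddCircle (1 : ℝ))) 1 := fun y => by
  simp

lemma PerC.ext_coe {v w : PerC} (h : ∀ y : ℝ, v (y : AddCircle (1 : ℝ)) = w y) : v = w := by
  ext x
  induction x using QuotientAddGroup.induction_on with
  | H y => exact h y

/-- The average as a functional on periodic functions. -/
noncomputable def meanL : PerC →L[ℝ] ℝ :=
  LinearMap.mkContinuous
    { toFun := fun w => mean fun y : ℝ => w (y : AddCircle (1 : ℝ))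
      map_add' := fun v w => by
        simp only [mean, ContinuousMap.add_apply]
        exact intervalIntegral.integral_add (v.continuous_coe.intervalIntegrable _ _)
          (w.continuous_coe.intervalIntegrable _ _)
      map_smul' := fun a w => by
        simp [mean, intervalIntegral.integral_const_mul] } 1 (fun w => by
    have := intervalIntegral.norm_integral_le_of_norm_le_const (a := (0 : ℝ)) (b := 1)
      (C := ‖w‖) (f := fun y : ℝ => w (y : AddCircle (1 : ℝ))) (fun y _ => w.norm_coe_le_norm _)
    simpa [mean] using this)

lemma meanL_apply (w : PerC) : meanL w = mean fun y : ℝ => w (y : AddCircle (1 : ℝ)) := rfl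

lemma abs_meanL_le (w : PerC) : |meanL w| ≤ ‖w‖ := by
  have := intervalIntegral.norm_integral_le_of_norm_le_const (a := (0 : ℝ)) (b := 1)
    (C := ‖w‖) (f := fun y : ℝ => w (y : AddCircle (1 : ℝ))) (fun y _ => w.norm_coe_le_norm _)
  simpa [meanL_apply, mean] using this

/-- The primitive, vanishing at `0`, of `w - <w>`. -/
noncomputable def primFun (w : PerC) (y : ℝ) : ℝ :=
  ∫ t in (0 : ℝ)..y, (w (t : AddCircle (1 : ℝ)) - meanL w)

lemma hasDerivAt_primFun (w : PerC) (y : ℝ) :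
    HasDerivAt (primFun w) (w (y : AddCircle (1 : ℝ)) - meanL w) y := by
  have hc : Continuous fun t : ℝ => w (t : AddCircle (1 : ℝ)) - meanL w :=
    w.continuous_coe.sub continuous_const
  exact intervalIntegral.integral_hasDerivAt_right (hc.intervalIntegrable _ _)
    hc.stronglyMeasurable.stronglyMeasurableAtFilter hc.continuousAt

lemma continuous_primFun (w : PerC) : Continuous (primFun w) :=
  continuous_iff_continuousAt.mpr fun y => (hasDerivAt_primFun w y).continuousAt

lemma periodic_primFun (w : PerC) : Function.Periodic (primFun w) 1 := fun y => by
  have hc : Continuous fun t : ℝ => w (t : AddCircle (1 : ℝ)) - meanL w :=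
    w.continuous_coe.sub continuous_const
  have hp : Function.Periodic (fun t : ℝ => w (t : AddCircle (1 : ℝ)) - meanL w) 1 := fun t => by
    simp
  have h := hp.intervalIntegral_add_eq y 0
  have h0 : ∫ t in (0 : ℝ)..0 + 1, (w (t : AddCircle (1 : ℝ)) - meanL w) = 0 := by
    rw [zero_add, intervalIntegral.integral_sub (w.continuous_coe.intervalIntegrable _ _)
      (by simp)]
    simp [meanL_apply, mean]
  rw [primFun, ← intervalIntegral.integral_add_adjacent_intervals
    (hc.intervalIntegrable 0 y) (hc.intervalIntegrable y (y + 1)), h, h0, add_zero, primFun]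

lemma primFun_sub_le (w : PerC) (a b : ℝ) :
    |primFun w a - primFun w b| ≤ 2 * ‖w‖ * |a - b| := by
  have hc : Continuous fun t : ℝ => w (t : AddCircle (1 : ℝ)) - meanL w :=
    w.continuous_coe.sub continuous_const
  rw [primFun, primFun, intervalIntegral.integral_interval_sub_left (hc.intervalIntegrable _ _)
    (hc.intervalIntegrable _ _)]
  refine intervalIntegral.norm_integral_le_of_norm_le_const (E := ℝ)
    (f := fun t : ℝ => w (t : AddCircle (1 : ℝ)) - meanL w) fun t _ => ?_
  calc ‖w (t : AddCircle (1 : ℝ)) - meanL w‖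
      ≤ ‖w (t : AddCircle (1 : ℝ))‖ + ‖meanL w‖ := norm_sub_le _ _
    _ ≤ ‖w‖ + ‖w‖ := add_le_add (w.norm_coe_le_norm _) (abs_meanL_le w)
    _ = 2 * ‖w‖ := by ring

/-- `primFun` on the circle. -/
noncomputable def primC (w : PerC) : PerC :=
  toPerC (primFun w) (continuous_primFun w) (periodic_primFun w)

lemma norm_primC_le (w : PerC) : ‖primC w‖ ≤ 2 * ‖w‖ := by
  refine (ContinuousMap.norm_le _ (by positivity)).mpr fun x => ?_
  induction x using QuotientAddGroup.induction_on with
  | H y =>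
    obtain ⟨z, hz, hyz⟩ := (periodic_primFun w).exists_mem_Ico₀ one_pos y
    change |primFun w y| ≤ _
    rw [hyz]
    have h := primFun_sub_le w z 0
    have h0 : primFun w 0 = 0 := by simp [primFun]
    rw [h0, sub_zero, sub_zero, abs_of_nonneg hz.1] at h
    nlinarith [norm_nonneg w, hz.1, hz.2]

/-- The primitive of `w - <w>` with zero average. -/
noncomputable def primL : PerC →L[ℝ] PerC :=
  LinearMap.mkContinuous
    { toFun := fun w => primC w - ContinuousMap.const _ (meanL (primC w))
      map_add' := fun v w => by
        have h : primC (v + w) = primC v + primC w := PerC.ext_coe fun y => by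
          change primFun (v + w) y = primFun v y + primFun w y
          rw [primFun, primFun, primFun, ← intervalIntegral.integral_add]
          · simp only [ContinuousMap.add_apply, map_add]
            congr 1; ext t; ring
          · exact (v.continuous_coe.sub continuous_const).intervalIntegrable _ _
          · exact (w.continuous_coe.sub continuous_const).intervalIntegrable _ _
        ext x
        simp only [h, map_add, ContinuousMap.sub_apply, ContinuousMap.add_apply,
          ContinuousMap.const_apply]
        ring
      map_smul' := fun a w => by
        have h : primC (a • w) = a • primC w := PerC.ext_coe fun y => by
          change primFun (a • w) y = a * primFun w y
          rw [primFun, primFun, ← intervalIntegral.integral_const_mul]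
          simp only [ContinuousMap.smul_apply, map_smul, smul_eq_mul]
          congr 1; ext t; ring
        ext x
        simp only [h, map_smul, ContinuousMap.sub_apply, ContinuousMap.smul_apply,
          ContinuousMap.const_apply, smul_eq_mul, RingHom.id_apply]
        ring } 4 (fun w => by
    refine (norm_sub_le _ _).trans ?_
    have h1 := norm_primC_le w
    have h2 := abs_meanL_le (primC w)
    have h3 : ‖ContinuousMap.const (AddCircle (1 : ℝ)) (meanL (primC w))‖ ≤ ‖primC w‖ :=
      (ContinuousMap.norm_le _ (norm_nonneg _)).mpr fun x => h2
    linarith)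

lemma primL_coe (w : PerC) (y : ℝ) :
    primL w (y : AddCircle (1 : ℝ)) = primFun w y - meanL (primC w) := rfl

lemma norm_primL_le (w : PerC) : ‖primL w‖ ≤ 4 * ‖w‖ := by
  refine (norm_sub_le _ _).trans ?_
  have h1 := norm_primC_le w
  have h2 := abs_meanL_le (primC w)
  have h3 : ‖ContinuousMap.const (AddCircle (1 : ℝ)) (meanL (primC w))‖ ≤ ‖primC w‖ :=
    (ContinuousMap.norm_le _ (norm_nonneg _)).mpr fun x => h2
  linarith

lemma hasDerivAt_primL (w : PerC) (y : ℝ) :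
    HasDerivAt (fun z : ℝ => primL w (z : AddCircle (1 : ℝ)))
      (w (y : AddCircle (1 : ℝ)) - meanL w) y :=
  (hasDerivAt_primFun w y).sub_const _

lemma meanL_const (a : ℝ) : meanL (ContinuousMap.const _ a) = a := by
  simp [meanL_apply, mean]

@[simp] lemma meanL_primL (w : PerC) : meanL (primL w) = 0 := by
  change meanL (primC w - ContinuousMap.const _ (meanL (primC w))) = 0
  rw [map_sub, meanL_const, sub_self]

/-- Primitives of functions from the unit ball are bounded by `4` and Lipschitz with constant `2`,
so Arzelà–Ascoli applies. -/
lemma isCompactOperator_primL : IsCompactOperator primL := by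
  refine (isCompactOperator_iff_image_closedBall_subset_compact (𝕜₁ := ℝ)
    (primL : PerC →ₗ[ℝ] PerC) one_pos).mpr ?_
  -- The compact set is found among all functions on the circle: a Tychonoff cube cut out by closed
  -- conditions. The Lipschitz bound is stated on lifts to `ℝ`, where `primFun_sub_le` gives it.
  let T : Set (AddCircle (1 : ℝ) → ℝ) := Set.pi Set.univ (fun _ => Set.Icc (-4 : ℝ) 4) ∩
    {h | ∀ x s : ℝ, |h ((x + s : ℝ) : AddCircle (1 : ℝ)) - h (x : AddCircle (1 : ℝ))| ≤ 2 * |s|}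
  have hT : IsCompact T := by
    refine (isCompact_univ_pi fun _ => isCompact_Icc).inter_right ?_
    simp only [Set.ofPred_forall]
    refine isClosed_iInter fun x => isClosed_iInter fun s => isClosed_le ?_ continuous_const
    fun_prop
  -- A point at quotient distance less than `ε` has a lift at real distance less than `ε`, which
  -- transfers the bound to the circle.
  have hmod : ∀ h ∈ T, ∀ x z : AddCircle (1 : ℝ), ∀ ε > 0, ‖z - x‖ < ε → |h z - h x| < 2 * ε := by
    intro h hh x z ε hε hxz
    induction x using QuotientAddGroup.induction_on with
    | H x =>
      obtain ⟨s, hs, hsn⟩ := QuotientAddGroup.exists_norm_mk_lt (z - (x : AddCircle (1 : ℝ)))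
        (sub_pos.mpr hxz)
      have hz : z = ((x + s : ℝ) : AddCircle (1 : ℝ)) := by
        rw [AddCircle.coe_add]
        rw [show ((s : ℝ) : AddCircle (1 : ℝ)) = z - x from hs]
        abel
      rw [hz]
      refine (hh.2 x s).trans_lt ?_
      rw [Real.norm_eq_abs] at hsn
      linarith
  have hcont : ∀ h ∈ T, Continuous h := by
    intro h hh
    rw [Metric.continuous_iff]
    intro x ε hε
    refine ⟨ε / 2, by positivity, fun z hz => ?_⟩
    rw [dist_eq_norm] at hz
    have := hmod h hh x z (ε / 2) (by positivity) hz
    rw [Real.dist_eq]; linarith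
  refine ⟨{w : PerC | (w : AddCircle (1 : ℝ) → ℝ) ∈ T}, ?_, ?_⟩
  · refine ArzelaAscoli.isCompact_of_equicontinuous _ ?_ ?_
    · convert hT using 1
      ext h
      constructor
      · rintro ⟨w, hw, rfl⟩; exact hw
      · intro hh; exact ⟨⟨h, hcont h hh⟩, hh, rfl⟩
    · intro x
      rw [Metric.equicontinuousAt_iff]
      intro ε hε
      refine ⟨ε / 2, by positivity, fun z hz w => ?_⟩
      rw [dist_eq_norm] at hz
      have := hmod _ w.2 x z (ε / 2) (by positivity) hz
      rw [dist_comm, Real.dist_eq]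
      linarith
  · rintro _ ⟨w, hw, rfl⟩
    have hw : ‖w‖ ≤ 1 := by simpa using hw
    refine ⟨fun x _ => ?_, fun x s => ?_⟩
    · have h1 := norm_primL_le w
      have h2 := (primL w).norm_coe_le_norm x
      rw [Real.norm_eq_abs] at h2
      exact abs_le.mp (by linarith : |primL w x| ≤ 4)
    · change |primL w ((x + s : ℝ) : AddCircle (1 : ℝ)) - primL w (x : AddCircle (1 : ℝ))| ≤ _
      rw [primL_coe, primL_coe, sub_sub_sub_cancel_right]
      refine (primFun_sub_le w _ _).trans ?_
      rw [add_sub_cancel_left]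
      nlinarith [abs_nonneg s]

/-! ### Fourth order periodic operators as compact perturbations of multiples of the identity. -/

/-- Projection onto the constants. -/
noncomputable def meanOp : PerC →L[ℝ] PerC := meanL.smulRight (1 : PerC)

/-- The function with average `<w>` and fourth derivative `w - <w>`. -/
noncomputable def prim₄ : PerC →L[ℝ] PerC :=
  primL ∘L primL ∘L primL ∘L primL + meanOp

/-- The operator `f ↦ c₄ f'''' + c₃ f''' + c₂ f'' + p₁ f' + p₀ f + <g f>` expressed through
`w = f'''' + <f>`. -/
noncomputable def perOp (c₄ c₃ c₂ : ℝ) (p₁ p₀ g : PerC) : PerC →L[ℝ] PerC :=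
  c₄ • (1 - meanOp) + c₃ • primL + c₂ • (primL ∘L primL)
    + ContinuousLinearMap.mul ℝ PerC p₁ ∘L primL ∘L primL ∘L primL
    + ContinuousLinearMap.mul ℝ PerC p₀ ∘L prim₄
    + meanOp ∘L ContinuousLinearMap.mul ℝ PerC g ∘L prim₄

@[simp] lemma meanOp_coe (w : PerC) (x : AddCircle (1 : ℝ)) : meanOp w x = meanL w := by
  simp [meanOp]

lemma prim₄_apply (w : PerC) : prim₄ w = primL (primL (primL (primL w))) + meanOp w := rfl

lemma perOp_apply (c₄ c₃ c₂ : ℝ) (p₁ p₀ g w : PerC) (x : AddCircle (1 : ℝ)) :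
    perOp c₄ c₃ c₂ p₁ p₀ g w x = c₄ * (w x - meanL w) + c₃ * primL w x + c₂ * primL (primL w) x
      + p₁ x * primL (primL (primL w)) x + p₀ x * prim₄ w x + meanL (g * prim₄ w) := by
  simp [perOp]

lemma isCompactOperator_meanOp : IsCompactOperator meanOp :=
  (isCompactOperator_of_locallyCompactSpace_dom meanL).clm_comp
    ((ContinuousLinearMap.id ℝ ℝ).smulRight (1 : PerC))

lemma isCompactOperator_prim₄ : IsCompactOperator prim₄ :=
  (isCompactOperator_primL.comp_clm (primL ∘L primL ∘L primL)).add isCompactOperator_meanOp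

/-- Fredholm alternative. Every term except `c₄ w` contains a primitive or an average, so `perOp -
c₄` is compact, and `-c₄` is either an eigenvalue of it, which injectivity excludes, or in its
resolvent set. -/
lemma isUnit_perOp {c₄ : ℝ} (h₄ : c₄ ≠ 0) (c₃ c₂ : ℝ) (p₁ p₀ g : PerC)
    (hinj : ∀ w, perOp c₄ c₃ c₂ p₁ p₀ g w = 0 → w = 0) : IsUnit (perOp c₄ c₃ c₂ p₁ p₀ g) := by
  set T : PerC →L[ℝ] PerC := perOp c₄ c₃ c₂ p₁ p₀ g - c₄ • 1 with hTdef
  have hT : IsCompactOperator T := by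
    have h : T = (-c₄) • meanOp + c₃ • primL + c₂ • (primL ∘L primL)
        + ContinuousLinearMap.mul ℝ PerC p₁ ∘L primL ∘L primL ∘L primL
        + ContinuousLinearMap.mul ℝ PerC p₀ ∘L prim₄
        + meanOp ∘L ContinuousLinearMap.mul ℝ PerC g ∘L prim₄ := by
      ext w x
      simp [hTdef, perOp]
      ring
    have hadd : ∀ {A B : PerC →L[ℝ] PerC}, IsCompactOperator A → IsCompactOperator B →
        IsCompactOperator (A + B) := fun hA hB => IsCompactOperator.add hA hB
    have hsmul : ∀ (a : ℝ) {A : PerC →L[ℝ] PerC}, IsCompactOperator A →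
        IsCompactOperator (a • A) := fun a _ hA => IsCompactOperator.smul hA a
    have hright : ∀ {A : PerC →L[ℝ] PerC} (B : PerC →L[ℝ] PerC), IsCompactOperator A →
        IsCompactOperator (A ∘L B) := fun B hA => hA.comp_clm B
    have hleft : ∀ (A : PerC →L[ℝ] PerC) {B : PerC →L[ℝ] PerC}, IsCompactOperator B →
        IsCompactOperator (A ∘L B) := fun A _ hB => hB.clm_comp A
    have h1 := isCompactOperator_primL
    rw [h]
    exact hadd (hadd (hadd (hadd (hadd (hsmul _ isCompactOperator_meanOp) (hsmul _ h1))
      (hsmul _ (hright _ h1))) (hleft _ (hright _ h1))) (hleft _ isCompactOperator_prim₄))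
      (hleft _ (hleft _ isCompactOperator_prim₄))
  rcases hT.hasEigenvalue_or_mem_resolventSet (neg_ne_zero.mpr h₄) with h | h
  · obtain ⟨w, hw⟩ := h.exists_hasEigenvector
    have h1 : T w = (-c₄) • w := hw.apply_eq_smul
    refine absurd (hinj w ?_) hw.2
    have h2 : perOp c₄ c₃ c₂ p₁ p₀ g w = T w + c₄ • w := by simp [hTdef]
    rw [h2, h1, neg_smul, neg_add_cancel]
  · have h1 : IsUnit (algebraMap ℝ (PerC →L[ℝ] PerC) (-c₄) - T) := h
    have h2 : algebraMap ℝ (PerC →L[ℝ] PerC) (-c₄) - T = -perOp c₄ c₃ c₂ p₁ p₀ g := by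
      rw [hTdef, Algebra.algebraMap_eq_smul_one, neg_smul]; abel
    rw [h2] at h1
    exact (IsUnit.neg_iff _).mp h1

lemma perOp_inverse_apply {c₄ c₃ c₂ : ℝ} {p₁ p₀ g : PerC} (h : IsUnit (perOp c₄ c₃ c₂ p₁ p₀ g))
    (r : PerC) : perOp c₄ c₃ c₂ p₁ p₀ g (Ring.inverse (perOp c₄ c₃ c₂ p₁ p₀ g) r) = r := by
  have := Ring.mul_inverse_cancel _ h
  exact congrArg (fun S : PerC →L[ℝ] PerC => S r) this

/-- The operator depends continuously on its coefficients in operator norm, and inversion is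
continuous at units. This is the source of continuity of the correctors in the wavenumber. -/
lemma continuousAt_perOp_inverse {X : Type*} [TopologicalSpace X] {x : X}
    {c₄ c₃ c₂ : X → ℝ} {p₁ p₀ g r : X → PerC}
    (h₄ : ContinuousAt c₄ x) (h₃ : ContinuousAt c₃ x) (h₂ : ContinuousAt c₂ x)
    (h₁ : ContinuousAt p₁ x) (h₀ : ContinuousAt p₀ x) (hg : ContinuousAt g x)
    (hr : ContinuousAt r x) (hu : IsUnit (perOp (c₄ x) (c₃ x) (c₂ x) (p₁ x) (p₀ x) (g x))) :
    ContinuousAt (fun z =>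
      Ring.inverse (perOp (c₄ z) (c₃ z) (c₂ z) (p₁ z) (p₀ z) (g z)) (r z)) x := by
  have hA : ContinuousAt (fun z => perOp (c₄ z) (c₃ z) (c₂ z) (p₁ z) (p₀ z) (g z)) x := by
    have hm : ∀ {p : X → PerC}, ContinuousAt p x →
        ContinuousAt (fun z => ContinuousLinearMap.mul ℝ PerC (p z)) x := fun hp =>
      (ContinuousLinearMap.mul ℝ PerC).continuous.continuousAt.comp hp
    unfold perOp
    have e1 := hm h₁
    have e0 := hm h₀
    have eg := hm hg
    refine ((((ContinuousAt.add (h₄.smul continuousAt_const) (h₃.smul continuousAt_const)).add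
      (h₂.smul continuousAt_const)).add ?_).add ?_).add ?_
    · exact e1.clm_comp continuousAt_const
    · exact e0.clm_comp continuousAt_const
    · exact continuousAt_const.clm_comp (eg.clm_comp continuousAt_const)
  obtain ⟨u, hu⟩ := hu
  have hi := NormedRing.inverse_continuousAt (R := PerC →L[ℝ] PerC) u
  rw [hu] at hi
  exact (ContinuousAt.comp (f := fun z => perOp (c₄ z) (c₃ z) (c₂ z) (p₁ z) (p₀ z) (g z))
    hi hA).clm_apply hr

lemma hasDerivAt_prim₄ (w : PerC) (y : ℝ) :
    HasDerivAt (fun z : ℝ => prim₄ w (z : AddCircle (1 : ℝ)))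
      (primL (primL (primL w)) (y : AddCircle (1 : ℝ))) y := by
  have h := (hasDerivAt_primL (primL (primL (primL w))) y).add_const (meanL w)
  simpa [prim₄_apply] using h

lemma meanL_prim₄ (w : PerC) : meanL (prim₄ w) = meanL w := by
  have h : meanOp w = ContinuousMap.const _ (meanL w) := by ext x; simp
  rw [prim₄_apply, map_add, meanL_primL, zero_add, h, meanL_const]

/-- A function with four explicit derivatives, the last one continuous. -/
lemma contDiff_four_of_hasDerivAt {f f₁ f₂ f₃ f₄ : ℝ → ℝ} (h₁ : ∀ y, HasDerivAt f (f₁ y) y)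
    (h₂ : ∀ y, HasDerivAt f₁ (f₂ y) y) (h₃ : ∀ y, HasDerivAt f₂ (f₃ y) y)
    (h₄ : ∀ y, HasDerivAt f₃ (f₄ y) y) (hc : Continuous f₄) :
    ContDiff ℝ 4 f ∧ deriv f = f₁ ∧ iteratedDeriv 2 f = f₂ ∧ iteratedDeriv 3 f = f₃ ∧
      iteratedDeriv 4 f = f₄ := by
  have d₁ : deriv f = f₁ := funext fun y => (h₁ y).deriv
  have d₂ : deriv f₁ = f₂ := funext fun y => (h₂ y).deriv
  have d₃ : deriv f₂ = f₃ := funext fun y => (h₃ y).deriv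
  have d₄ : deriv f₃ = f₄ := funext fun y => (h₄ y).deriv
  have step : ∀ {u v : ℝ → ℝ} {n : ℕ}, (∀ y, HasDerivAt u (v y) y) → ContDiff ℝ n v →
      ContDiff ℝ ((n + 1 : ℕ) : ℕ∞ω) u := by
    intro u v n hu hv
    rw [Nat.cast_add, Nat.cast_one, contDiff_succ_iff_deriv]
    refine ⟨fun y => (hu y).differentiableAt, by simp, ?_⟩
    rwa [show deriv u = v from funext fun y => (hu y).deriv]
  have c₄ : ContDiff ℝ ((0 : ℕ) : ℕ∞ω) f₄ := by exact_mod_cast contDiff_zero.mpr hc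
  have c := step h₁ (step h₂ (step h₃ (step h₄ c₄)))
  refine ⟨by exact_mod_cast c, d₁, ?_, ?_, ?_⟩ <;>
    simp [iteratedDeriv_succ', d₁, d₂, d₃, d₄]

/-- The inner primitives have zero average, so differentiation peels them off one at a time; only
the last step leaves `w - <w>`. This identifies `perOp` with a differential operator acting on
`prim₄ w`. -/
lemma prim₄_regular (w : PerC) :
    ContDiff ℝ 4 (fun y : ℝ => prim₄ w (y : AddCircle (1 : ℝ))) ∧
    deriv (fun y : ℝ => prim₄ w (y : AddCircle (1 : ℝ)))
      = (fun y : ℝ => primL (primL (primL w)) (y : AddCircle (1 : ℝ))) ∧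
    iteratedDeriv 2 (fun y : ℝ => prim₄ w (y : AddCircle (1 : ℝ)))
      = (fun y : ℝ => primL (primL w) (y : AddCircle (1 : ℝ))) ∧
    iteratedDeriv 3 (fun y : ℝ => prim₄ w (y : AddCircle (1 : ℝ)))
      = (fun y : ℝ => primL w (y : AddCircle (1 : ℝ))) ∧
    iteratedDeriv 4 (fun y : ℝ => prim₄ w (y : AddCircle (1 : ℝ)))
      = (fun y : ℝ => w (y : AddCircle (1 : ℝ)) - meanL w) :=
  contDiff_four_of_hasDerivAt (hasDerivAt_prim₄ w)
    (fun y => by simpa using hasDerivAt_primL (primL (primL w)) y)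
    (fun y => by simpa using hasDerivAt_primL (primL w) y)
    (hasDerivAt_primL w) (w.continuous_coe.sub continuous_const)

/-- The element of `PerC` defined by a function, when it is continuous and periodic. -/
noncomputable def perC (f : ℝ → ℝ) : PerC := by
  classical
  exact if h : Continuous f ∧ Function.Periodic f 1 then toPerC f h.1 h.2 else 0

lemma perC_coe {f : ℝ → ℝ} (hf : Continuous f) (hp : Function.Periodic f 1) (y : ℝ) :
    perC f (y : AddCircle (1 : ℝ)) = f y := by
  rw [perC, dif_pos ⟨hf, hp⟩, toPerC_coe]

/-- Joint continuity is uniform in the phase over the compact period `[0, 1]`, and periodicity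
extends the estimate to the whole line. -/
lemma continuousAt_perC {K : Set ℝ} (hK : IsOpen K) {F : ℝ → ℝ → ℝ}
    (hF : ContinuousOn (fun p : ℝ × ℝ => F p.1 p.2) (K ×ˢ Set.univ))
    (hp : ∀ k ∈ K, Function.Periodic (F k) 1) {k : ℝ} (hk : k ∈ K) :
    ContinuousAt (fun k => perC (F k)) k := by
  have hc : ∀ k ∈ K, Continuous (F k) := fun k hk =>
    hF.comp_continuous (by fun_prop : Continuous fun y : ℝ => (k, y)) fun y => ⟨hk, trivial⟩
  rw [Metric.continuousAt_iff']
  intro ε hε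
  obtain ⟨v, hv, hv'⟩ := isCompact_Icc.mem_uniformity_of_prod (k := Set.Icc (0 : ℝ) 1) (f := F)
    (hF.mono (Set.prod_mono_right (Set.subset_univ _))) hk (Metric.dist_mem_uniformity
      (half_pos hε))
  rw [hK.nhdsWithin_eq hk] at hv
  filter_upwards [hv, hK.mem_nhds hk] with k' hk' hk'K
  refine lt_of_le_of_lt ((ContinuousMap.dist_le (half_pos hε).le).mpr fun x => ?_)
    (half_lt_self hε)
  induction x using QuotientAddGroup.induction_on with
  | H y =>
    change dist (perC (F k') (y : AddCircle (1 : ℝ))) (perC (F k) (y : AddCircle (1 : ℝ))) ≤ _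
    rw [perC_coe (hc _ hk'K) (hp _ hk'K), perC_coe (hc _ hk) (hp _ hk)]
    have hper : Function.Periodic (fun y => dist (F k' y) (F k y)) 1 := fun y => by
      simp only [hp _ hk'K y, hp _ hk y]
    obtain ⟨z, hz, hyz⟩ := hper.exists_mem_Ico₀ one_pos y
    exact hyz.le.trans (hv' k' hk' z ⟨hz.1, hz.2.le⟩).le

/-! ### Smooth families of functions of the phase. -/

section Calculus

variable {K : Set ℝ} {F : ℝ → ℝ → ℝ}

/-- `F` is a smooth function of the parameter in `K` and of the phase. -/
def SmoothFam (K : Set ℝ) (F : ℝ → ℝ → ℝ) : Prop :=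
  ContDiffOn ℝ ∞ (fun p : ℝ × ℝ => F p.1 p.2) (K ×ˢ Set.univ)

lemma SmoothFam.contDiffAt (hF : SmoothFam K F) (hK : IsOpen K) {k : ℝ} (hk : k ∈ K) (y : ℝ) :
    ContDiffAt ℝ ∞ (fun p : ℝ × ℝ => F p.1 p.2) (k, y) :=
  ContDiffOn.contDiffAt hF ((hK.prod isOpen_univ).mem_nhds ⟨hk, trivial⟩)

lemma SmoothFam.contDiff (hF : SmoothFam K F) {k : ℝ} (hk : k ∈ K) : ContDiff ℝ ∞ (F k) := by
  rw [← contDiffOn_univ]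
  exact ContDiffOn.comp (g := fun p : ℝ × ℝ => F p.1 p.2) (f := fun y : ℝ => (k, y)) hF
    (by fun_prop) (fun y _ => ⟨hk, trivial⟩)

lemma SmoothFam.hasDerivAt_phase (hF : SmoothFam K F) (hK : IsOpen K) {k : ℝ} (hk : k ∈ K)
    (y : ℝ) :
    HasDerivAt (F k) (fderiv ℝ (fun p : ℝ × ℝ => F p.1 p.2) (k, y) (0, 1)) y := by
  have h := ((hF.contDiffAt hK hk y).differentiableAt (by simp)).hasFDerivAt
  have h2 : HasDerivAt (fun z : ℝ => ((k, z) : ℝ × ℝ)) (0, 1) y :=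
    (hasDerivAt_const y k).prodMk (hasDerivAt_id y)
  exact h.comp_hasDerivAt (f := fun z : ℝ => ((k, z) : ℝ × ℝ)) y h2

lemma SmoothFam.hasDerivAt_param (hF : SmoothFam K F) (hK : IsOpen K) {k : ℝ} (hk : k ∈ K)
    (y : ℝ) :
    HasDerivAt (fun s => F s y) (fderiv ℝ (fun p : ℝ × ℝ => F p.1 p.2) (k, y) (1, 0)) k := by
  have h := ((hF.contDiffAt hK hk y).differentiableAt (by simp)).hasFDerivAt
  have h2 : HasDerivAt (fun z : ℝ => ((z, y) : ℝ × ℝ)) (1, 0) k :=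
    (hasDerivAt_id k).prodMk (hasDerivAt_const k y)
  exact h.comp_hasDerivAt (f := fun z : ℝ => ((z, y) : ℝ × ℝ)) k h2

lemma SmoothFam.fderiv_apply (hF : SmoothFam K F) (hK : IsOpen K) (v : ℝ × ℝ) :
    SmoothFam K fun k y => fderiv ℝ (fun p : ℝ × ℝ => F p.1 p.2) (k, y) v :=
  (ContDiffOn.fderiv_of_isOpen hF (hK.prod isOpen_univ) (by simp)).clm_apply contDiffOn_const

lemma SmoothFam.congr {G : ℝ → ℝ → ℝ} (hF : SmoothFam K F) (h : ∀ k ∈ K, ∀ y, G k y = F k y) :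
    SmoothFam K G :=
  ContDiffOn.congr hF fun p hp => h p.1 hp.1 p.2

lemma SmoothFam.deriv_phase (hF : SmoothFam K F) (hK : IsOpen K) :
    SmoothFam K fun k => deriv (F k) :=
  (hF.fderiv_apply hK (0, 1)).congr fun _ hk y => (hF.hasDerivAt_phase hK hk y).deriv

lemma SmoothFam.deriv_param (hF : SmoothFam K F) (hK : IsOpen K) :
    SmoothFam K fun k y => deriv (fun s => F s y) k :=
  (hF.fderiv_apply hK (1, 0)).congr fun _ hk y => (hF.hasDerivAt_param hK hk y).deriv

lemma SmoothFam.differentiableAt_param (hF : SmoothFam K F) (hK : IsOpen K) {k : ℝ} (hk : k ∈ K)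
    (y : ℝ) : DifferentiableAt ℝ (fun s => F s y) k :=
  (hF.hasDerivAt_param hK hk y).differentiableAt

/-- Both sides are values of the second Fréchet derivative, which is symmetric. -/
lemma SmoothFam.deriv_comm (hF : SmoothFam K F) (hK : IsOpen K) {k : ℝ} (hk : k ∈ K) (y : ℝ) :
    deriv (fun s => deriv (F s) y) k = deriv (fun z => deriv (fun s => F s z) k) y := by
  have hs : IsSymmSndFDerivAt ℝ (fun p : ℝ × ℝ => F p.1 p.2) (k, y) :=
    (hF.contDiffAt hK hk y).isSymmSndFDerivAt (by
      rw [minSmoothness_of_isRCLikeNormedField]; exact WithTop.coe_le_coe.mpr (le_top : (2 : ℕ∞) ≤ ⊤))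
  have hd : DifferentiableAt ℝ (fderiv ℝ fun p : ℝ × ℝ => F p.1 p.2) (k, y) :=
    ((ContDiffOn.fderiv_of_isOpen (m := 1) hF (hK.prod isOpen_univ) (by norm_cast)).contDiffAt
      ((hK.prod isOpen_univ).mem_nhds ⟨hk, trivial⟩)).differentiableAt (by simp)
  have e1 : deriv (fun s => deriv (F s) y) k
      = fderiv ℝ (fderiv ℝ fun p : ℝ × ℝ => F p.1 p.2) (k, y) (1, 0) (0, 1) := by
    have h2 : HasDerivAt (fun z : ℝ => ((z, y) : ℝ × ℝ)) (1, 0) k :=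
      (hasDerivAt_id k).prodMk (hasDerivAt_const k y)
    have h := (hd.hasFDerivAt.comp_hasDerivAt (f := fun z : ℝ => ((z, y) : ℝ × ℝ)) k h2).clm_apply
      (hasDerivAt_const k ((0, 1) : ℝ × ℝ))
    refine (Filter.EventuallyEq.deriv_eq ?_).trans (h.deriv.trans (by simp))
    filter_upwards [hK.mem_nhds hk] with s hs
    exact (hF.hasDerivAt_phase hK hs y).deriv
  have e2 : deriv (fun z => deriv (fun s => F s z) k) y
      = fderiv ℝ (fderiv ℝ fun p : ℝ × ℝ => F p.1 p.2) (k, y) (0, 1) (1, 0) := by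
    have h2 : HasDerivAt (fun z : ℝ => ((k, z) : ℝ × ℝ)) (0, 1) y :=
      (hasDerivAt_const y k).prodMk (hasDerivAt_id y)
    have h := (hd.hasFDerivAt.comp_hasDerivAt (f := fun z : ℝ => ((k, z) : ℝ × ℝ)) y h2).clm_apply
      (hasDerivAt_const y ((1, 0) : ℝ × ℝ))
    refine (Filter.EventuallyEq.deriv_eq ?_).trans (h.deriv.trans (by simp))
    filter_upwards with z
    exact (hF.hasDerivAt_param hK hk z).deriv
  rw [e1, e2, hs]

lemma SmoothFam.iteratedDeriv_phase (hF : SmoothFam K F) (hK : IsOpen K) (n : ℕ) :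
    SmoothFam K fun k => iteratedDeriv n (F k) := by
  induction n with
  | zero => simpa [iteratedDeriv_zero] using hF
  | succ n ih =>
    have h := ih.deriv_phase hK
    simpa only [← iteratedDeriv_succ] using h

lemma SmoothFam.hasDerivAt_iteratedDeriv (hF : SmoothFam K F) (hK : IsOpen K) (n : ℕ) {k : ℝ}
    (hk : k ∈ K) (y : ℝ) :
    HasDerivAt (fun s => iteratedDeriv n (F s) y)
      (iteratedDeriv n (fun z => deriv (fun s => F s z) k) y) k := by
  have hd : ∀ n y, DifferentiableAt ℝ (fun s => iteratedDeriv n (F s) y) k := fun n y =>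
    (hF.iteratedDeriv_phase hK n).differentiableAt_param hK hk y
  suffices h : ∀ y, deriv (fun s => iteratedDeriv n (F s) y) k
      = iteratedDeriv n (fun z => deriv (fun s => F s z) k) y by
    rw [← h]; exact (hd n y).hasDerivAt
  clear y
  induction n with
  | zero => intro y; simp [iteratedDeriv_zero]
  | succ n ih =>
    intro y
    simp only [iteratedDeriv_succ]
    rw [(hF.iteratedDeriv_phase hK n).deriv_comm hK hk y]
    congr 1
    funext z
    exact ih z

lemma SmoothFam.continuousOn (hF : SmoothFam K F) :
    ContinuousOn (fun p : ℝ × ℝ => F p.1 p.2) (K ×ˢ Set.univ) :=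
  ContDiffOn.continuousOn hF

/-- Differentiation under the integral; the dominating constant is the maximum of the parameter
derivative on a compact ball of parameters times one period. -/
lemma SmoothFam.hasDerivAt_mean (hF : SmoothFam K F) (hK : IsOpen K) {k : ℝ} (hk : k ∈ K) :
    HasDerivAt (fun s => mean (F s)) (mean fun y => deriv (fun s => F s y) k) k := by
  obtain ⟨r, hr, hrK⟩ := Metric.isOpen_iff.mp hK k hk
  have hG := hF.deriv_param hK
  have hsub : Metric.closedBall k (r / 2) ⊆ K :=
    (Metric.closedBall_subset_ball (half_lt_self hr)).trans hrK
  obtain ⟨C, hC⟩ := ((isCompact_closedBall k (r / 2)).prod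
    (isCompact_Icc (a := (0 : ℝ)) (b := 1))).exists_bound_of_continuousOn
    (hG.continuousOn.mono (Set.prod_mono hsub (Set.subset_univ _)))
  have hb : Metric.ball k (r / 2) ∈ 𝓝 k := Metric.ball_mem_nhds _ (half_pos hr)
  refine (intervalIntegral.hasDerivAt_integral_of_dominated_loc_of_deriv_le
    (F' := fun s y => deriv (fun s => F s y) s) (bound := fun _ => C) hb
    ?_ ?_ ?_ ?_ ?_ ?_).2
  · filter_upwards [hK.mem_nhds hk] with s hs
    exact (hF.contDiff hs).continuous.aestronglyMeasurable
  · exact (hF.contDiff hk).continuous.intervalIntegrable _ _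
  · exact (hG.contDiff hk).continuous.aestronglyMeasurable
  · refine Eventually.of_forall fun y hy s hs => ?_
    rw [Set.uIoc_of_le zero_le_one] at hy
    exact hC (s, y) ⟨Metric.ball_subset_closedBall hs, hy.1.le, hy.2⟩
  · simp
  · refine Eventually.of_forall fun y _ s hs => ?_
    exact (hF.differentiableAt_param hK (hsub (Metric.ball_subset_closedBall hs)) y).hasDerivAt

end Calculus

/-! ### Algebra of the linearized operator. -/

section LinOp

variable {𝕜 : Type*} [RCLike 𝕜] {δ k c : ℝ} {V : ℝ → ℝ}

lemma linOp_eq (hV : Differentiable ℝ V) {f : ℝ → 𝕜} (hf : Differentiable ℝ f) (y : ℝ) :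
    linOp δ k c V f y = (k : 𝕜) * (((6 * deriv V y : ℝ) : 𝕜) * f y
        + ((6 * V y - c : ℝ) : 𝕜) * deriv f y)
      + (k : 𝕜) ^ 3 * iteratedDeriv 3 f y
      + (δ : 𝕜) * ((k : 𝕜) ^ 2 * iteratedDeriv 2 f y + (k : 𝕜) ^ 4 * iteratedDeriv 4 f y) := by
  have h1 : HasDerivAt (fun z => 6 * V z - c) (6 * deriv V y) y :=
    ((hV y).hasDerivAt.const_mul 6).sub_const c
  have h2 : HasDerivAt (fun z => ((6 * V z - c : ℝ) : 𝕜)) ((6 * deriv V y : ℝ) : 𝕜) y :=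
    (RCLike.ofRealCLM (K := 𝕜)).hasFDerivAt.comp_hasDerivAt y h1
  rw [linOp, (h2.fun_mul (hf y).hasDerivAt).deriv]

lemma linOp_add (hV : Differentiable ℝ V) {f g : ℝ → 𝕜} (hf : ContDiff ℝ 4 f)
    (hg : ContDiff ℝ 4 g) (y : ℝ) :
    linOp δ k c V (fun z => f z + g z) y = linOp δ k c V f y + linOp δ k c V g y := by
  have hf' := hf.differentiable (by simp)
  have hg' := hg.differentiable (by simp)
  have i : ∀ n : ℕ, n ≤ 4 → iteratedDeriv n (fun z => f z + g z) y
      = iteratedDeriv n f y + iteratedDeriv n g y := fun n hn => by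
    have hn' : (n : ℕ∞ω) ≤ 4 := by exact_mod_cast hn
    exact iteratedDeriv_fun_add (hf.of_le hn').contDiffAt (hg.of_le hn').contDiffAt
  rw [linOp_eq hV hf', linOp_eq hV hg', linOp_eq hV (hf'.fun_add hg'), i 2 (by lia), i 3 (by lia),
    i 4 le_rfl, deriv_fun_add (hf' y) (hg' y)]
  ring

lemma linOp_const_mul (hV : Differentiable ℝ V) (a : 𝕜) {f : ℝ → 𝕜} (hf : ContDiff ℝ 4 f)
    (y : ℝ) : linOp δ k c V (fun z => a * f z) y = a * linOp δ k c V f y := by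
  have hf' := hf.differentiable (by simp)
  have i : ∀ n : ℕ, n ≤ 4 → iteratedDeriv n (fun z => a * f z) y = a * iteratedDeriv n f y :=
    fun n hn => by
      have hn' : (n : ℕ∞ω) ≤ 4 := by exact_mod_cast hn
      exact iteratedDeriv_const_mul a (hf.of_le hn').contDiffAt
  rw [linOp_eq hV hf', linOp_eq hV (hf'.const_mul a), i 2 (by lia), i 3 (by lia),
    i 4 le_rfl, deriv_const_mul a (hf' y)]
  ring

lemma iteratedDeriv_clm_comp {E F : Type*} [NormedAddCommGroup E] [NormedSpace ℝ E]
    [NormedAddCommGroup F] [NormedSpace ℝ F] (L : E →L[ℝ] F) {f : ℝ → E} {n : ℕ}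
    (hf : ContDiff ℝ n f) (y : ℝ) :
    iteratedDeriv n (fun z => L (f z)) y = L (iteratedDeriv n f y) := by
  have := L.iteratedFDeriv_comp_left (hf.contDiffAt (x := y)) le_rfl
  rw [iteratedDeriv_eq_iteratedFDeriv, iteratedDeriv_eq_iteratedFDeriv]
  change iteratedFDeriv ℝ n (L ∘ f) y _ = _
  rw [this]; rfl

lemma linOp_ofReal (hV : Differentiable ℝ V) {f : ℝ → ℝ} (hf : ContDiff ℝ 4 f) (y : ℝ) :
    linOp δ k c V (fun z => (f z : ℂ)) y = ((linOp δ k c V f y : ℝ) : ℂ) := by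
  have hf' := hf.differentiable (by simp)
  have i : ∀ n : ℕ, n ≤ 4 → iteratedDeriv n (fun z => (f z : ℂ)) y
      = ((iteratedDeriv n f y : ℝ) : ℂ) :=
    fun n hn => by
      have hn' : (n : ℕ∞ω) ≤ 4 := by exact_mod_cast hn
      exact iteratedDeriv_clm_comp Complex.ofRealCLM (hf.of_le hn') y
  have d : HasDerivAt (fun z => (f z : ℂ)) ((deriv f y : ℝ) : ℂ) y := (hf' y).hasDerivAt.ofReal_comp
  rw [linOp_eq hV hf', linOp_eq hV (fun z => (hf' z).hasDerivAt.ofReal_comp.differentiableAt),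
    i 2 (by lia), i 3 (by lia), i 4 le_rfl, d.deriv]
  simp

/-- The coefficients are real. Applied to the real and imaginary parts, this reduces complex
uniqueness, kernel and solvability questions to real ones. -/
lemma linOp_clm (hV : Differentiable ℝ V) (L : ℂ →L[ℝ] ℝ) {f : ℝ → ℂ} (hf : ContDiff ℝ 4 f)
    (y : ℝ) : linOp δ k c V (fun z => L (f z)) y = L (linOp δ k c V f y) := by
  have hf' := hf.differentiable (by simp)
  have i : ∀ n : ℕ, n ≤ 4 → iteratedDeriv n (fun z => L (f z)) y = L (iteratedDeriv n f y) :=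
    fun n hn => by
      have hn' : (n : ℕ∞ω) ≤ 4 := by exact_mod_cast hn
      exact iteratedDeriv_clm_comp L (hf.of_le hn') y
  have d : HasDerivAt (fun z => L (f z)) (L (deriv f y)) y :=
    L.hasFDerivAt.comp_hasDerivAt y (hf' y).hasDerivAt
  have hr : ∀ (a : ℝ) (z : ℂ), L ((a : ℂ) * z) = a * L z := fun a z => by
    rw [← Complex.real_smul, map_smul, smul_eq_mul]
  have hp : ∀ (a : ℝ) (n : ℕ) (z : ℂ), L ((a : ℂ) ^ n * z) = a ^ n * L z := fun a n z => by
    rw [← hr, Complex.ofReal_pow]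
  rw [linOp_eq hV hf', linOp_eq hV (f := fun z => L (f z))
    (fun z => (L.hasFDerivAt.comp_hasDerivAt z (hf' z).hasDerivAt).differentiableAt),
    i 2 (by lia), i 3 (by lia), i 4 le_rfl, d.deriv]
  simp only [RCLike.ofReal_real_eq_id, id_eq, Complex.coe_algebraMap, map_add, hr, hp]

end LinOp

/-! ### Averages over a period. -/

section Mean

variable {E : Type*} [NormedAddCommGroup E] [NormedSpace ℝ E]

lemma mean_add {f g : ℝ → E} (hf : Continuous f) (hg : Continuous g) :
    mean (fun y => f y + g y) = mean f + mean g :=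
  intervalIntegral.integral_add (hf.intervalIntegrable _ _) (hg.intervalIntegrable _ _)

lemma mean_sub {f g : ℝ → E} (hf : Continuous f) (hg : Continuous g) :
    mean (fun y => f y - g y) = mean f - mean g :=
  intervalIntegral.integral_sub (hf.intervalIntegrable _ _) (hg.intervalIntegrable _ _)

lemma mean_const_mul {𝕜 : Type*} [RCLike 𝕜] (a : 𝕜) (f : ℝ → 𝕜) :
    mean (fun y => a * f y) = a * mean f :=
  intervalIntegral.integral_const_mul a f

@[simp] lemma mean_const [CompleteSpace E] (a : E) : mean (fun _ : ℝ => a) = a := by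
  simp [mean]

lemma mean_ofReal (f : ℝ → ℝ) : mean (fun y => (f y : ℂ)) = ((mean f : ℝ) : ℂ) :=
  intervalIntegral.integral_ofReal

lemma mean_deriv [CompleteSpace E] {f : ℝ → E} (hf : ContDiff ℝ 1 f)
    (hp : Function.Periodic f 1) : mean (deriv f) = 0 := by
  rw [mean, intervalIntegral.integral_deriv_eq_sub
    (fun y _ => (hf.differentiable (by simp)) y)
    ((hf.continuous_deriv (by simp)).intervalIntegrable _ _)]
  have := hp 0
  rw [zero_add] at this
  rw [this, sub_self]

lemma periodic_deriv {f : ℝ → E} (hp : Function.Periodic f 1) : Function.Periodic (deriv f) 1 :=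
  fun y => by
    rw [← deriv_comp_add_const]
    congr 1
    exact funext hp

lemma periodic_iteratedDeriv {f : ℝ → E} (hp : Function.Periodic f 1) (n : ℕ) :
    Function.Periodic (iteratedDeriv n f) 1 := by
  induction n with
  | zero => simpa [iteratedDeriv_zero] using hp
  | succ n ih => rw [iteratedDeriv_succ]; exact periodic_deriv ih

lemma mean_iteratedDeriv_succ [CompleteSpace E] {f : ℝ → E} {n : ℕ}
    (hf : ContDiff ℝ (n + 1 : ℕ) f) (hp : Function.Periodic f 1) :
    mean (iteratedDeriv (n + 1) f) = 0 := by
  rw [iteratedDeriv_succ]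
  refine mean_deriv ?_ (periodic_iteratedDeriv hp n)
  rw [add_comm] at hf
  rw [iteratedDeriv_eq_iterate]
  exact_mod_cast hf.iterate_deriv' 1 n

lemma mean_eq_zero_of_sq {f : ℝ → ℝ} (hf : Continuous f) (hp : Function.Periodic f 1)
    (h : mean (fun y => f y * f y) = 0) (y : ℝ) : f y = 0 := by
  by_contra hy
  obtain ⟨z, hz, hyz⟩ := hp.exists_mem_Ico₀ one_pos y
  have hz0 : f z ≠ 0 := hyz ▸ hy
  have hpos : 0 < ∫ y in (0 : ℝ)..1, f y * f y := by
    refine intervalIntegral.integral_pos one_pos (hf.mul hf).continuousOn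
      (fun x _ => mul_self_nonneg _) ⟨z, ⟨hz.1, hz.2.le⟩, ?_⟩
    exact mul_self_pos.mpr hz0
  exact hpos.ne' h

end Mean

/-! ### Galilean invariance and derivatives of the profile equation. -/

namespace IsWaveFamily

variable {δ : ℝ} {K : Set ℝ} {U : ℝ → ℝ → ℝ → ℝ} {c : ℝ → ℝ → ℝ}

/-- Profiles of other means differ from these by a constant, so from here on the wavenumber is the
only parameter that needs calculus. -/
lemma smoothFam (hU : IsWaveFamily δ K U c) : SmoothFam K fun k => U k 0 :=
  ContDiffOn.comp (g := fun p : ℝ × ℝ × ℝ => U p.1 p.2.1 p.2.2)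
    (f := fun p : ℝ × ℝ => (p.1, (0 : ℝ), p.2)) hU.smooth_U (by fun_prop)
    (fun _ hp => ⟨hp.1, trivial⟩)

lemma U_eq (hU : IsWaveFamily δ K U c) {k : ℝ} (hk : k ∈ K) (M : ℝ) :
    U k M = fun y => M + U k 0 y := funext (hU.galilean k hk M)

lemma contDiff_U (hU : IsWaveFamily δ K U c) {k : ℝ} (hk : k ∈ K) (M : ℝ) :
    ContDiff ℝ ∞ (U k M) := by
  rw [hU.U_eq hk]; exact contDiff_const.add (hU.smoothFam.contDiff hk)

lemma differentiable_U (hU : IsWaveFamily δ K U c) {k : ℝ} (hk : k ∈ K) (M : ℝ) :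
    Differentiable ℝ (U k M) := (hU.contDiff_U hk M).differentiable (by simp)

lemma deriv_U (hU : IsWaveFamily δ K U c) {k : ℝ} (hk : k ∈ K) (M : ℝ) :
    deriv (U k M) = deriv (U k 0) := by
  funext y; rw [hU.U_eq hk M, deriv_const_add]

lemma iteratedDeriv_U (hU : IsWaveFamily δ K U c) {k : ℝ} (hk : k ∈ K) (M : ℝ) (n : ℕ) :
    iteratedDeriv (n + 1) (U k M) = iteratedDeriv (n + 1) (U k 0) := by
  rw [iteratedDeriv_succ', iteratedDeriv_succ', hU.deriv_U hk M]

lemma contDiff_deriv_U (hU : IsWaveFamily δ K U c) {k : ℝ} (hk : k ∈ K) (M : ℝ) :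
    ContDiff ℝ ∞ (deriv (U k M)) := by
  rw [hU.deriv_U hk]; exact (hU.smoothFam.deriv_phase hU.isOpen).contDiff hk

/-- The Jordan chain above the translation mode. It explains why the average of a correction has to
be prescribed before a coefficient of `U'` carries information. -/
lemma linOp_one (hU : IsWaveFamily δ K U c) {k : ℝ} (hk : k ∈ K) (M : ℝ) (y : ℝ) :
    linOp δ k (c k M) (U k M) (fun _ => (1 : ℝ)) y = 6 * k * deriv (U k M) y := by
  rw [linOp_eq (hU.differentiable_U hk M) (differentiable_const 1)]
  simp [iteratedDeriv_const]
  ring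

/-- Nonconstancy is hidden in the kernel hypothesis: for a constant wave `L 1 = 0`, so `1` would be
a multiple of `U' = 0`. -/
lemma exists_deriv_ne_zero (hU : IsWaveFamily δ K U c) {k : ℝ} (hk : k ∈ K) (M : ℝ) :
    ∃ y, deriv (U k M) y ≠ 0 := by
  by_contra! h
  obtain ⟨a, ha⟩ := hU.kernel k hk M (fun _ => 1) contDiff_const (fun _ => rfl)
    (fun y => by rw [hU.linOp_one hk, h y, mul_zero])
  simpa [h 0] using ha 0

lemma hasDerivAt_iteratedDeriv {f : ℝ → ℝ} (hf : ContDiff ℝ ∞ f) (n : ℕ) (y : ℝ) :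
    HasDerivAt (iteratedDeriv n f) (iteratedDeriv (n + 1) f y) y := by
  rw [iteratedDeriv_succ]
  refine DifferentiableAt.hasDerivAt ?_
  exact hf.differentiable_iteratedDeriv n (WithTop.coe_lt_coe.mpr (ENat.natCast_lt_top n)) y

/-- The profile equation, differentiated once. -/
lemma profile_deriv (hU : IsWaveFamily δ K U c) {k : ℝ} (hk : k ∈ K) (M : ℝ) (y : ℝ) :
    k * ((6 * U k M y - c k M) * deriv (U k M) y) + k ^ 3 * iteratedDeriv 3 (U k M) y
      + δ * (k ^ 2 * iteratedDeriv 2 (U k M) y + k ^ 4 * iteratedDeriv 4 (U k M) y) = 0 := by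
  obtain ⟨q, hq⟩ := hU.profile k hk M
  have h0 : HasDerivAt (U k M) (deriv (U k M) y) y := (hU.differentiable_U hk M y).hasDerivAt
  have hs := hU.contDiff_U hk M
  have h1 := hasDerivAt_iteratedDeriv hs 1 y
  rw [iteratedDeriv_one] at h1
  have h2 := hasDerivAt_iteratedDeriv hs 2 y
  have h3 := hasDerivAt_iteratedDeriv hs 3 y
  have h := ((((h0.fun_pow 2).const_mul 3).sub (h0.const_mul (c k M))).const_mul k).add
    (h2.const_mul (k ^ 3)) |>.add (((h1.const_mul (k ^ 2)).add (h3.const_mul (k ^ 4))).const_mul δ)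
  have hc := (hasDerivAt_const y q).congr_of_eventuallyEq (Eventually.of_forall hq)
  have := h.unique hc
  simp only [Nat.reduceAdd] at this
  rw [← this]; push_cast; ring

/-- Translation invariance: this is one more phase derivative of the differentiated profile
equation. -/
lemma linOp_deriv_U (hU : IsWaveFamily δ K U c) {k : ℝ} (hk : k ∈ K) (M : ℝ) (y : ℝ) :
    linOp δ k (c k M) (U k M) (deriv (U k M)) y = 0 := by
  have hs := hU.contDiff_U hk M
  have h0 : HasDerivAt (U k M) (deriv (U k M) y) y := (hU.differentiable_U hk M y).hasDerivAt
  have h1 := hasDerivAt_iteratedDeriv hs 1 y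
  rw [iteratedDeriv_one] at h1
  have h := ((((h0.const_mul 6).sub_const (c k M)).fun_mul h1).const_mul k).add
    ((hasDerivAt_iteratedDeriv hs 3 y).const_mul (k ^ 3)) |>.add
    ((((hasDerivAt_iteratedDeriv hs 2 y).const_mul (k ^ 2)).add
      ((hasDerivAt_iteratedDeriv hs 4 y).const_mul (k ^ 4))).const_mul δ)
  have hc := (hasDerivAt_const y (0 : ℝ)).congr_of_eventuallyEq
    (Eventually.of_forall (hU.profile_deriv hk M))
  have := h.unique hc
  simp only [Nat.reduceAdd] at this
  rw [linOp_eq (hU.differentiable_U hk M)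
    ((hU.contDiff_deriv_U hk M).differentiable (by simp)), ← iteratedDeriv_succ',
    ← iteratedDeriv_succ', ← iteratedDeriv_succ', ← this]
  rw [show deriv (deriv (U k M)) y = iteratedDeriv 2 (U k M) y by
    simp [iteratedDeriv_succ', iteratedDeriv_zero]]
  simp only [RCLike.ofReal_real_eq_id, id_eq]

/-- The differentiated profile equations for the means `M` and `0` differ only in the term `k (6U -
c) U'`; they are compared at a phase where `U'` does not vanish. Thus `6U - c`, and with it `L`,
does not depend on the mean. -/
lemma speed_eq (hU : IsWaveFamily δ K U c) {k : ℝ} (hk : k ∈ K) (M : ℝ) :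
    c k M = c k 0 + 6 * M := by
  obtain ⟨y, hy⟩ := hU.exists_deriv_ne_zero hk 0
  have h1 := hU.profile_deriv hk M y
  have h0 := hU.profile_deriv hk 0 y
  rw [hU.iteratedDeriv_U hk M 2, hU.iteratedDeriv_U hk M 3, hU.iteratedDeriv_U hk M 1,
    hU.deriv_U hk M, hU.galilean k hk M y] at h1
  have hk0 := (hU.pos k hk).ne'
  have : (k * deriv (U k 0) y) * (c k M - (c k 0 + 6 * M)) = 0 := by linear_combination h0 - h1
  rcases mul_eq_zero.mp this with h | h
  · exact absurd h (mul_ne_zero hk0 hy)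
  · linarith

lemma contDiffOn_speed (hU : IsWaveFamily δ K U c) (M : ℝ) :
    ContDiffOn ℝ ∞ (fun s => c s M) K :=
  ContDiffOn.comp (g := fun p : ℝ × ℝ => c p.1 p.2) (f := fun s : ℝ => (s, M)) hU.smooth_c
    (by fun_prop) (fun _ hs => ⟨hs, trivial⟩)

lemma hasDerivAt_speed (hU : IsWaveFamily δ K U c) {k : ℝ} (hk : k ∈ K) (M : ℝ) :
    HasDerivAt (fun s => c s M) (dk c k M) k :=
  (((hU.contDiffOn_speed M).contDiffAt (hU.isOpen.mem_nhds hk)).differentiableAt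
    (by simp)).hasDerivAt

lemma dk_speed (hU : IsWaveFamily δ K U c) {k : ℝ} (hk : k ∈ K) (M : ℝ) :
    dk c k M = dk c k 0 := by
  refine (HasDerivAt.congr_of_eventuallyEq ((hU.hasDerivAt_speed hk 0).add_const (6 * M)) ?_).deriv
  filter_upwards [hU.isOpen.mem_nhds hk] with s hs using hU.speed_eq hs M

lemma dM_speed (hU : IsWaveFamily δ K U c) {k : ℝ} (hk : k ∈ K) (M : ℝ) : dM c k M = 6 := by
  rw [dM, show (fun s => c k s) = fun s => c k 0 + 6 * s from funext (hU.speed_eq hk)]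
  simp

lemma dkU_eq (hU : IsWaveFamily δ K U c) {k : ℝ} (hk : k ∈ K) (M : ℝ) :
    dkU U k M = dkU U k 0 := by
  funext y
  have h : (fun s => U s M y) =ᶠ[𝓝 k] fun s => M + U s 0 y := by
    filter_upwards [hU.isOpen.mem_nhds hk] with s hs using hU.galilean s hs M y
  exact h.deriv_eq.trans (deriv_const_add _)

lemma dMU_eq (hU : IsWaveFamily δ K U c) {k : ℝ} (hk : k ∈ K) (M y : ℝ) : dMU U k M y = 1 := by
  simp only [dMU, dM]
  rw [show (fun s => U k s y) = fun s => s + U k 0 y from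
    funext fun s => hU.galilean k hk s y]
  simp

lemma smoothFam_dkU (hU : IsWaveFamily δ K U c) : SmoothFam K fun k => dkU U k 0 :=
  hU.smoothFam.deriv_param hU.isOpen

lemma contDiff_dkU (hU : IsWaveFamily δ K U c) {k : ℝ} (hk : k ∈ K) (M : ℝ) :
    ContDiff ℝ ∞ (dkU U k M) := by
  rw [hU.dkU_eq hk]; exact hU.smoothFam_dkU.contDiff hk

lemma periodic_dkU (hU : IsWaveFamily δ K U c) {k : ℝ} (hk : k ∈ K) (M : ℝ) :
    Function.Periodic (dkU U k M) 1 := fun y => by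
  have h : (fun s => U s M (y + 1)) =ᶠ[𝓝 k] fun s => U s M y := by
    filter_upwards [hU.isOpen.mem_nhds hk] with s hs using hU.periodic s hs M y
  exact h.deriv_eq

/-- The average of `U(k, 0)` vanishes for all `k`, and the average may be differentiated in `k`. -/
lemma mean_dkU (hU : IsWaveFamily δ K U c) {k : ℝ} (hk : k ∈ K) (M : ℝ) :
    mean (dkU U k M) = 0 := by
  rw [hU.dkU_eq hk]
  have h := hU.smoothFam.hasDerivAt_mean hU.isOpen hk
  have h' : (fun s => mean (U s 0)) =ᶠ[𝓝 k] fun _ => (0 : ℝ) := by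
    filter_upwards [hU.isOpen.mem_nhds hk] with s hs using hU.mean_eq s hs 0
  exact h.unique ((hasDerivAt_const k (0 : ℝ)).congr_of_eventuallyEq h')

lemma hasDerivAt_iteratedDeriv_param (hU : IsWaveFamily δ K U c) {k : ℝ} (hk : k ∈ K) (M : ℝ)
    (n : ℕ) (y : ℝ) :
    HasDerivAt (fun s => iteratedDeriv n (U s M) y) (iteratedDeriv n (dkU U k M) y) k := by
  have h0 := hU.smoothFam.hasDerivAt_iteratedDeriv hU.isOpen n hk y
  rw [hU.dkU_eq hk]
  rcases n with _ | n
  · refine (h0.const_add M).congr_of_eventuallyEq ?_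
    filter_upwards [hU.isOpen.mem_nhds hk] with s hs
    simpa [iteratedDeriv_zero] using hU.galilean s hs M y
  · refine h0.congr_of_eventuallyEq ?_
    filter_upwards [hU.isOpen.mem_nhds hk] with s hs
    rw [hU.iteratedDeriv_U hs M n]

/-- The profile equation, differentiated in the wavenumber. -/
lemma linOp_dkU (hU : IsWaveFamily δ K U c) {k : ℝ} (hk : k ∈ K) (M : ℝ) (y : ℝ) :
    linOp δ k (c k M) (U k M) (dkU U k M) y = k * dk c k M * deriv (U k M) y
      - ((6 * U k M y - c k M) * deriv (U k M) y + 3 * k ^ 2 * iteratedDeriv 3 (U k M) y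
        + δ * (2 * k * iteratedDeriv 2 (U k M) y + 4 * k ^ 3 * iteratedDeriv 4 (U k M) y)) := by
  have i : ∀ n, HasDerivAt (fun s => iteratedDeriv n (U s M) y)
      (iteratedDeriv n (dkU U k M) y) k := fun n => hU.hasDerivAt_iteratedDeriv_param hk M n y
  have i0 := i 0
  have i1 := i 1
  simp only [iteratedDeriv_zero] at i0
  simp only [iteratedDeriv_one] at i1
  have hid := hasDerivAt_id' k
  have h := (hid.fun_mul (((i0.const_mul 6).sub (hU.hasDerivAt_speed hk M)).fun_mul i1)).add
    ((hid.fun_pow 3).fun_mul (i 3)) |>.add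
    ((((hid.fun_pow 2).fun_mul (i 2)).add ((hid.fun_pow 4).fun_mul (i 4))).const_mul δ)
  have hc : HasDerivAt (fun s : ℝ => s * ((6 * U s M y - c s M) * deriv (U s M) y)
      + s ^ 3 * iteratedDeriv 3 (U s M) y
      + δ * (s ^ 2 * iteratedDeriv 2 (U s M) y + s ^ 4 * iteratedDeriv 4 (U s M) y)) 0 k := by
    refine (hasDerivAt_const k (0 : ℝ)).congr_of_eventuallyEq ?_
    filter_upwards [hU.isOpen.mem_nhds hk] with s hs using hU.profile_deriv hs M y
  have := h.unique hc
  rw [linOp_eq (hU.differentiable_U hk M) ((hU.contDiff_dkU hk M).differentiable (by simp))]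
  simp only [RCLike.ofReal_real_eq_id, id_eq]
  simp only [Pi.sub_apply] at this
  push_cast at this
  linear_combination this

end IsWaveFamily

/-! ### Existence and uniqueness of correctors. -/

namespace IsCorrector

variable {𝕜 : Type*} [RCLike 𝕜] {δ : ℝ} {U : ℝ → ℝ → ℝ → ℝ} {c : ℝ → ℝ → ℝ} {k M : ℝ}

lemma add {r s f g : ℝ → 𝕜} (hV : ContDiff ℝ ∞ (U k M))
    (hf : IsCorrector δ U c k M r f) (hg : IsCorrector δ U c k M s g) :
    IsCorrector δ U c k M (fun y => r y + s y) (fun y => f y + g y) := by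
  have hV' : Continuous (deriv (U k M)) := hV.continuous_deriv (by simp)
  refine ⟨hf.1.add hg.1, fun y => by simp only [hf.2.1 y, hg.2.1 y], fun y => ?_, ?_⟩
  · rw [linOp_add (hV.differentiable (by simp)) hf.1 hg.1, hf.2.2.1, hg.2.2.1]
  · simp only [add_mul]
    exact (mean_add (f := fun y => f y * ((deriv (U k M) y : ℝ) : 𝕜))
      (g := fun y => g y * ((deriv (U k M) y : ℝ) : 𝕜))
      (hf.1.continuous.mul (RCLike.continuous_ofReal.comp hV'))
      (hg.1.continuous.mul (RCLike.continuous_ofReal.comp hV'))).trans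
      (by rw [hf.2.2.2, hg.2.2.2, add_zero])

lemma const_mul {r f : ℝ → 𝕜} (hV : ContDiff ℝ ∞ (U k M)) (a : 𝕜)
    (hf : IsCorrector δ U c k M r f) :
    IsCorrector δ U c k M (fun y => a * r y) (fun y => a * f y) := by
  refine ⟨contDiff_const.mul hf.1, fun y => by simp only [hf.2.1 y], fun y => ?_, ?_⟩
  · rw [linOp_const_mul (hV.differentiable (by simp)) a hf.1, hf.2.2.1]
  · simp only [mul_assoc]
    rw [mean_const_mul, hf.2.2.2, mul_zero]

lemma ofReal {r f : ℝ → ℝ} (hV : ContDiff ℝ ∞ (U k M)) (hf : IsCorrector δ U c k M r f) :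
    IsCorrector δ U c k M (fun y => (r y : ℂ)) (fun y => (f y : ℂ)) := by
  refine ⟨Complex.ofRealCLM.contDiff.comp hf.1, fun y => by simp only [hf.2.1 y], fun y => ?_, ?_⟩
  · rw [linOp_ofReal (hV.differentiable (by simp)) hf.1, hf.2.2.1]
  · have h : (fun y => (f y : ℂ) * ((deriv (U k M) y : ℝ) : ℂ))
        = fun y => ((f y * deriv (U k M) y : ℝ) : ℂ) := by funext y; push_cast; rfl
    have h2 := hf.2.2.2
    simp only [RCLike.ofReal_real_eq_id, id_eq] at h2
    refine (congrArg mean h).trans ?_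
    rw [mean_ofReal, h2, Complex.ofReal_zero]

end IsCorrector

namespace IsWaveFamily

variable {δ : ℝ} {K : Set ℝ} {U : ℝ → ℝ → ℝ → ℝ} {c : ℝ → ℝ → ℝ}

lemma periodic_deriv_U (hU : IsWaveFamily δ K U c) {k : ℝ} (hk : k ∈ K) (M : ℝ) :
    Function.Periodic (deriv (U k M)) 1 := periodic_deriv (hU.periodic k hk M)

lemma mean_deriv_sq_ne_zero (hU : IsWaveFamily δ K U c) {k : ℝ} (hk : k ∈ K) (M : ℝ) :
    mean (fun y => deriv (U k M) y * deriv (U k M) y) ≠ 0 := fun h => by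
  obtain ⟨y, hy⟩ := hU.exists_deriv_ne_zero hk M
  exact hy (mean_eq_zero_of_sq (hU.contDiff_deriv_U hk M).continuous (hU.periodic_deriv_U hk M) h y)

lemma eq_zero_of_linOp (hU : IsWaveFamily δ K U c) {k : ℝ} (hk : k ∈ K) (M : ℝ) {f : ℝ → ℝ}
    (hf : ContDiff ℝ 4 f) (hp : Function.Periodic f 1)
    (h : ∀ y, linOp δ k (c k M) (U k M) f y = 0)
    (hm : mean (fun y => f y * deriv (U k M) y) = 0) (y : ℝ) : f y = 0 := by
  obtain ⟨a, ha⟩ := hU.kernel k hk M f hf hp h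
  simp only [ha, mul_assoc] at hm
  rw [show (fun y => a * (deriv (U k M) y * deriv (U k M) y))
    = fun y => a * ((fun z => deriv (U k M) z * deriv (U k M) z) y) from rfl, mean_const_mul] at hm
  rcases mul_eq_zero.mp hm with h | h
  · rw [ha, h, zero_mul]
  · exact absurd h (hU.mean_deriv_sq_ne_zero hk M)

lemma corrector_unique_real (hU : IsWaveFamily δ K U c) {k : ℝ} (hk : k ∈ K) (M : ℝ)
    {r f g : ℝ → ℝ} (hf : IsCorrector δ U c k M r f) (hg : IsCorrector δ U c k M r g) : f = g := by
  have h := hf.add (hU.contDiff_U hk M) (hg.const_mul (hU.contDiff_U hk M) (-1))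
  have h2 := h.2.2.2
  simp only [RCLike.ofReal_real_eq_id, id_eq] at h2
  funext y
  have := hU.eq_zero_of_linOp hk M h.1 h.2.1 (fun y => by rw [h.2.2.1 y]; ring) h2 y
  linarith

lemma corrector_clm (hU : IsWaveFamily δ K U c) {k : ℝ} (hk : k ∈ K) (M : ℝ) (L : ℂ →L[ℝ] ℝ)
    {r f : ℝ → ℂ} (hf : IsCorrector δ U c k M r f) :
    IsCorrector δ U c k M (fun y => L (r y)) (fun y => L (f y)) := by
  refine ⟨L.contDiff.comp hf.1, fun y => by simp only [hf.2.1 y], fun y => ?_, ?_⟩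
  · rw [linOp_clm (hU.differentiable_U hk M) L hf.1, hf.2.2.1]
  · have hc : Continuous fun y => f y * ((deriv (U k M) y : ℝ) : ℂ) :=
      hf.1.continuous.mul (Complex.continuous_ofReal.comp (hU.contDiff_deriv_U hk M).continuous)
    have h1 : mean (fun y => L (f y * ((deriv (U k M) y : ℝ) : ℂ))) = 0 := by
      rw [mean, L.intervalIntegral_comp_comm (hc.intervalIntegrable _ _)]
      exact (congrArg L hf.2.2.2).trans (map_zero L)
    rw [← h1]
    congr 1
    funext y
    rw [mul_comm (f y), ← Complex.real_smul, map_smul, smul_eq_mul, mul_comm]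
    rfl

lemma corrector_unique (hU : IsWaveFamily δ K U c) {k : ℝ} (hk : k ∈ K) (M : ℝ)
    {r f g : ℝ → ℂ} (hf : IsCorrector δ U c k M r f) (hg : IsCorrector δ U c k M r g) : f = g := by
  have h := fun L => hU.corrector_unique_real hk M (hU.corrector_clm hk M L hf)
    (hU.corrector_clm hk M L hg)
  funext y
  exact Complex.ext (congrFun (h Complex.reCLM) y) (congrFun (h Complex.imCLM) y)

lemma kernel_complex (hU : IsWaveFamily δ K U c) {k : ℝ} (hk : k ∈ K) (M : ℝ) {f : ℝ → ℂ}
    (hf : ContDiff ℝ 4 f) (hp : Function.Periodic f 1)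
    (h : ∀ y, linOp δ k (c k M) (U k M) f y = 0) :
    ∃ a : ℂ, ∀ y, f y = a * ((deriv (U k M) y : ℝ) : ℂ) := by
  have key : ∀ L : ℂ →L[ℝ] ℝ, ∃ a : ℝ, ∀ y, L (f y) = a * deriv (U k M) y := fun L =>
    hU.kernel k hk M (fun y => L (f y)) (L.contDiff.comp hf) (fun y => by simp only [hp y])
      (fun y => by rw [linOp_clm (hU.differentiable_U hk M) L hf, h y, map_zero])
  obtain ⟨a, ha⟩ := key Complex.reCLM
  obtain ⟨b, hb⟩ := key Complex.imCLM
  refine ⟨⟨a, b⟩, fun y => Complex.ext ?_ ?_⟩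
  · simpa using ha y
  · simpa using hb y

/-- The linearization at wavenumber `k`, augmented by the functional `f ↦ <f U'>`. -/
noncomputable def augOp (δ : ℝ) (U : ℝ → ℝ → ℝ → ℝ) (c : ℝ → ℝ → ℝ) (k : ℝ) : PerC →L[ℝ] PerC :=
  perOp (δ * k ^ 4) (k ^ 3) (δ * k ^ 2) (perC fun y => k * (6 * U k 0 y - c k 0))
    (perC fun y => 6 * k * deriv (U k 0) y) (perC (deriv (U k 0)))

/-- `f'''' + <f>`, where `f` is the solution of `L f + <f U'> = r`. -/
noncomputable def solve (δ : ℝ) (U : ℝ → ℝ → ℝ → ℝ) (c : ℝ → ℝ → ℝ) (k : ℝ) (r : ℝ → ℝ) : PerC :=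
  Ring.inverse (augOp δ U c k) (perC r)

/-- The augmented operator is built at mean `0` yet represents `L_{k,M}` for every `M`, since `6U -
c` and `U'` are Galilean invariant. -/
lemma augOp_coe (hU : IsWaveFamily δ K U c) {k : ℝ} (hk : k ∈ K) (M : ℝ) (w : PerC) (y : ℝ) :
    augOp δ U c k w (y : AddCircle (1 : ℝ))
      = linOp δ k (c k M) (U k M) (fun y : ℝ => prim₄ w (y : AddCircle (1 : ℝ))) y
        + mean (fun y : ℝ => prim₄ w (y : AddCircle (1 : ℝ)) * deriv (U k M) y) := by
  obtain ⟨h0, h1, h2, h3, h4⟩ := prim₄_regular w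
  have hc := (hU.contDiff_U hk 0).continuous
  have hp := hU.periodic k hk 0
  have hc' := (hU.contDiff_deriv_U hk 0).continuous
  have hp' := hU.periodic_deriv_U hk 0
  rw [linOp_eq (hU.differentiable_U hk M) (h0.differentiable (by simp)), h1, h2, h3, h4,
    augOp, perOp_apply, perC_coe (by fun_prop) (fun y => by simp only [hp y]),
    perC_coe (by fun_prop) (fun y => by simp only [hp' y]), hU.speed_eq hk M, hU.deriv_U hk M,
    hU.galilean k hk M y, meanL_apply (perC (deriv (U k 0)) * prim₄ w)]
  have hm : (fun y : ℝ => (perC (deriv (U k 0)) * prim₄ w) (y : AddCircle (1 : ℝ)))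
      = fun y : ℝ => prim₄ w (y : AddCircle (1 : ℝ)) * deriv (U k 0) y := by
    funext z
    rw [ContinuousMap.mul_apply, perC_coe hc' hp', mul_comm]
  rw [hm]
  simp only [RCLike.ofReal_real_eq_id, id_eq]
  ring

/-- Every term of `L f` is a derivative of a periodic function. This is the solvability condition
used at every order. -/
lemma mean_linOp (hU : IsWaveFamily δ K U c) {k : ℝ} (hk : k ∈ K) (M : ℝ) {𝕜 : Type*} [RCLike 𝕜]
    {f : ℝ → 𝕜} (hf : ContDiff ℝ 4 f) (hp : Function.Periodic f 1) :
    mean (linOp δ k (c k M) (U k M) f) = 0 := by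
  have hV : ContDiff ℝ 4 fun z => ((6 * U k M z - c k M : ℝ) : 𝕜) := by
    have h : ContDiff ℝ 4 (U k M) := (hU.contDiff_U hk M).of_le (by
      exact WithTop.coe_le_coe.mpr (le_top : (4 : ℕ∞) ≤ ⊤))
    exact (RCLike.ofRealCLM (K := 𝕜)).contDiff.comp
      ((contDiff_const.mul h).sub contDiff_const)
  have hVf := hV.mul hf
  have hpV : Function.Periodic (fun z => ((6 * U k M z - c k M : ℝ) : 𝕜) * f z) 1 := fun z => by
    simp only [hU.periodic k hk M z, hp z]
  have hi : ∀ n : ℕ, n ≤ 4 → Continuous (iteratedDeriv n f) := fun n hn =>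
    hf.continuous_iteratedDeriv n (by exact_mod_cast hn)
  have hm : ∀ n : ℕ, n + 1 ≤ 4 → mean (iteratedDeriv (n + 1) f) = 0 := fun n hn =>
    mean_iteratedDeriv_succ (hf.of_le (by exact_mod_cast hn)) hp
  have hd : Continuous (deriv fun z => ((6 * U k M z - c k M : ℝ) : 𝕜) * f z) :=
    hVf.continuous_deriv (by norm_num)
  have i2 := hi 2 (by lia)
  have i3 := hi 3 (by lia)
  have i4 := hi 4 le_rfl
  unfold linOp
  rw [mean_add (by fun_prop) (by fun_prop), mean_add (by fun_prop) (by fun_prop), mean_const_mul,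
    mean_const_mul, mean_const_mul, mean_add (by fun_prop) (by fun_prop), mean_const_mul,
    mean_const_mul, hm 1 (by lia), hm 2 (by lia), hm 3 (by lia),
    mean_deriv (hVf.of_le (by norm_num)) hpV]
  ring

/-- If `L f + <f U'> = 0`, averaging gives `<f U'> = 0`, hence `L f = 0`, so `f` is a multiple of
`U'` orthogonal to `U'`, that is `f = 0`. The added functional fills the one-dimensional cokernel
(the constants) and kills the one-dimensional kernel at the same time. The leading coefficient `δ
k⁴` is nonzero because `δ` and `k` are positive. -/
lemma isUnit_augOp (hδ : 0 < δ) (hU : IsWaveFamily δ K U c) {k : ℝ} (hk : k ∈ K) :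
    IsUnit (augOp δ U c k) := by
  have hk0 := hU.pos k hk
  refine isUnit_perOp (by positivity) _ _ _ _ _ fun w hw => ?_
  have hw' : ∀ y : ℝ, linOp δ k (c k 0) (U k 0) (fun y : ℝ => prim₄ w (y : AddCircle (1 : ℝ))) y
      + mean (fun y : ℝ => prim₄ w (y : AddCircle (1 : ℝ)) * deriv (U k 0) y) = 0 := fun y => by
    rw [← hU.augOp_coe hk 0 w y]
    exact congrArg (fun v : PerC => v (y : AddCircle (1 : ℝ))) hw
  obtain ⟨h0, h1, h2, h3, h4⟩ := prim₄_regular w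
  have hm : mean (fun y : ℝ => prim₄ w (y : AddCircle (1 : ℝ)) * deriv (U k 0) y) = 0 := by
    have h := hU.mean_linOp hk 0 h0 (prim₄ w).periodic_coe
    rw [show linOp δ k (c k 0) (U k 0) (fun y : ℝ => prim₄ w (y : AddCircle (1 : ℝ)))
      = fun _ => -mean (fun y : ℝ => prim₄ w (y : AddCircle (1 : ℝ)) * deriv (U k 0) y) from
      funext fun y => by linarith [hw' y], mean_const] at h
    linarith
  have hz := hU.eq_zero_of_linOp hk 0 h0 (prim₄ w).periodic_coe
    (fun y => by linarith [hw' y]) hm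
  have hz' : prim₄ w = 0 := PerC.ext_coe hz
  -- From `f = 0` the unknown `w` is recovered through `<w> = <f>` and `w - <w> = f''''`.
  have hmw : meanL w = 0 := by rw [← meanL_prim₄, hz', map_zero]
  refine PerC.ext_coe fun y => ?_
  have h5 := congrFun h4 y
  rw [show (fun y : ℝ => prim₄ w (y : AddCircle (1 : ℝ))) = fun _ => (0 : ℝ) from funext hz,
    hmw] at h5
  simpa [iteratedDeriv_const] using h5.symm

/-- The solution of `L f + <f U'> = r` is automatically normalized: averaging the equation gives `<f
U'> = <r> = 0`, and then `L f = r`. -/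
lemma isCorrector_solve (hδ : 0 < δ) (hU : IsWaveFamily δ K U c) {k : ℝ} (hk : k ∈ K) (M : ℝ)
    {r : ℝ → ℝ} (hr : Continuous r) (hp : Function.Periodic r 1) (hm : mean r = 0) :
    IsCorrector δ U c k M r (fun y : ℝ => prim₄ (solve δ U c k r) (y : AddCircle (1 : ℝ))) := by
  obtain ⟨h0, -⟩ := prim₄_regular (solve δ U c k r)
  have he := perOp_inverse_apply (hU.isUnit_augOp hδ hk) (perC r)
  have hw' : ∀ y : ℝ, linOp δ k (c k M) (U k M)
      (fun y : ℝ => prim₄ (solve δ U c k r) (y : AddCircle (1 : ℝ))) y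
      + mean (fun y : ℝ => prim₄ (solve δ U c k r) (y : AddCircle (1 : ℝ)) * deriv (U k M) y)
      = r y := fun y => by
    rw [← hU.augOp_coe hk M _ y, ← perC_coe hr hp y]
    exact congrArg (fun v : PerC => v (y : AddCircle (1 : ℝ))) he
  have hm0 : mean (fun y : ℝ => prim₄ (solve δ U c k r) (y : AddCircle (1 : ℝ))
      * deriv (U k M) y) = 0 := by
    have h := hU.mean_linOp hk M h0 (prim₄ (solve δ U c k r)).periodic_coe
    rw [show linOp δ k (c k M) (U k M)
        (fun y : ℝ => prim₄ (solve δ U c k r) (y : AddCircle (1 : ℝ)))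
      = fun y => r y - mean (fun y : ℝ => prim₄ (solve δ U c k r) (y : AddCircle (1 : ℝ))
        * deriv (U k M) y) from funext fun y => by linarith [hw' y],
      mean_sub hr continuous_const, hm, mean_const] at h
    linarith
  refine ⟨h0, (prim₄ _).periodic_coe, fun y => by linarith [hw' y], ?_⟩
  simpa using hm0

lemma existsUnique_complex (hδ : 0 < δ) (hU : IsWaveFamily δ K U c) {k : ℝ} (hk : k ∈ K) (M : ℝ)
    {r : ℝ → ℂ} (hr : Continuous r) (hp : Function.Periodic r 1) (hm : mean r = 0) :
    ∃! f : ℝ → ℂ, IsCorrector δ U c k M r f := by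
  have key : ∀ L : ℂ →L[ℝ] ℝ, ∃ f : ℝ → ℝ, IsCorrector δ U c k M (fun y => L (r y)) f := fun L =>
    ⟨_, hU.isCorrector_solve hδ hk M (L.continuous.comp hr) (fun y => by simp only [hp y]) (by
      rw [mean, L.intervalIntegral_comp_comm (hr.intervalIntegrable _ _)]
      exact (congrArg L hm).trans (map_zero L))⟩
  obtain ⟨f, hf⟩ := key Complex.reCLM
  obtain ⟨g, hg⟩ := key Complex.imCLM
  have hV := hU.contDiff_U hk M
  have h := (hf.ofReal hV).add hV ((hg.ofReal hV).const_mul hV Complex.I)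
  have hr' : (fun y => (Complex.reCLM (r y) : ℂ) + Complex.I * (Complex.imCLM (r y) : ℂ)) = r := by
    funext y
    rw [mul_comm]; exact Complex.re_add_im (r y)
  rw [hr'] at h
  exact ⟨_, h, fun _ hg => hU.corrector_unique hk M hg h⟩

lemma corrector_eq {𝕜 : Type*} [RCLike 𝕜] {k M : ℝ} {r f : ℝ → 𝕜}
    (h : ∃! f : ℝ → 𝕜, IsCorrector δ U c k M r f) (hf : IsCorrector δ U c k M r f) :
    corrector δ U c k M r = f :=
  h.unique (Classical.epsilon_spec ⟨f, hf⟩) hf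

end IsWaveFamily

/-! ### Galilean reduction of the sources. -/

namespace IsWaveFamily

variable {δ : ℝ} {K : Set ℝ} {U : ℝ → ℝ → ℝ → ℝ} {c : ℝ → ℝ → ℝ}

/-- The part of the coefficient of `∂_X k` in the source of the corrector that does not depend on
the mean. -/
noncomputable def srcX (δ : ℝ) (U : ℝ → ℝ → ℝ → ℝ) (k y : ℝ) : ℝ :=
  6 * (U k 0 y * dkU U k 0 y - mean fun z => U k 0 z * dkU U k 0 z)
    + 3 * (k ^ 2 * iteratedDeriv 2 (dkU U k 0) y + k * iteratedDeriv 2 (U k 0) y)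
    + δ * (2 * k * deriv (dkU U k 0) y + deriv (U k 0) y)
    + δ * (4 * k ^ 3 * iteratedDeriv 3 (dkU U k 0) y + 6 * k ^ 2 * iteratedDeriv 3 (U k 0) y)

lemma mean_U_zero (hU : IsWaveFamily δ K U c) {k : ℝ} (hk : k ∈ K) : mean (U k 0) = 0 :=
  hU.mean_eq k hk 0

/-- `U - <U>` is the profile of mean `0`, whatever `M` is. This is why `∂_T M` disappears from the
corrector and `Λ₀` from `v^M`. -/
lemma hasDerivAt_sub_mean (hU : IsWaveFamily δ K U c) {k : ℝ} (hk : k ∈ K) (M y : ℝ) :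
    dk (fun k M => U k M y - mean (U k M)) k M = dkU U k 0 y ∧
      dM (fun k M => U k M y - mean (U k M)) k M = 0 := by
  have h : ∀ s ∈ K, ∀ M, U s M y - mean (U s M) = U s 0 y := fun s hs M => by
    rw [hU.mean_eq s hs, hU.galilean s hs]; ring
  constructor
  · refine Filter.EventuallyEq.deriv_eq ?_
    filter_upwards [hU.isOpen.mem_nhds hk] with s hs using h s hs M
  · rw [dM, show (fun s => U k s y - mean (U k s)) = fun _ => U k 0 y from funext (h k hk)]
    simp

lemma smoothFam_sq (hU : IsWaveFamily δ K U c) : SmoothFam K fun k y => U k 0 y ^ 2 :=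
  ContDiffOn.pow hU.smoothFam 2

lemma hasDerivAt_mean_sq (hU : IsWaveFamily δ K U c) {k : ℝ} (hk : k ∈ K) :
    HasDerivAt (fun s => mean fun y => U s 0 y ^ 2)
      (2 * mean fun y => U k 0 y * dkU U k 0 y) k := by
  have h := hU.smoothFam_sq.hasDerivAt_mean hU.isOpen hk
  have e : (fun y => deriv (fun s => U s 0 y ^ 2) k)
      = fun y => 2 * (U k 0 y * dkU U k 0 y) := by
    funext y
    have := (hU.smoothFam.differentiableAt_param hU.isOpen hk y).hasDerivAt.fun_pow 2
    rw [this.deriv]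
    simp only [dkU, dk]
    norm_num
    ring
  rw [e, mean_const_mul] at h
  exact h

lemma mean_sq_eq (hU : IsWaveFamily δ K U c) {k : ℝ} (hk : k ∈ K) (M : ℝ) :
    mean (fun y => U k M y ^ 2) = M ^ 2 + mean fun y => U k 0 y ^ 2 := by
  have hc := (hU.contDiff_U hk 0).continuous
  have h : (fun y => U k M y ^ 2) = fun y => (M ^ 2 + 2 * M * U k 0 y) + U k 0 y ^ 2 := by
    funext y; rw [hU.galilean k hk M y]; ring
  rw [h, mean_add (by fun_prop) (by fun_prop), mean_add (by fun_prop) (by fun_prop),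
    mean_const, mean_const_mul (2 * M) (U k 0), hU.mean_U_zero hk]
  ring

lemma meanSq_eq (hU : IsWaveFamily δ K U c) {k : ℝ} (hk : k ∈ K) (M : ℝ) :
    meanSq U k M = 3 * M ^ 2 + 3 * mean fun y => U k 0 y ^ 2 := by
  rw [meanSq, mean_const_mul 3 (fun y => U k M y ^ 2), hU.mean_sq_eq hk]; ring

lemma dk_meanSq (hU : IsWaveFamily δ K U c) {k : ℝ} (hk : k ∈ K) (M : ℝ) :
    dk (meanSq U) k M = 6 * mean fun y => U k 0 y * dkU U k 0 y := by
  have h := ((hU.hasDerivAt_mean_sq hk).const_mul 3).const_add (3 * M ^ 2)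
  have h' : (fun s => meanSq U s M) =ᶠ[𝓝 k] fun s => 3 * M ^ 2 + 3 * mean fun y => U s 0 y ^ 2 := by
    filter_upwards [hU.isOpen.mem_nhds hk] with s hs using hU.meanSq_eq hs M
  rw [dk, h'.deriv_eq, h.deriv]; ring

lemma dM_meanSq (hU : IsWaveFamily δ K U c) {k : ℝ} (hk : k ∈ K) (M : ℝ) :
    dM (meanSq U) k M = 6 * M := by
  have h := ((hasDerivAt_id' M).fun_pow 2).const_mul 3 |>.add_const
    (3 * mean fun y => U k 0 y ^ 2)
  rw [dM, show (fun s => meanSq U k s) = fun M => 3 * M ^ 2 + 3 * mean fun y => U k 0 y ^ 2 from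
    funext (hU.meanSq_eq hk), h.deriv]
  norm_num; ring

lemma dk_sqFluct (hU : IsWaveFamily δ K U c) {k : ℝ} (hk : k ∈ K) (M y : ℝ) :
    dk (sqFluct U y) k M
      = 2 * (U k M y * dkU U k 0 y - mean fun z => U k 0 z * dkU U k 0 z) := by
  have h := ((hU.hasDerivAt_iteratedDeriv_param hk M 0 y).fun_pow 2).sub
    ((hU.hasDerivAt_mean_sq hk).const_add (M ^ 2))
  have h' : (fun s => sqFluct U y s M) =ᶠ[𝓝 k]
      fun s => iteratedDeriv 0 (U s M) y ^ 2 - (M ^ 2 + mean fun y => U s 0 y ^ 2) := by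
    filter_upwards [hU.isOpen.mem_nhds hk] with s hs
    rw [sqFluct, hU.mean_sq_eq hs M, iteratedDeriv_zero]
  rw [dk, h'.deriv_eq]
  refine h.deriv.trans ?_
  simp only [iteratedDeriv_zero, hU.dkU_eq hk M]
  norm_num; ring

lemma dM_sqFluct (hU : IsWaveFamily δ K U c) {k : ℝ} (hk : k ∈ K) (M y : ℝ) :
    dM (sqFluct U y) k M = 2 * U k 0 y := by
  have h : (fun s => sqFluct U y k s)
      = fun s => 2 * U k 0 y * s + (U k 0 y ^ 2 - mean fun z => U k 0 z ^ 2) := by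
    funext s
    rw [sqFluct, hU.mean_sq_eq hk s, hU.galilean k hk s]; ring
  rw [dM, h]
  simp

/-- The source is linear in the slopes, and after the dependence on `M` is made explicit only the
three sources `∂_k U`, `srcX` and `U(k, 0)` remain. -/
lemma whithamSource_eq (hU : IsWaveFamily δ K U c) {k : ℝ} (hk : k ∈ K) (M kT kX MT MX : ℝ) :
    whithamSource δ U k M kT kX MT MX = fun y => kT * dkU U k 0 y
      + (kX * (srcX δ U k y + 6 * M * dkU U k 0 y) + MX * (6 * U k 0 y)) := by
  funext y
  have hX : (fun z => chain (fun k M => U k M z) k M kX MX)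
      = fun z => MX + kX * dkU U k 0 z := by
    funext z
    have h2 := hU.dMU_eq hk M z
    have h1 := congrFun (hU.dkU_eq hk M) z
    simp only [dMU, dkU] at h1 h2
    rw [chain, h1, h2, dkU]; ring
  have hs := hU.contDiff_dkU hk 0
  have hi : ∀ n, iteratedDeriv (n + 1) (fun z => MX + kX * dkU U k 0 z) y
      = kX * iteratedDeriv (n + 1) (dkU U k 0) y := fun n => by
    have hd : deriv (fun z => MX + kX * dkU U k 0 z) = fun z => kX * deriv (dkU U k 0) z := by
      funext z
      rw [deriv_const_add, deriv_const_mul _ (hs.differentiable (by simp) z)]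
    rw [iteratedDeriv_succ', hd, iteratedDeriv_const_mul, iteratedDeriv_succ']
    exact ((hU.smoothFam_dkU.deriv_phase hU.isOpen).contDiff hk).contDiffAt.of_le
      (WithTop.coe_le_coe.mpr le_top)
  have hi0 := hi 0
  rw [zero_add, iteratedDeriv_one, iteratedDeriv_one] at hi0
  simp only [whithamSource]
  rw [hX, hi 1, hi 2, hi0, hU.iteratedDeriv_U hk M 1, hU.iteratedDeriv_U hk M 2, hU.deriv_U hk M]
  simp only [chain]
  rw [(hU.hasDerivAt_sub_mean hk M y).1, (hU.hasDerivAt_sub_mean hk M y).2, hU.dk_sqFluct hk,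
    hU.dM_sqFluct hk, hU.galilean k hk M y, srcX]
  ring

/-- Compared with `whithamSource_eq`, this is the source for `∂_T k` replaced by `Λ₀ - c` and `∂_X
k` by `1`. The agreement of the two theories at second order rests on this match. -/
lemma vk_eq (hU : IsWaveFamily δ K U c) {k : ℝ} (hk : k ∈ K) (M : ℝ) (Λ₀ : ℂ) (y : ℝ) :
    vk δ U c k M Λ₀ y = (Λ₀ - (c k M : ℂ)) * ((dkU U k 0 y : ℝ) : ℂ)
      + ((srcX δ U k y + 6 * M * dkU U k 0 y : ℝ) : ℂ) := by
  have hs := (hU.contDiff_dkU hk 0).of_le (show ((2 : ℕ) : ℕ∞ω) ≤ ∞ from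
    WithTop.coe_le_coe.mpr le_top)
  have hs' := (hU.contDiff_U hk M).of_le (show ((2 : ℕ) : ℕ∞ω) ≤ ∞ from
    WithTop.coe_le_coe.mpr le_top)
  rw [vk, hU.dkU_eq hk M, hU.dk_sqFluct hk, iteratedDeriv_fun_add hs'.contDiffAt
    (contDiff_const.mul hs).contDiffAt, iteratedDeriv_const_mul _ hs.contDiffAt,
    hU.iteratedDeriv_U hk M 1, hU.iteratedDeriv_U hk M 2, hU.deriv_U hk M, hU.galilean k hk M y,
    srcX]
  congr 2
  ring

lemma vM_eq (hU : IsWaveFamily δ K U c) {k : ℝ} (hk : k ∈ K) (M : ℝ) (Λ₀ : ℂ) (y : ℝ) :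
    vM U c k M Λ₀ y = ((6 * U k 0 y : ℝ) : ℂ) := by
  rw [vM, (hU.hasDerivAt_sub_mean hk M y).2, hU.dM_sqFluct hk]
  push_cast; ring

lemma smoothFam_iteratedDeriv_U (hU : IsWaveFamily δ K U c) (n : ℕ) :
    SmoothFam K fun k => iteratedDeriv n (U k 0) := hU.smoothFam.iteratedDeriv_phase hU.isOpen n

lemma smoothFam_iteratedDeriv_dkU (hU : IsWaveFamily δ K U c) (n : ℕ) :
    SmoothFam K fun k => iteratedDeriv n (dkU U k 0) :=
  hU.smoothFam_dkU.iteratedDeriv_phase hU.isOpen n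

lemma continuousOn_srcX (hU : IsWaveFamily δ K U c) :
    ContinuousOn (fun p : ℝ × ℝ => srcX δ U p.1 p.2) (K ×ˢ Set.univ) := by
  have u := fun n => (hU.smoothFam_iteratedDeriv_U n).continuousOn
  have d := fun n => (hU.smoothFam_iteratedDeriv_dkU n).continuousOn
  have u0 := u 0
  have u1 := u 1
  have u2 := u 2
  have u3 := u 3
  have d0 := d 0
  have d1 := d 1
  have d2 := d 2
  have d3 := d 3
  simp only [iteratedDeriv_zero, iteratedDeriv_one] at u0 u1 d0 d1
  have hm : ContinuousOn (fun p : ℝ × ℝ => mean fun z => U p.1 0 z * dkU U p.1 0 z)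
      (K ×ˢ Set.univ) := by
    have hF : SmoothFam K fun k y => U k 0 y * dkU U k 0 y :=
      ContDiffOn.mul hU.smoothFam hU.smoothFam_dkU
    have : ContinuousOn (fun s => mean fun z => U s 0 z * dkU U s 0 z) K := fun k hk =>
      (hF.hasDerivAt_mean hU.isOpen hk).continuousAt.continuousWithinAt
    exact this.comp continuousOn_fst (fun p hp => hp.1)
  unfold srcX
  fun_prop

lemma continuous_srcX (hU : IsWaveFamily δ K U c) {k : ℝ} (hk : k ∈ K) :
    Continuous (srcX δ U k) :=
  hU.continuousOn_srcX.comp_continuous (by fun_prop : Continuous fun y : ℝ => (k, y))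
    fun _ => ⟨hk, trivial⟩

lemma periodic_srcX (hU : IsWaveFamily δ K U c) {k : ℝ} (hk : k ∈ K) :
    Function.Periodic (srcX δ U k) 1 := fun y => by
  have hu := hU.periodic k hk 0
  have hd := hU.periodic_dkU hk 0
  rw [srcX, srcX, hu y, hd y, periodic_deriv hu y, periodic_deriv hd y,
    periodic_iteratedDeriv hu 2 y, periodic_iteratedDeriv hu 3 y, periodic_iteratedDeriv hd 2 y,
    periodic_iteratedDeriv hd 3 y]

/-- The quadratic part has its average subtracted and all other terms are derivatives, so this
source satisfies the solvability condition. -/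
lemma mean_srcX (hU : IsWaveFamily δ K U c) {k : ℝ} (hk : k ∈ K) : mean (srcX δ U k) = 0 := by
  have hu := hU.periodic k hk 0
  have hd := hU.periodic_dkU hk 0
  have su := hU.contDiff_U hk 0
  have sd := hU.contDiff_dkU hk 0
  have cu : ∀ n : ℕ, Continuous (iteratedDeriv n (U k 0)) := fun n =>
    ((hU.smoothFam_iteratedDeriv_U n).contDiff hk).continuous
  have cd : ∀ n : ℕ, Continuous (iteratedDeriv n (dkU U k 0)) := fun n =>
    ((hU.smoothFam_iteratedDeriv_dkU n).contDiff hk).continuous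
  have mu : ∀ n : ℕ, mean (iteratedDeriv (n + 1) (U k 0)) = 0 := fun n =>
    mean_iteratedDeriv_succ (su.of_le (WithTop.coe_le_coe.mpr le_top)) hu
  have md : ∀ n : ℕ, mean (iteratedDeriv (n + 1) (dkU U k 0)) = 0 := fun n =>
    mean_iteratedDeriv_succ (sd.of_le (WithTop.coe_le_coe.mpr le_top)) hd
  have cu0 := su.continuous
  have cd0 := sd.continuous
  have cu1 := cu 1
  have cd1 := cd 1
  have mu1 := mu 0
  have md1 := md 0
  simp only [zero_add, iteratedDeriv_one] at cu1 cd1 mu1 md1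
  have cu2 := cu 2
  have cu3 := cu 3
  have cd2 := cd 2
  have cd3 := cd 3
  unfold srcX
  rw [mean_add (by fun_prop) (by fun_prop), mean_add (by fun_prop) (by fun_prop),
    mean_add (by fun_prop) (by fun_prop), mean_const_mul, mean_const_mul, mean_const_mul,
    mean_const_mul, mean_sub (by fun_prop) (by fun_prop), mean_const,
    mean_add (by fun_prop) (by fun_prop), mean_add (by fun_prop) (by fun_prop),
    mean_add (by fun_prop) (by fun_prop), mean_const_mul, mean_const_mul, mean_const_mul,
    mean_const_mul, mean_const_mul, mu 1, mu 2, md 1, md 2, mu1, md1]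
  ring

end IsWaveFamily

/-! ### Responses to the basic sources, and the fluxes in closed form. -/

/-- A product whose first factor vanishes is differentiable when the second is continuous. -/
lemma hasFDerivAt_mul_of_eq_zero {E : Type*} [NormedAddCommGroup E] [NormedSpace ℝ E]
    {a F : E → ℝ} {a' : E →L[ℝ] ℝ} {x : E} (ha : HasFDerivAt a a' x) (h0 : a x = 0)
    (hF : ContinuousAt F x) : HasFDerivAt (fun z => a z * F z) (F x • a') x := by
  rw [hasFDerivAt_iff_isLittleO]
  -- The product is split as `a (F - F x) + F x · a`; the first summand is `O(z - x)` times `o(1)`.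
  have h1 : (fun z => a z * (F z - F x)) =o[𝓝 x] fun z => z - x := by
    have hO : a =O[𝓝 x] fun z => z - x := by
      have := ha.isBigO_sub
      simpa [h0] using this
    have ho : (fun z => F z - F x) =o[𝓝 x] fun _ => (1 : ℝ) := by
      rw [isLittleO_one_iff]
      simpa using hF.tendsto.sub_const (F x)
    have h := hO.norm_right.mul_isLittleO ho
    simp only [mul_one] at h
    exact h.norm_right.congr_right (fun z => by simp) |>.of_norm_right
  have h2 := (hasFDerivAt_iff_isLittleO.mp ha).const_mul_left (F x)
  refine (h1.add h2).congr_left fun z => ?_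
  simp [h0]
  ring

namespace IsWaveFamily

variable {δ : ℝ} {K : Set ℝ} {U : ℝ → ℝ → ℝ → ℝ} {c : ℝ → ℝ → ℝ}

/-- The periodic solution of `L f = r`, `<f U'> = 0`, at wavenumber `k`. -/
noncomputable def resp (δ : ℝ) (U : ℝ → ℝ → ℝ → ℝ) (c : ℝ → ℝ → ℝ) (k : ℝ) (r : ℝ → ℝ) (y : ℝ) :
    ℝ := prim₄ (solve δ U c k r) (y : AddCircle (1 : ℝ))

/-- `<6 (U - <U>) f>` for the solution `f` of `L f = r`. -/
noncomputable def respFlux (δ : ℝ) (U : ℝ → ℝ → ℝ → ℝ) (c : ℝ → ℝ → ℝ) (k : ℝ) (r : ℝ → ℝ) : ℝ :=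
  mean fun y => 6 * U k 0 y * resp δ U c k r y

lemma continuous_resp (k : ℝ) (r : ℝ → ℝ) : Continuous (resp δ U c k r) :=
  (prim₄ (solve δ U c k r)).continuous_coe

/-- The coefficients of `augOp` and the source vary continuously in the uniform norm with `k`, and
the inverse follows them. -/
lemma continuousAt_solve (hδ : 0 < δ) (hU : IsWaveFamily δ K U c) {k : ℝ} (hk : k ∈ K)
    {r : ℝ → ℝ → ℝ} (hr : ContinuousOn (fun p : ℝ × ℝ => r p.1 p.2) (K ×ˢ Set.univ))
    (hp : ∀ k ∈ K, Function.Periodic (r k) 1) :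
    ContinuousAt (fun k => solve δ U c k (r k)) k := by
  have hu := hU.smoothFam.continuousOn
  have hu' := (hU.smoothFam.deriv_phase hU.isOpen).continuousOn
  have hc : ContinuousOn (fun p : ℝ × ℝ => c p.1 0) (K ×ˢ Set.univ) :=
    (hU.contDiffOn_speed 0).continuousOn.comp continuousOn_fst fun p hp => hp.1
  have h1 := continuousAt_perC hU.isOpen (F := fun k y => k * (6 * U k 0 y - c k 0))
    (continuousOn_fst.mul ((continuousOn_const.mul hu).sub hc)) (fun k hk y => by simp only [hU.periodic k hk 0 y]) hk
  have h0 := continuousAt_perC hU.isOpen (F := fun k y => 6 * k * deriv (U k 0) y)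
    (by fun_prop) (fun k hk y => by simp only [hU.periodic_deriv_U hk 0 y]) hk
  have hg := continuousAt_perC hU.isOpen (F := fun k => deriv (U k 0))
    hu' (fun k hk => hU.periodic_deriv_U hk 0) hk
  exact continuousAt_perOp_inverse (c₄ := fun k => δ * k ^ 4) (c₃ := fun k => k ^ 3)
    (c₂ := fun k => δ * k ^ 2) (by fun_prop) (by fun_prop) (by fun_prop) h1 h0 hg
    (continuousAt_perC hU.isOpen hr hp hk) (hU.isUnit_augOp hδ hk)

lemma continuousAt_mean_resp (hδ : 0 < δ) (hU : IsWaveFamily δ K U c) {k : ℝ} (hk : k ∈ K)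
    {r : ℝ → ℝ → ℝ} (hr : ContinuousOn (fun p : ℝ × ℝ => r p.1 p.2) (K ×ˢ Set.univ))
    (hp : ∀ k ∈ K, Function.Periodic (r k) 1) :
    ContinuousAt (fun k => mean (resp δ U c k (r k))) k :=
  (meanL.continuous.comp prim₄.continuous).continuousAt.comp (hU.continuousAt_solve hδ hk hr hp)

lemma continuousAt_respFlux (hδ : 0 < δ) (hU : IsWaveFamily δ K U c) {k : ℝ} (hk : k ∈ K)
    {r : ℝ → ℝ → ℝ} (hr : ContinuousOn (fun p : ℝ × ℝ => r p.1 p.2) (K ×ˢ Set.univ))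
    (hp : ∀ k ∈ K, Function.Periodic (r k) 1) :
    ContinuousAt (fun k => respFlux δ U c k (r k)) k := by
  have h1 := continuousAt_perC hU.isOpen hU.smoothFam.continuousOn
    (fun k hk => hU.periodic k hk 0) hk
  have h2 := prim₄.continuous.continuousAt.comp (hU.continuousAt_solve hδ hk hr hp)
  have h3 := (meanL.continuous.continuousAt.comp (h1.mul h2)).const_mul 6
  refine h3.congr ?_
  filter_upwards [hU.isOpen.mem_nhds hk] with s hs
  simp only [respFlux, mul_assoc]
  rw [mean_const_mul 6 fun y => U s 0 y * resp δ U c s (r s) y]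
  simp only [Function.comp_apply, meanL_apply]
  congr 2
  funext y
  simp only [Pi.mul_apply, Function.comp_apply, ContinuousMap.mul_apply]
  rw [perC_coe (hU.contDiff_U hs 0).continuous (hU.periodic s hs 0), resp]

lemma mean_lincomb {f g h : ℝ → ℝ} (hf : Continuous f) (hg : Continuous g) (hh : Continuous h)
    (p q r s : ℝ) :
    mean (fun y => p * f y + (q * (g y + r * f y) + s * (6 * h y)))
      = p * mean f + (q * (mean g + r * mean f) + s * (6 * mean h)) := by
  rw [mean_add (by fun_prop) (by fun_prop), mean_add (by fun_prop) (by fun_prop),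
    mean_const_mul, mean_const_mul, mean_const_mul, mean_add (by fun_prop) (by fun_prop),
    mean_const_mul, mean_const_mul]

section Sources

variable {k : ℝ}

lemma isCorrector_dkU (hδ : 0 < δ) (hU : IsWaveFamily δ K U c) (hk : k ∈ K) (M : ℝ) :
    IsCorrector δ U c k M (dkU U k 0) (resp δ U c k (dkU U k 0)) :=
  hU.isCorrector_solve hδ hk M (hU.contDiff_dkU hk 0).continuous (hU.periodic_dkU hk 0)
    (hU.mean_dkU hk 0)

lemma isCorrector_srcX (hδ : 0 < δ) (hU : IsWaveFamily δ K U c) (hk : k ∈ K) (M : ℝ) :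
    IsCorrector δ U c k M (srcX δ U k) (resp δ U c k (srcX δ U k)) :=
  hU.isCorrector_solve hδ hk M (hU.continuous_srcX hk) (hU.periodic_srcX hk) (hU.mean_srcX hk)

lemma isCorrector_U (hδ : 0 < δ) (hU : IsWaveFamily δ K U c) (hk : k ∈ K) (M : ℝ) :
    IsCorrector δ U c k M (U k 0) (resp δ U c k (U k 0)) :=
  hU.isCorrector_solve hδ hk M (hU.contDiff_U hk 0).continuous (hU.periodic k hk 0)
    (hU.mean_U_zero hk)

lemma isCorrector_whithamSource (hδ : 0 < δ) (hU : IsWaveFamily δ K U c) (hk : k ∈ K)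
    (M kT kX MT MX : ℝ) :
    IsCorrector δ U c k M (whithamSource δ U k M kT kX MT MX)
      (fun y => kT * resp δ U c k (dkU U k 0) y + (kX * (resp δ U c k (srcX δ U k) y
        + 6 * M * resp δ U c k (dkU U k 0) y) + MX * (6 * resp δ U c k (U k 0) y))) := by
  rw [hU.whithamSource_eq hk]
  have hV := hU.contDiff_U hk M
  have hA := hU.isCorrector_dkU hδ hk M
  exact (hA.const_mul hV kT).add hV ((((hU.isCorrector_srcX hδ hk M).add hV
    (hA.const_mul hV (6 * M))).const_mul hV kX).add hV
    (((hU.isCorrector_U hδ hk M).const_mul hV 6).const_mul hV MX))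

lemma existsUnique_whithamF (hδ : 0 < δ) (hU : IsWaveFamily δ K U c) (hk : k ∈ K)
    (M kT kX MT MX : ℝ) :
    ∃! f : ℝ → ℝ, IsCorrector δ U c k M (whithamSource δ U k M kT kX MT MX) f :=
  ⟨_, hU.isCorrector_whithamSource hδ hk M kT kX MT MX, fun _ hg =>
    hU.corrector_unique_real hk M hg (hU.isCorrector_whithamSource hδ hk M kT kX MT MX)⟩

lemma whithamF_eq (hδ : 0 < δ) (hU : IsWaveFamily δ K U c) (hk : k ∈ K) (M kT kX MT MX : ℝ) :
    whithamF δ U c k M kT kX MT MX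
      = fun y => kT * resp δ U c k (dkU U k 0) y + (kX * (resp δ U c k (srcX δ U k) y
        + 6 * M * resp δ U c k (dkU U k 0) y) + MX * (6 * resp δ U c k (U k 0) y)) :=
  corrector_eq (hU.existsUnique_whithamF hδ hk M kT kX MT MX)
    (hU.isCorrector_whithamSource hδ hk M kT kX MT MX)

lemma isCorrector_fk (hδ : 0 < δ) (hU : IsWaveFamily δ K U c) (hk : k ∈ K) (M : ℝ) (Λ₀ : ℂ) :
    IsCorrector δ U c k M (fun y => (k : ℂ) * vk δ U c k M Λ₀ y)
      (fun y => (k : ℂ) * ((Λ₀ - (c k M : ℂ)) * ((resp δ U c k (dkU U k 0) y : ℝ) : ℂ)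
        + ((resp δ U c k (srcX δ U k) y + 6 * M * resp δ U c k (dkU U k 0) y : ℝ) : ℂ))) := by
  have hV := hU.contDiff_U hk M
  have hA := hU.isCorrector_dkU hδ hk M
  simp only [hU.vk_eq hk]
  exact (((hA.ofReal hV).const_mul hV _).add hV
    (((hU.isCorrector_srcX hδ hk M).add hV (hA.const_mul hV (6 * M))).ofReal hV)).const_mul hV _

lemma isCorrector_fM (hδ : 0 < δ) (hU : IsWaveFamily δ K U c) (hk : k ∈ K) (M : ℝ) (Λ₀ : ℂ) :
    IsCorrector δ U c k M (fun y => (k : ℂ) * vM U c k M Λ₀ y)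
      (fun y => (k : ℂ) * ((6 * resp δ U c k (U k 0) y : ℝ) : ℂ)) := by
  have hV := hU.contDiff_U hk M
  simp only [hU.vM_eq hk]
  exact (((hU.isCorrector_U hδ hk M).const_mul hV 6).ofReal hV).const_mul hV _

lemma existsUnique_fk (hδ : 0 < δ) (hU : IsWaveFamily δ K U c) (hk : k ∈ K) (M : ℝ) (Λ₀ : ℂ) :
    ∃! f : ℝ → ℂ, IsCorrector δ U c k M (fun y => (k : ℂ) * vk δ U c k M Λ₀ y) f :=
  ⟨_, hU.isCorrector_fk hδ hk M Λ₀, fun _ hg =>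
    hU.corrector_unique hk M hg (hU.isCorrector_fk hδ hk M Λ₀)⟩

lemma existsUnique_fM (hδ : 0 < δ) (hU : IsWaveFamily δ K U c) (hk : k ∈ K) (M : ℝ) (Λ₀ : ℂ) :
    ∃! f : ℝ → ℂ, IsCorrector δ U c k M (fun y => (k : ℂ) * vM U c k M Λ₀ y) f :=
  ⟨_, hU.isCorrector_fM hδ hk M Λ₀, fun _ hg =>
    hU.corrector_unique hk M hg (hU.isCorrector_fM hδ hk M Λ₀)⟩

lemma fk_eq (hδ : 0 < δ) (hU : IsWaveFamily δ K U c) (hk : k ∈ K) (M : ℝ) (Λ₀ : ℂ) :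
    fk δ U c k M Λ₀ = fun y =>
      (k : ℂ) * ((Λ₀ - (c k M : ℂ)) * ((resp δ U c k (dkU U k 0) y : ℝ) : ℂ)
        + ((resp δ U c k (srcX δ U k) y + 6 * M * resp δ U c k (dkU U k 0) y : ℝ) : ℂ)) :=
  corrector_eq (hU.existsUnique_fk hδ hk M Λ₀) (hU.isCorrector_fk hδ hk M Λ₀)

lemma fM_eq (hδ : 0 < δ) (hU : IsWaveFamily δ K U c) (hk : k ∈ K) (M : ℝ) (Λ₀ : ℂ) :
    fM δ U c k M Λ₀ = fun y => (k : ℂ) * ((6 * resp δ U c k (U k 0) y : ℝ) : ℂ) :=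
  corrector_eq (hU.existsUnique_fM hδ hk M Λ₀) (hU.isCorrector_fM hδ hk M Λ₀)

lemma isCorrector_fk' (hδ : 0 < δ) (hU : IsWaveFamily δ K U c) (hk : k ∈ K) (M : ℝ) (Λ₀ : ℂ) :
    IsCorrector δ U c k M (fun y => (k : ℂ) * vk δ U c k M Λ₀ y) (fk δ U c k M Λ₀) := by
  rw [hU.fk_eq hδ hk]; exact hU.isCorrector_fk hδ hk M Λ₀

lemma isCorrector_fM' (hδ : 0 < δ) (hU : IsWaveFamily δ K U c) (hk : k ∈ K) (M : ℝ) (Λ₀ : ℂ) :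
    IsCorrector δ U c k M (fun y => (k : ℂ) * vM U c k M Λ₀ y) (fM δ U c k M Λ₀) := by
  rw [hU.fM_eq hδ hk]; exact hU.isCorrector_fM hδ hk M Λ₀

lemma mean_fk (hδ : 0 < δ) (hU : IsWaveFamily δ K U c) (hk : k ∈ K) (M : ℝ) (Λ₀ : ℂ) :
    mean (fk δ U c k M Λ₀) = k * ((Λ₀ - c k M) * (mean (resp δ U c k (dkU U k 0)) : ℝ)
      + ((mean (resp δ U c k (srcX δ U k)) + 6 * M * mean (resp δ U c k (dkU U k 0)) : ℝ) : ℂ)) := by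
  have hA := continuous_resp (δ := δ) (U := U) (c := c) k (dkU U k 0)
  have hB := continuous_resp (δ := δ) (U := U) (c := c) k (srcX δ U k)
  rw [hU.fk_eq hδ hk, mean_const_mul, mean_add (by fun_prop) (by fun_prop), mean_const_mul,
    mean_ofReal, mean_ofReal, mean_add (by fun_prop) (by fun_prop), mean_const_mul]

lemma mean_fM (hδ : 0 < δ) (hU : IsWaveFamily δ K U c) (hk : k ∈ K) (M : ℝ) (Λ₀ : ℂ) :
    mean (fM δ U c k M Λ₀) = k * ((6 * mean (resp δ U c k (U k 0)) : ℝ) : ℂ) := by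
  rw [hU.fM_eq hδ hk, mean_const_mul, mean_ofReal, mean_const_mul]

/-- Subtracting the average from one factor of a mean product is the same as subtracting it from the
other, so the constant part `M` of the wave does not contribute. -/
lemma fluxMean_eq (hU : IsWaveFamily δ K U c) (hk : k ∈ K) (M : ℝ) {f : ℝ → ℂ}
    (hf : Continuous f) : fluxMean (U k M) f = mean fun y => ((6 * U k 0 y : ℝ) : ℂ) * f y := by
  have hc := (hU.contDiff_U hk 0).continuous
  have h : (fun y => ((6 * U k M y : ℝ) : ℂ) * (f y - mean f)) = fun y =>
      (((6 * U k 0 y : ℝ) : ℂ) * f y + ((6 * M : ℝ) : ℂ) * (f y - mean f))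
        - mean f * ((6 * U k 0 y : ℝ) : ℂ) := by
    funext y; rw [hU.galilean k hk M y]; push_cast; ring
  rw [fluxMean, h, mean_sub (by fun_prop) (by fun_prop), mean_add (by fun_prop) (by fun_prop),
    mean_const_mul, mean_const_mul, mean_sub (by fun_prop) (by fun_prop), mean_const,
    mean_ofReal, mean_const_mul 6 (U k 0), hU.mean_U_zero hk]
  simp

lemma fluxMean_fk (hδ : 0 < δ) (hU : IsWaveFamily δ K U c) (hk : k ∈ K) (M : ℝ) (Λ₀ : ℂ) :
    fluxMean (U k M) (fk δ U c k M Λ₀)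
      = k * ((Λ₀ - c k M) * (respFlux δ U c k (dkU U k 0) : ℝ)
        + ((respFlux δ U c k (srcX δ U k) + 6 * M * respFlux δ U c k (dkU U k 0) : ℝ) : ℂ)) := by
  have hA := continuous_resp (δ := δ) (U := U) (c := c) k (dkU U k 0)
  have hB := continuous_resp (δ := δ) (U := U) (c := c) k (srcX δ U k)
  have hc := (hU.contDiff_U hk 0).continuous
  rw [hU.fluxMean_eq hk M (hU.isCorrector_fk' hδ hk M Λ₀).1.continuous, hU.fk_eq hδ hk]
  have h : (fun y => ((6 * U k 0 y : ℝ) : ℂ)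
      * ((k : ℂ) * ((Λ₀ - (c k M : ℂ)) * ((resp δ U c k (dkU U k 0) y : ℝ) : ℂ)
        + ((resp δ U c k (srcX δ U k) y + 6 * M * resp δ U c k (dkU U k 0) y : ℝ) : ℂ))))
      = fun y => (k : ℂ) * ((Λ₀ - (c k M : ℂ))
        * ((6 * U k 0 y * resp δ U c k (dkU U k 0) y : ℝ) : ℂ)
        + ((6 * U k 0 y * resp δ U c k (srcX δ U k) y
          + 6 * M * (6 * U k 0 y * resp δ U c k (dkU U k 0) y) : ℝ) : ℂ)) := by
    funext y; push_cast; ring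
  rw [h, mean_const_mul, mean_add (by fun_prop) (by fun_prop), mean_const_mul,
    mean_ofReal, mean_ofReal, mean_add (by fun_prop) (by fun_prop), mean_const_mul]
  rfl

lemma fluxMean_fM (hδ : 0 < δ) (hU : IsWaveFamily δ K U c) (hk : k ∈ K) (M : ℝ) (Λ₀ : ℂ) :
    fluxMean (U k M) (fM δ U c k M Λ₀) = k * ((6 * respFlux δ U c k (U k 0) : ℝ) : ℂ) := by
  rw [hU.fluxMean_eq hk M (hU.isCorrector_fM' hδ hk M Λ₀).1.continuous, hU.fM_eq hδ hk]
  have h : (fun y => ((6 * U k 0 y : ℝ) : ℂ) * ((k : ℂ) * ((6 * resp δ U c k (U k 0) y : ℝ) : ℂ)))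
      = fun y => (k : ℂ) * ((6 * (6 * U k 0 y * resp δ U c k (U k 0) y) : ℝ) : ℂ) := by
    funext y; push_cast; ring
  rw [h, mean_const_mul, mean_ofReal, mean_const_mul]
  rfl

/-- The flux is affine in the slopes with coefficients depending on `(k, M)` alone, the form
required by `hasFDerivAt_flux`. -/
lemma fluxK_eq (hδ : 0 < δ) (hU : IsWaveFamily δ K U c) (hk : k ∈ K) (M kT kX MT MX : ℝ) :
    fluxK δ U c (k, M, kT, kX, MT, MX) = k * (c k 0 + 6 * M)
      + kT * (6 * k * mean (resp δ U c k (dkU U k 0)))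
      + kX * (6 * k * (mean (resp δ U c k (srcX δ U k)) + 6 * M * mean (resp δ U c k (dkU U k 0))))
      + MX * (6 * k * (6 * mean (resp δ U c k (U k 0)))) := by
  have hA := continuous_resp (δ := δ) (U := U) (c := c) k (dkU U k 0)
  have hB := continuous_resp (δ := δ) (U := U) (c := c) k (srcX δ U k)
  have hC := continuous_resp (δ := δ) (U := U) (c := c) k (U k 0)
  simp only [fluxK]
  rw [hU.whithamF_eq hδ hk, hU.speed_eq hk, mean_const_mul, mean_lincomb hA hB hC]
  ring

lemma mean_mul_sub_mean (hU : IsWaveFamily δ K U c) (hk : k ∈ K) (M : ℝ) {f : ℝ → ℝ}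
    (hf : Continuous f) :
    mean (fun y => 6 * U k M y * (f y - mean f)) = mean fun y => 6 * U k 0 y * f y := by
  have hc := (hU.contDiff_U hk 0).continuous
  have h : (fun y => 6 * U k M y * (f y - mean f)) = fun y =>
      (6 * U k 0 y * f y + 6 * M * (f y - mean f)) - 6 * mean f * U k 0 y := by
    funext y; rw [hU.galilean k hk M y]; ring
  rw [h, mean_sub (by fun_prop) (by fun_prop), mean_add (by fun_prop) (by fun_prop),
    mean_const_mul (6 * M), mean_const_mul _ (U k 0), mean_sub (by fun_prop) (by fun_prop),
    mean_const, hU.mean_U_zero hk]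
  ring

lemma fluxM_eq (hδ : 0 < δ) (hU : IsWaveFamily δ K U c) (hk : k ∈ K) (M kT kX MT MX : ℝ) :
    fluxM δ U c (k, M, kT, kX, MT, MX) = (3 * M ^ 2 + 3 * (mean fun y => U k 0 y ^ 2))
      + kT * (-respFlux δ U c k (dkU U k 0))
      + kX * (-(respFlux δ U c k (srcX δ U k) + 6 * M * respFlux δ U c k (dkU U k 0)))
      + MX * (δ - 6 * respFlux δ U c k (U k 0)) := by
  have hA := continuous_resp (δ := δ) (U := U) (c := c) k (dkU U k 0)
  have hB := continuous_resp (δ := δ) (U := U) (c := c) k (srcX δ U k)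
  have hC := continuous_resp (δ := δ) (U := U) (c := c) k (U k 0)
  simp only [fluxM]
  have hf : Continuous (whithamF δ U c k M kT kX MT MX) := by
    rw [hU.whithamF_eq hδ hk]; fun_prop
  rw [hU.mean_mul_sub_mean hk M hf, hU.whithamF_eq hδ hk, hU.meanSq_eq hk]
  have h : (fun y => 6 * U k 0 y * (kT * resp δ U c k (dkU U k 0) y
      + (kX * (resp δ U c k (srcX δ U k) y
        + 6 * M * resp δ U c k (dkU U k 0) y) + MX * (6 * resp δ U c k (U k 0) y))))
      = fun y => kT * (6 * U k 0 y * resp δ U c k (dkU U k 0) y)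
        + (kX * (6 * U k 0 y * resp δ U c k (srcX δ U k) y
          + 6 * M * (6 * U k 0 y * resp δ U c k (dkU U k 0) y))
          + MX * (6 * (6 * U k 0 y * resp δ U c k (U k 0) y))) := by
    funext y; ring
  have hc := (hU.contDiff_U hk 0).continuous
  have hA' : Continuous fun y => 6 * U k 0 y * resp δ U c k (dkU U k 0) y := by fun_prop
  have hB' : Continuous fun y => 6 * U k 0 y * resp δ U c k (srcX δ U k) y := by fun_prop
  have hC' : Continuous fun y => 6 * U k 0 y * resp δ U c k (U k 0) y := by fun_prop
  rw [h, mean_lincomb hA' hB' hC']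
  simp only [respFlux]
  ring

end Sources

end IsWaveFamily

/-! ### Linearization of the fluxes at a constant state. -/

section Flux

/-- The wavenumber as a coordinate of the local state. -/
noncomputable def jetk : Jet →L[ℝ] ℝ := ContinuousLinearMap.fst ℝ ℝ (ℝ × ℝ × ℝ × ℝ × ℝ)

/-- The mean as a coordinate of the local state. -/
noncomputable def jetM : Jet →L[ℝ] ℝ :=
  ContinuousLinearMap.fst ℝ ℝ (ℝ × ℝ × ℝ × ℝ)
    ∘L ContinuousLinearMap.snd ℝ ℝ (ℝ × ℝ × ℝ × ℝ × ℝ)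

/-- `∂_T k` as a coordinate of the local state. -/
noncomputable def jetTk : Jet →L[ℝ] ℝ :=
  ContinuousLinearMap.fst ℝ ℝ (ℝ × ℝ × ℝ) ∘L ContinuousLinearMap.snd ℝ ℝ (ℝ × ℝ × ℝ × ℝ)
    ∘L ContinuousLinearMap.snd ℝ ℝ (ℝ × ℝ × ℝ × ℝ × ℝ)

/-- `∂_X k` as a coordinate of the local state. -/
noncomputable def jetXk : Jet →L[ℝ] ℝ :=
  ContinuousLinearMap.fst ℝ ℝ (ℝ × ℝ) ∘L ContinuousLinearMap.snd ℝ ℝ (ℝ × ℝ × ℝ)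
    ∘L ContinuousLinearMap.snd ℝ ℝ (ℝ × ℝ × ℝ × ℝ)
    ∘L ContinuousLinearMap.snd ℝ ℝ (ℝ × ℝ × ℝ × ℝ × ℝ)

/-- `∂_X M` as a coordinate of the local state. -/
noncomputable def jetXM : Jet →L[ℝ] ℝ :=
  ContinuousLinearMap.snd ℝ ℝ ℝ ∘L ContinuousLinearMap.snd ℝ ℝ (ℝ × ℝ)
    ∘L ContinuousLinearMap.snd ℝ ℝ (ℝ × ℝ × ℝ) ∘L ContinuousLinearMap.snd ℝ ℝ (ℝ × ℝ × ℝ × ℝ)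
    ∘L ContinuousLinearMap.snd ℝ ℝ (ℝ × ℝ × ℝ × ℝ × ℝ)

/-- The base point has zero slopes, so in each product of a slope with `A`, `B` or `C` the slope is
the vanishing factor, and continuity of the other factor is enough. No derivative of a corrector in
`k` is ever needed. -/
lemma hasFDerivAt_flux {Φ h A B C : Jet → ℝ} {h' : Jet →L[ℝ] ℝ} {k M : ℝ}
    (hΦ : Φ =ᶠ[𝓝 (k, M, 0, 0, 0, 0)] fun p =>
      h p + p.2.2.1 * A p + p.2.2.2.1 * B p + p.2.2.2.2.2 * C p)
    (hh : HasFDerivAt h h' (k, M, 0, 0, 0, 0)) (hA : ContinuousAt A (k, M, 0, 0, 0, 0))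
    (hB : ContinuousAt B (k, M, 0, 0, 0, 0)) (hC : ContinuousAt C (k, M, 0, 0, 0, 0)) :
    DifferentiableAt ℝ Φ (k, M, 0, 0, 0, 0) ∧
    ∀ κ m κT κX mT mX : ℝ, fderiv ℝ Φ (k, M, 0, 0, 0, 0) (κ, m, κT, κX, mT, mX)
      = h' (κ, m, κT, κX, mT, mX) + A (k, M, 0, 0, 0, 0) * κT + B (k, M, 0, 0, 0, 0) * κX
        + C (k, M, 0, 0, 0, 0) * mX := by
  have e3 : HasFDerivAt (fun p : Jet => p.2.2.1) jetTk (k, M, 0, 0, 0, 0) := jetTk.hasFDerivAt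
  have e4 : HasFDerivAt (fun p : Jet => p.2.2.2.1) jetXk (k, M, 0, 0, 0, 0) := jetXk.hasFDerivAt
  have e6 : HasFDerivAt (fun p : Jet => p.2.2.2.2.2) jetXM (k, M, 0, 0, 0, 0) :=
    jetXM.hasFDerivAt
  have H := (((hh.add (hasFDerivAt_mul_of_eq_zero e3 rfl hA)).add
    (hasFDerivAt_mul_of_eq_zero e4 rfl hB)).add
    (hasFDerivAt_mul_of_eq_zero e6 rfl hC)).congr_of_eventuallyEq hΦ
  refine ⟨H.differentiableAt, fun κ m κT κX mT mX => ?_⟩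
  rw [H.fderiv]
  simp [jetTk, jetXk, jetXM]

variable {δ : ℝ} {K : Set ℝ} {U : ℝ → ℝ → ℝ → ℝ} {c : ℝ → ℝ → ℝ} {k : ℝ}

lemma IsWaveFamily.eventually_jet (hU : IsWaveFamily δ K U c) (hk : k ∈ K) (M : ℝ) :
    ∀ᶠ p : Jet in 𝓝 (k, M, 0, 0, 0, 0), p.1 ∈ K :=
  continuous_fst.continuousAt.eventually_mem (hU.isOpen.mem_nhds hk)

lemma IsWaveFamily.continuousOn_dkU (hU : IsWaveFamily δ K U c) :
    ContinuousOn (fun p : ℝ × ℝ => dkU U p.1 0 p.2) (K ×ˢ Set.univ) :=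
  hU.smoothFam_dkU.continuousOn

lemma IsWaveFamily.fluxK_linear (hδ : 0 < δ) (hU : IsWaveFamily δ K U c) (hk : k ∈ K) (M : ℝ) :
    DifferentiableAt ℝ (fluxK δ U c) (k, M, 0, 0, 0, 0) ∧
    ∀ κ m κT κX mT mX : ℝ, fderiv ℝ (fluxK δ U c) (k, M, 0, 0, 0, 0) (κ, m, κT, κX, mT, mX)
      = (c k M + k * dk c k M) * κ + 6 * k * m
        + 6 * k * mean (IsWaveFamily.resp δ U c k (dkU U k 0)) * κT
        + 6 * k * (mean (IsWaveFamily.resp δ U c k (IsWaveFamily.srcX δ U k))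
          + 6 * M * mean (IsWaveFamily.resp δ U c k (dkU U k 0))) * κX
        + 6 * k * (6 * mean (IsWaveFamily.resp δ U c k (U k 0))) * mX := by
  have cA := hU.continuousAt_mean_resp hδ hk hU.continuousOn_dkU fun k hk => hU.periodic_dkU hk 0
  have cB := hU.continuousAt_mean_resp hδ hk hU.continuousOn_srcX fun k hk => hU.periodic_srcX hk
  have cC := hU.continuousAt_mean_resp hδ hk hU.smoothFam.continuousOn
    fun k hk => hU.periodic k hk 0
  have h1 : ContinuousAt (fun p : Jet => p.1) (k, M, 0, 0, 0, 0) := continuous_fst.continuousAt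
  have h2 : ContinuousAt (fun p : Jet => p.2.1) (k, M, 0, 0, 0, 0) :=
    jetM.continuous.continuousAt
  have lA : ContinuousAt (fun p : Jet => mean (IsWaveFamily.resp δ U c p.1 (dkU U p.1 0)))
      (k, M, 0, 0, 0, 0) := ContinuousAt.comp (f := fun p : Jet => p.1)
        (g := fun k => mean (IsWaveFamily.resp δ U c k (dkU U k 0))) cA h1
  have lB : ContinuousAt (fun p : Jet => mean (IsWaveFamily.resp δ U c p.1 (IsWaveFamily.srcX δ U p.1)))
      (k, M, 0, 0, 0, 0) := ContinuousAt.comp (f := fun p : Jet => p.1)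
        (g := fun k => mean (IsWaveFamily.resp δ U c k (IsWaveFamily.srcX δ U k))) cB h1
  have lC : ContinuousAt (fun p : Jet => mean (IsWaveFamily.resp δ U c p.1 (U p.1 0)))
      (k, M, 0, 0, 0, 0) := ContinuousAt.comp (f := fun p : Jet => p.1)
        (g := fun k => mean (IsWaveFamily.resp δ U c k (U k 0))) cC h1
  have e1 : HasFDerivAt (fun p : Jet => p.1) jetk (k, M, 0, 0, 0, 0) := jetk.hasFDerivAt
  have e2 : HasFDerivAt (fun p : Jet => p.2.1) jetM (k, M, 0, 0, 0, 0) := jetM.hasFDerivAt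
  have ec := HasDerivAt.comp_hasFDerivAt (f := fun p : Jet => p.1) (k, M, 0, 0, 0, 0)
    (hU.hasDerivAt_speed hk 0) e1
  have eh := e1.mul (ec.add (e2.const_mul 6))
  have H := hasFDerivAt_flux (Φ := fluxK δ U c) (h := fun p => p.1 * (c p.1 0 + 6 * p.2.1))
    (A := fun p => 6 * p.1 * mean (IsWaveFamily.resp δ U c p.1 (dkU U p.1 0)))
    (B := fun p => 6 * p.1 * (mean (IsWaveFamily.resp δ U c p.1 (IsWaveFamily.srcX δ U p.1))
      + 6 * p.2.1 * mean (IsWaveFamily.resp δ U c p.1 (dkU U p.1 0))))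
    (C := fun p => 6 * p.1 * (6 * mean (IsWaveFamily.resp δ U c p.1 (U p.1 0)))) ?_ eh ?_ ?_ ?_
  · refine ⟨H.1, fun κ m κT κX mT mX => ?_⟩
    rw [H.2, hU.dk_speed hk M, hU.speed_eq hk M]
    simp [jetk, jetM]
    ring
  · filter_upwards [hU.eventually_jet hk M] with p hp
    exact hU.fluxK_eq hδ hp p.2.1 p.2.2.1 p.2.2.2.1 p.2.2.2.2.1 p.2.2.2.2.2
  · exact (continuousAt_const.mul h1).mul lA
  · exact (continuousAt_const.mul h1).mul (lB.add ((continuousAt_const.mul h2).mul lA))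
  · exact (continuousAt_const.mul h1).mul (continuousAt_const.mul lC)

lemma IsWaveFamily.fluxM_linear (hδ : 0 < δ) (hU : IsWaveFamily δ K U c) (hk : k ∈ K) (M : ℝ) :
    DifferentiableAt ℝ (fluxM δ U c) (k, M, 0, 0, 0, 0) ∧
    ∀ κ m κT κX mT mX : ℝ, fderiv ℝ (fluxM δ U c) (k, M, 0, 0, 0, 0) (κ, m, κT, κX, mT, mX)
      = dk (meanSq U) k M * κ + 6 * M * m
        - IsWaveFamily.respFlux δ U c k (dkU U k 0) * κT
        - (IsWaveFamily.respFlux δ U c k (IsWaveFamily.srcX δ U k)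
          + 6 * M * IsWaveFamily.respFlux δ U c k (dkU U k 0)) * κX
        + (δ - 6 * IsWaveFamily.respFlux δ U c k (U k 0)) * mX := by
  have cA := hU.continuousAt_respFlux hδ hk hU.continuousOn_dkU fun k hk => hU.periodic_dkU hk 0
  have cB := hU.continuousAt_respFlux hδ hk hU.continuousOn_srcX fun k hk => hU.periodic_srcX hk
  have cC := hU.continuousAt_respFlux hδ hk hU.smoothFam.continuousOn
    fun k hk => hU.periodic k hk 0
  have h1 : ContinuousAt (fun p : Jet => p.1) (k, M, 0, 0, 0, 0) := continuous_fst.continuousAt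
  have h2 : ContinuousAt (fun p : Jet => p.2.1) (k, M, 0, 0, 0, 0) :=
    jetM.continuous.continuousAt
  have lA : ContinuousAt (fun p : Jet => IsWaveFamily.respFlux δ U c p.1 (dkU U p.1 0))
      (k, M, 0, 0, 0, 0) := ContinuousAt.comp (f := fun p : Jet => p.1)
        (g := fun k => IsWaveFamily.respFlux δ U c k (dkU U k 0)) cA h1
  have lB : ContinuousAt (fun p : Jet => IsWaveFamily.respFlux δ U c p.1 (IsWaveFamily.srcX δ U p.1))
      (k, M, 0, 0, 0, 0) := ContinuousAt.comp (f := fun p : Jet => p.1)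
        (g := fun k => IsWaveFamily.respFlux δ U c k (IsWaveFamily.srcX δ U k)) cB h1
  have lC : ContinuousAt (fun p : Jet => IsWaveFamily.respFlux δ U c p.1 (U p.1 0))
      (k, M, 0, 0, 0, 0) := ContinuousAt.comp (f := fun p : Jet => p.1)
        (g := fun k => IsWaveFamily.respFlux δ U c k (U k 0)) cC h1
  have e1 : HasFDerivAt (fun p : Jet => p.1) jetk (k, M, 0, 0, 0, 0) := jetk.hasFDerivAt
  have e2 : HasFDerivAt (fun p : Jet => p.2.1) jetM (k, M, 0, 0, 0, 0) := jetM.hasFDerivAt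
  have ec := HasDerivAt.comp_hasFDerivAt (f := fun p : Jet => p.1) (k, M, 0, 0, 0, 0)
    (hU.hasDerivAt_mean_sq hk) e1
  have eh := ((e2.pow 2).const_mul 3).add (ec.const_mul 3)
  have H := hasFDerivAt_flux (Φ := fluxM δ U c)
    (h := fun p => 3 * p.2.1 ^ 2 + 3 * (mean fun y => U p.1 0 y ^ 2))
    (A := fun p => -IsWaveFamily.respFlux δ U c p.1 (dkU U p.1 0))
    (B := fun p => -(IsWaveFamily.respFlux δ U c p.1 (IsWaveFamily.srcX δ U p.1)
      + 6 * p.2.1 * IsWaveFamily.respFlux δ U c p.1 (dkU U p.1 0)))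
    (C := fun p => δ - 6 * IsWaveFamily.respFlux δ U c p.1 (U p.1 0)) ?_ eh ?_ ?_ ?_
  · refine ⟨H.1, fun κ m κT κX mT mX => ?_⟩
    rw [H.2, hU.dk_meanSq hk M]
    simp [jetk, jetM]
    ring
  · filter_upwards [hU.eventually_jet hk M] with p hp
    exact hU.fluxM_eq hδ hp p.2.1 p.2.2.1 p.2.2.2.1 p.2.2.2.2.1 p.2.2.2.2.2
  · exact lA.neg
  · exact (lB.add ((continuousAt_const.mul h2).mul lA)).neg
  · exact continuousAt_const.sub (continuousAt_const.mul lC)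

end Flux

/-! ### Symbols of linearized conservation laws on plane waves. -/

section PlaneWaves

lemma hasDerivAt_planeWave_x (k ξ : ℝ) (l a : ℂ) (x t : ℝ) :
    HasDerivAt (fun x' => planeWave k ξ l a x' t)
      (Complex.I * ξ * k * planeWave k ξ l a x t) x := by
  have h : HasDerivAt (fun x' : ℝ => l * t + Complex.I * ξ * (k * (x' : ℂ)))
      (Complex.I * ξ * (k * 1)) x :=
    ((((hasDerivAt_id x).ofReal_comp).const_mul (k : ℂ)).const_mul (Complex.I * ξ)).const_add _
  refine (h.cexp.const_mul a).congr_deriv ?_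
  rw [planeWave]; ring

lemma hasDerivAt_planeWave_t (k ξ : ℝ) (l a : ℂ) (x t : ℝ) :
    HasDerivAt (fun t' => planeWave k ξ l a x t') (l * planeWave k ξ l a x t) t := by
  have h : HasDerivAt (fun t' : ℝ => l * (t' : ℂ) + Complex.I * ξ * (k * (x : ℂ)))
      (l * 1) t :=
    (((hasDerivAt_id t).ofReal_comp).const_mul l).add_const _
  refine (h.cexp.const_mul a).congr_deriv ?_
  rw [planeWave]; ring

lemma Dx_clm_planeWave (L : ℂ →L[ℝ] ℝ) (k ξ : ℝ) (l a : ℂ) (x t : ℝ) :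
    Dx (fun x t => L (planeWave k ξ l a x t)) x t
      = L (Complex.I * ξ * k * planeWave k ξ l a x t) :=
  (L.hasFDerivAt.comp_hasDerivAt x (hasDerivAt_planeWave_x k ξ l a x t)).deriv

lemma DT_clm_planeWave (L : ℂ →L[ℝ] ℝ) (cs k ξ : ℝ) (l a : ℂ) (x t : ℝ) :
    DT cs (fun x t => L (planeWave k ξ l a x t)) x t
      = L ((l - cs * (Complex.I * ξ * k)) * planeWave k ξ l a x t) := by
  have h := (L.hasFDerivAt.comp_hasDerivAt t (hasDerivAt_planeWave_t k ξ l a x t)).deriv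
  rw [DT, Dx_clm_planeWave, sub_mul, map_sub, mul_assoc (cs : ℂ), ← Complex.real_smul (x := cs),
    map_smul, smul_eq_mul]
  exact congrArg (· - _) h

/-- The symbol of a linearized conservation law on plane waves. -/
lemma linLawC_planeWave {Φ : Jet → ℝ} {ks Ms : ℝ} {a₁ a₂ a₃ a₄ a₆ : ℝ}
    (hΦ : ∀ κ m κT κX mT mX : ℝ, fderiv ℝ Φ (ks, Ms, 0, 0, 0, 0) (κ, m, κT, κX, mT, mX)
      = a₁ * κ + a₂ * m + a₃ * κT + a₄ * κX + a₆ * mX) (cs k ξ : ℝ) (l w κ m : ℂ) (x t : ℝ) :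
    linLawC Φ ks Ms cs (planeWave k ξ l w) (planeWave k ξ l κ) (planeWave k ξ l m) x t
      = ((l - cs * (Complex.I * ξ * k)) * w + Complex.I * ξ * k * (a₁ * κ + a₂ * m
          + a₃ * ((l - cs * (Complex.I * ξ * k)) * κ) + a₄ * (Complex.I * ξ * k * κ)
          + a₆ * (Complex.I * ξ * k * m)))
        * Complex.exp (l * t + Complex.I * ξ * (k * x)) := by
  -- The differential has real coefficients, so real and imaginary parts are treated together
  -- through an arbitrary real functional `L`; the linearized flux of plane waves is then again a
  -- plane wave.
  have key : ∀ L : ℂ →L[ℝ] ℝ, linLaw Φ ks Ms cs (fun x t => L (planeWave k ξ l w x t))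
      (fun x t => L (planeWave k ξ l κ x t)) (fun x t => L (planeWave k ξ l m x t)) x t
      = L (((l - cs * (Complex.I * ξ * k)) * w + Complex.I * ξ * k * (a₁ * κ + a₂ * m
          + a₃ * ((l - cs * (Complex.I * ξ * k)) * κ) + a₄ * (Complex.I * ξ * k * κ)
          + a₆ * (Complex.I * ξ * k * m)))
        * Complex.exp (l * t + Complex.I * ξ * (k * x))) := by
    intro L
    have hr : ∀ (a : ℝ) (z : ℂ), a * L z = L ((a : ℂ) * z) := fun a z => by
      rw [← Complex.real_smul, map_smul, smul_eq_mul]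
    have he : (fun x' => fderiv ℝ Φ (ks, Ms, 0, 0, 0, 0)
        (L (planeWave k ξ l κ x' t), L (planeWave k ξ l m x' t),
          DT cs (fun x t => L (planeWave k ξ l κ x t)) x' t,
          Dx (fun x t => L (planeWave k ξ l κ x t)) x' t,
          DT cs (fun x t => L (planeWave k ξ l m x t)) x' t,
          Dx (fun x t => L (planeWave k ξ l m x t)) x' t))
        = fun x' => L (planeWave k ξ l (a₁ * κ + a₂ * m
          + a₃ * ((l - cs * (Complex.I * ξ * k)) * κ) + a₄ * (Complex.I * ξ * k * κ)
          + a₆ * (Complex.I * ξ * k * m)) x' t) := by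
      funext x'
      rw [hΦ, DT_clm_planeWave, Dx_clm_planeWave, Dx_clm_planeWave]
      simp only [hr, ← map_add, planeWave]
      congr 1
      ring
    rw [linLaw, DT_clm_planeWave, he]
    have h := Dx_clm_planeWave L k ξ l (a₁ * κ + a₂ * m
          + a₃ * ((l - cs * (Complex.I * ξ * k)) * κ) + a₄ * (Complex.I * ξ * k * κ)
          + a₆ * (Complex.I * ξ * k * m)) x t
    rw [Dx] at h
    rw [h, ← map_add, planeWave, planeWave]
    congr 1
    ring
  have h1 := key Complex.reCLM
  have h2 := key Complex.imCLM
  simp only [Complex.reCLM_apply, Complex.imCLM_apply] at h1 h2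
  have hz : ∀ z : ℂ, (z.re : ℂ) + Complex.I * (z.im : ℂ) = z := fun z => by
    rw [mul_comm]; exact Complex.re_add_im z
  rw [linLawC, h1, h2]
  exact hz _

end PlaneWaves

/-! ### First order expansions in `ν`, and the plane wave criterion. -/

namespace AmplitudeExpansion

variable {a b : ℝ → ℂ} {a₀ a₁ b₀ b₁ : ℂ}

lemma const (z : ℂ) : AmplitudeExpansion (fun _ => z) z 0 := by
  simpa [AmplitudeExpansion] using isBigO_zero _ _

lemma nu : AmplitudeExpansion (fun ξ => Complex.I * ξ) 0 1 := by
  simpa [AmplitudeExpansion] using isBigO_zero _ _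

lemma add (ha : AmplitudeExpansion a a₀ a₁) (hb : AmplitudeExpansion b b₀ b₁) :
    AmplitudeExpansion (fun ξ => a ξ + b ξ) (a₀ + b₀) (a₁ + b₁) :=
  (IsBigO.add ha hb).congr_left fun ξ => by ring

lemma isBigO_ofReal_pow {l : Filter ℝ} (m : ℕ) :
    (fun ξ : ℝ => (ξ : ℂ) ^ m) =O[l] fun ξ => ξ ^ m :=
  IsBigO.of_bound 1 (Eventually.of_forall fun ξ => by simp)

lemma isBigO_one (ha : AmplitudeExpansion a a₀ a₁) :
    a =O[𝓝[≠] (0 : ℝ)] fun _ => (1 : ℝ) := by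
  have h1 : (fun ξ : ℝ => ξ ^ 2) =O[𝓝[≠] (0 : ℝ)] fun _ => (1 : ℝ) :=
    ((continuous_pow 2).tendsto (0 : ℝ)).isBigO_one ℝ |>.mono nhdsWithin_le_nhds
  have h2 : (fun ξ : ℝ => a₀ + Complex.I * ξ * a₁) =O[𝓝[≠] (0 : ℝ)] fun _ => (1 : ℝ) :=
    ((Continuous.tendsto (by fun_prop) (0 : ℝ)).isBigO_one ℝ).mono nhdsWithin_le_nhds
  exact ((ha.trans h1).add h2).congr_left fun ξ => by ring

lemma mul (ha : AmplitudeExpansion a a₀ a₁) (hb : AmplitudeExpansion b b₀ b₁) :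
    AmplitudeExpansion (fun ξ => a ξ * b ξ) (a₀ * b₀) (a₀ * b₁ + a₁ * b₀) := by
  have h2 : (fun ξ : ℝ => a₀ + Complex.I * ξ * a₁) =O[𝓝[≠] (0 : ℝ)] fun _ => (1 : ℝ) :=
    ((Continuous.tendsto (by fun_prop) (0 : ℝ)).isBigO_one ℝ).mono nhdsWithin_le_nhds
  have e1 := (IsBigO.mul ha hb.isBigO_one)
  have e2 := (IsBigO.mul h2 hb)
  have e3 := (isBigO_ofReal_pow (l := 𝓝[≠] (0 : ℝ)) 2).const_mul_left (-(a₁ * b₁))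
  simp only [mul_one, one_mul] at e1 e2
  refine ((e1.add e2).add e3).congr_left fun ξ => ?_
  linear_combination (-(a₁ * b₁ * ξ ^ 2)) * Complex.I_sq

lemma congr (ha : AmplitudeExpansion a a₀ a₁) (h0 : a₀ = b₀) (h1 : a₁ = b₁)
    (h : ∀ᶠ ξ in 𝓝[≠] (0 : ℝ), a ξ = b ξ) : AmplitudeExpansion b b₀ b₁ := by
  subst h0 h1
  exact IsBigO.congr' ha (h.mono fun ξ hξ => by simp only [hξ]) EventuallyEq.rfl

/-- A quotient of an eigenvalue by `ν`. -/
lemma of_eigenvalue {k : ℝ} {l : ℝ → ℂ} {Λ₀ Λ₁ : ℂ} (h : EigenvalueExpansion k l Λ₀ Λ₁) :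
    AmplitudeExpansion (fun ξ => l ξ / (Complex.I * ξ)) (k * Λ₀) (k * Λ₁) := by
  have hinv : (fun ξ : ℝ => (Complex.I * ξ)⁻¹) =O[𝓝[≠] (0 : ℝ)] fun ξ => ξ⁻¹ :=
    IsBigO.of_bound 1 (Eventually.of_forall fun ξ => by simp)
  refine (IsBigO.mul h hinv).congr' ?_ ?_
  · filter_upwards [self_mem_nhdsWithin] with ξ hξ
    have hξ' : (ξ : ℂ) ≠ 0 := Complex.ofReal_ne_zero.mpr hξ
    field_simp
  · filter_upwards [self_mem_nhdsWithin] with ξ hξ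
    have hξ' : ξ ≠ 0 := hξ
    field_simp

/-- Coefficients of an expansion are unique: the limit at `0` gives `a₀ = 0`, and division by `ν`
then gives `a₁ = 0`. -/
lemma isBigO_sq_iff (ha : AmplitudeExpansion a a₀ a₁) :
    a =O[𝓝[≠] (0 : ℝ)] (fun ξ => ξ ^ 2) ↔ a₀ = 0 ∧ a₁ = 0 := by
  refine ⟨fun h => ?_, ?_⟩
  · have h1 : (fun ξ : ℝ => a₀ + Complex.I * ξ * a₁) =O[𝓝[≠] (0 : ℝ)] fun ξ => ξ ^ 2 :=
      (h.sub ha).congr_left fun ξ => by ring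
    have h0 : a₀ = 0 := by
      have t1 : Tendsto (fun ξ : ℝ => a₀ + Complex.I * ξ * a₁) (𝓝[≠] (0 : ℝ)) (𝓝 0) :=
        h1.trans_tendsto (by
          have := ((continuous_pow 2).tendsto (0 : ℝ)).mono_left
            (nhdsWithin_le_nhds (s := {(0 : ℝ)}ᶜ))
          simpa using this)
      have t2 : Tendsto (fun ξ : ℝ => a₀ + Complex.I * ξ * a₁) (𝓝[≠] (0 : ℝ)) (𝓝 a₀) := by
        have : Tendsto (fun ξ : ℝ => a₀ + Complex.I * ξ * a₁) (𝓝 0)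
          (𝓝 (a₀ + Complex.I * (0 : ℝ) * a₁)) := Continuous.tendsto (by fun_prop) _
        simpa using this.mono_left nhdsWithin_le_nhds
      exact tendsto_nhds_unique t2 t1
    refine ⟨h0, ?_⟩
    subst h0
    have hinv : (fun ξ : ℝ => (Complex.I * ξ)⁻¹) =O[𝓝[≠] (0 : ℝ)] fun ξ => ξ⁻¹ :=
      IsBigO.of_bound 1 (Eventually.of_forall fun ξ => by simp)
    have h2 : (fun _ : ℝ => a₁) =O[𝓝[≠] (0 : ℝ)] fun ξ => ξ := by
      refine (h1.mul hinv).congr' ?_ ?_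
      · filter_upwards [self_mem_nhdsWithin] with ξ hξ
        have hξ' : (ξ : ℂ) ≠ 0 := Complex.ofReal_ne_zero.mpr hξ
        field_simp
        simp
      · filter_upwards [self_mem_nhdsWithin] with ξ hξ
        have hξ' : ξ ≠ 0 := hξ
        field_simp
    exact tendsto_nhds_unique tendsto_const_nhds
      (h2.trans_tendsto (tendsto_id.mono_left nhdsWithin_le_nhds))
  · rintro ⟨rfl, rfl⟩
    exact IsBigO.congr_left ha fun ξ => by ring

end AmplitudeExpansion

/-- The expansion of the symbol of a linearized conservation law. -/
lemma isBigO_linLawC_iff {Φ : Jet → ℝ} {ks Ms : ℝ} {a₁ a₂ a₃ a₄ a₆ : ℝ}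
    (hΦ : ∀ κ m κT κX mT mX : ℝ, fderiv ℝ Φ (ks, Ms, 0, 0, 0, 0) (κ, m, κT, κX, mT, mX)
      = a₁ * κ + a₂ * m + a₃ * κT + a₄ * κX + a₆ * mX) (cs k : ℝ) {l w κ m : ℝ → ℂ}
    {Λ₀ Λ₁ w₀ w₁ κ₀ κ₁ m₀ m₁ : ℂ} (hl : EigenvalueExpansion k l Λ₀ Λ₁)
    (hw : AmplitudeExpansion w w₀ w₁) (hκ : AmplitudeExpansion κ κ₀ κ₁)
    (hm : AmplitudeExpansion m m₀ m₁) (x t : ℝ) :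
    (fun ξ : ℝ => linLawC Φ ks Ms cs (planeWave k ξ (l ξ) (w ξ)) (planeWave k ξ (l ξ) (κ ξ))
        (planeWave k ξ (l ξ) (m ξ)) x t) =O[𝓝[≠] (0 : ℝ)] (fun ξ => ξ ^ 3) ↔
      k * ((Λ₀ - cs) * w₀ + (a₁ * κ₀ + a₂ * m₀)) = 0 ∧
      k * (Λ₁ * w₀ + (Λ₀ - cs) * w₁ + (a₁ * κ₁ + a₂ * m₁)
        + k * (a₃ * ((Λ₀ - cs) * κ₀) + a₄ * κ₀ + a₆ * m₀)) = 0 := by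
  simp only [linLawC_planeWave hΦ]
  have hq := AmplitudeExpansion.of_eigenvalue hl
  have hν := AmplitudeExpansion.nu
  have C := AmplitudeExpansion.const
  have hs := hq.add (C (-(cs * k)))
  -- The exponential factor tends to `1`, as does its inverse, so it affects no order of vanishing;
  -- this is why the conditions do not depend on `(x, t)`.
  have hE : Tendsto (fun ξ : ℝ => Complex.exp (l ξ * t + Complex.I * ξ * (k * x)))
      (𝓝[≠] (0 : ℝ)) (𝓝 1) := by
    have hl0 : Tendsto l (𝓝[≠] (0 : ℝ)) (𝓝 0) := by
      have h1 : Tendsto (fun ξ : ℝ => Complex.I * ξ * (k * Λ₀) + (Complex.I * ξ) ^ 2 * (k * Λ₁))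
          (𝓝[≠] (0 : ℝ)) (𝓝 0) := by
        have := Continuous.tendsto (f := fun ξ : ℝ => Complex.I * (ξ : ℂ) * (k * Λ₀)
          + (Complex.I * (ξ : ℂ)) ^ 2 * (k * Λ₁)) (by fun_prop) 0
        simpa using this.mono_left (nhdsWithin_le_nhds (s := {(0 : ℝ)}ᶜ))
      have h2 : Tendsto (fun ξ : ℝ => ξ ^ 3) (𝓝[≠] (0 : ℝ)) (𝓝 0) := by
        have := (continuous_pow 3).tendsto (0 : ℝ)
        simpa using this.mono_left (nhdsWithin_le_nhds (s := {(0 : ℝ)}ᶜ))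
      simpa using (hl.trans_tendsto h2).add h1
    have h3 : Tendsto (fun ξ : ℝ => Complex.I * (ξ : ℂ) * (k * x)) (𝓝[≠] (0 : ℝ)) (𝓝 0) := by
      have := Continuous.tendsto (f := fun ξ : ℝ => Complex.I * (ξ : ℂ) * (k * x)) (by fun_prop) 0
      simpa using this.mono_left (nhdsWithin_le_nhds (s := {(0 : ℝ)}ᶜ))
    have := ((hl0.mul_const (t : ℂ)).add h3).cexp
    simpa using this
  have hE' : Tendsto (fun ξ : ℝ => (Complex.exp (l ξ * t + Complex.I * ξ * (k * x)))⁻¹)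
      (𝓝[≠] (0 : ℝ)) (𝓝 1) := by simpa using hE.inv₀ one_ne_zero
  -- `T` is the symbol divided by `ν`, so that the symbol is `O(ν³)` exactly when `T` is `O(ν²)`,
  -- that is, when both coefficients of `T` vanish.
  set T : ℝ → ℂ := fun ξ => (l ξ / (Complex.I * ξ) + -(cs * k)) * w ξ
    + k * (a₁ * κ ξ + a₂ * m ξ + Complex.I * ξ * (a₃ * ((l ξ / (Complex.I * ξ) + -(cs * k)) * κ ξ)
      + a₄ * (k * κ ξ) + a₆ * (k * m ξ))) with hTdef
  have hT : AmplitudeExpansion T (k * ((Λ₀ - cs) * w₀ + (a₁ * κ₀ + a₂ * m₀)))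
      (k * (Λ₁ * w₀ + (Λ₀ - cs) * w₁ + (a₁ * κ₁ + a₂ * m₁)
        + k * (a₃ * ((Λ₀ - cs) * κ₀) + a₄ * κ₀ + a₆ * m₀))) := by
    refine ((hs.mul hw).add ((C k).mul ((((C a₁).mul hκ).add ((C a₂).mul hm)).add
      (hν.mul ((((C a₃).mul (hs.mul hκ)).add ((C a₄).mul ((C k).mul hκ))).add
        ((C a₆).mul ((C k).mul hm))))))).congr ?_ ?_ (Eventually.of_forall fun _ => rfl)
    · ring
    · ring
  rw [← hT.isBigO_sq_iff]
  have hS : ∀ᶠ ξ : ℝ in 𝓝[≠] (0 : ℝ), (l ξ - cs * (Complex.I * ξ * k)) * w ξ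
      + Complex.I * ξ * k * (a₁ * κ ξ + a₂ * m ξ
          + a₃ * ((l ξ - cs * (Complex.I * ξ * k)) * κ ξ) + a₄ * (Complex.I * ξ * k * κ ξ)
          + a₆ * (Complex.I * ξ * k * m ξ)) = Complex.I * ξ * T ξ := by
    filter_upwards [self_mem_nhdsWithin] with ξ hξ
    have hξ' : (ξ : ℂ) ≠ 0 := Complex.ofReal_ne_zero.mpr hξ
    have hl' : l ξ = Complex.I * ξ * (l ξ / (Complex.I * ξ)) := by field_simp
    rw [hTdef]
    simp only
    set q := l ξ / (Complex.I * ξ)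
    rw [hl']
    ring
  constructor
  · intro h
    have h1 := h.mul (hE'.isBigO_one ℝ)
    have hinv : (fun ξ : ℝ => (Complex.I * ξ)⁻¹) =O[𝓝[≠] (0 : ℝ)] fun ξ => ξ⁻¹ :=
      IsBigO.of_bound 1 (Eventually.of_forall fun ξ => by simp)
    refine (h1.mul hinv).congr' ?_ ?_
    · filter_upwards [self_mem_nhdsWithin, hS] with ξ hξ hSξ
      have hξ' : (ξ : ℂ) ≠ 0 := Complex.ofReal_ne_zero.mpr hξ
      rw [hSξ, mul_assoc _ _ (Complex.exp _)⁻¹, mul_inv_cancel₀ (Complex.exp_ne_zero _)]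
      field_simp
    · filter_upwards [self_mem_nhdsWithin] with ξ hξ
      have hξ' : ξ ≠ 0 := hξ
      field_simp
  · intro h
    have hν' : (fun ξ : ℝ => Complex.I * (ξ : ℂ)) =O[𝓝[≠] (0 : ℝ)] fun ξ => ξ :=
      IsBigO.of_bound 1 (Eventually.of_forall fun ξ => by simp)
    refine ((hν'.mul h).mul (hE.isBigO_one ℝ)).congr' ?_ ?_
    · filter_upwards [hS] with ξ hSξ
      rw [hSξ]
    · exact Eventually.of_forall fun ξ => by simp only; ring

variable {δ : ℝ} {K : Set ℝ} {U : ℝ → ℝ → ℝ → ℝ} {c : ℝ → ℝ → ℝ} {k : ℝ}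

/-- In each law the coefficients of `ν` and `ν²` of the symbol must vanish. In the first law the
frame speed cancels the `c` in the `k`-derivative of `k c`, leaving `Λ₀ k₀ + k dc(k₀, M₀)`. The
slope terms, with `∂_T` acting as `ν k (Λ₀ - c)`, reproduce the averages and fluxes of `f^k` and
`f^M`. -/
theorem IsWaveFamily.whithamPlaneWave_iff (hδ : 0 < δ) (hU : IsWaveFamily δ K U c) (hk : k ∈ K)
    (M : ℝ) {l kh Mh : ℝ → ℂ} {Λ₀ Λ₁ k₀ M₀ k₁ M₁ : ℂ} (hl : EigenvalueExpansion k l Λ₀ Λ₁)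
    (hkh : AmplitudeExpansion kh k₀ k₁) (hMh : AmplitudeExpansion Mh M₀ M₁) :
    WhithamPlaneWave δ U c k M l kh Mh ↔
      FirstOrderSystem U c k M Λ₀ k₀ M₀ ∧ SecondOrderSystem δ U c k M Λ₀ k₀ M₀ Λ₁ k₁ M₁ := by
  have hk0 : (k : ℂ) ≠ 0 := Complex.ofReal_ne_zero.mpr (hU.pos k hk).ne'
  have h1 := fun x t => isBigO_linLawC_iff (hU.fluxK_linear hδ hk M).2 (c k M) k hl hkh hkh hMh x t
  have h2 := fun x t => isBigO_linLawC_iff (Φ := fluxM δ U c) (ks := k) (Ms := M)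
    (a₁ := dk (meanSq U) k M) (a₂ := 6 * M)
    (a₃ := -IsWaveFamily.respFlux δ U c k (dkU U k 0))
    (a₄ := -(IsWaveFamily.respFlux δ U c k (IsWaveFamily.srcX δ U k)
          + 6 * M * IsWaveFamily.respFlux δ U c k (dkU U k 0)))
    (a₆ := δ - 6 * IsWaveFamily.respFlux δ U c k (U k 0))
    (fun κ m κT κX mT mX => by rw [(hU.fluxM_linear hδ hk M).2]; ring)
    (c k M) k hl hMh hkh hMh x t
  rw [WhithamPlaneWave]
  simp only [h1, h2, mul_eq_zero, hk0, false_or, forall_const]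
  rw [FirstOrderSystem, SecondOrderSystem, hU.mean_fk hδ hk, hU.mean_fM hδ hk,
    hU.fluxMean_fk hδ hk, hU.fluxMean_fM hδ hk, hU.dM_speed hk, hU.dM_meanSq hk]
  push_cast
  constructor
  · rintro ⟨⟨e1, e2⟩, e3, e4⟩
    refine ⟨⟨?_, ?_⟩, ?_, ?_⟩
    · linear_combination e1
    · linear_combination e3
    · linear_combination e2
    · linear_combination e4
  · rintro ⟨⟨e1, e3⟩, e2, e4⟩
    refine ⟨⟨?_, ?_⟩, ?_, ?_⟩
    · linear_combination e1
    · linear_combination e2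
    · linear_combination e3
    · linear_combination e4

/-! ### The Bloch operator as a polynomial in `ν`. -/

section Bloch

/-- The coefficient of `ν` in the Bloch operator. -/
noncomputable def bloch₁ (δ k c : ℝ) (V : ℝ → ℝ) (f : ℝ → ℂ) (y : ℝ) : ℂ :=
  k * (((6 * V y - c : ℝ) : ℂ) * f y) + 3 * k ^ 3 * iteratedDeriv 2 f y
    + δ * (2 * k ^ 2 * deriv f y + 4 * k ^ 4 * iteratedDeriv 3 f y)

/-- The coefficient of `ν²` in the Bloch operator. -/
noncomputable def bloch₂ (δ k : ℝ) (f : ℝ → ℂ) (y : ℝ) : ℂ :=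
  3 * k ^ 3 * deriv f y + δ * (k ^ 2 * f y + 6 * k ^ 4 * iteratedDeriv 2 f y)

/-- The coefficient of `ν³` in the Bloch operator. -/
noncomputable def bloch₃ (δ k : ℝ) (f : ℝ → ℂ) (y : ℝ) : ℂ :=
  k ^ 3 * f y + δ * (4 * k ^ 4 * deriv f y)

variable {δ k c : ℝ} {V : ℝ → ℝ} {f g : ℝ → ℂ}

lemma hasDerivAt_iteratedDeriv_four (hf : ContDiff ℝ 4 f) {n : ℕ} (hn : n < 4) (y : ℝ) :
    HasDerivAt (iteratedDeriv n f) (iteratedDeriv (n + 1) f y) y := by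
  rw [iteratedDeriv_succ]
  exact (hf.differentiable_iteratedDeriv n (by exact_mod_cast hn) y).hasDerivAt

lemma blochOp_eq (hf : ContDiff ℝ 4 f) (ν : ℂ) (y : ℝ) :
    blochOp δ k c V ν f y = linOp δ k c V f y + ν * bloch₁ δ k c V f y + ν ^ 2 * bloch₂ δ k f y
      + ν ^ 3 * bloch₃ δ k f y + ν ^ 4 * (δ * k ^ 4 * f y) := by
  have d0 := fun y => hasDerivAt_iteratedDeriv_four hf (n := 0) (by lia) y
  have d1 := fun y => hasDerivAt_iteratedDeriv_four hf (n := 1) (by lia) y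
  have d2 := fun y => hasDerivAt_iteratedDeriv_four hf (n := 2) (by lia) y
  have d3 := fun y => hasDerivAt_iteratedDeriv_four hf (n := 3) (by lia) y
  simp only [iteratedDeriv_zero, zero_add, iteratedDeriv_one, Nat.reduceAdd] at d0 d1 d2 d3
  have b1 : bd ν f = fun y => deriv f y + ν * f y := rfl
  have b2 : bd ν (bd ν f) = fun y => iteratedDeriv 2 f y + 2 * ν * deriv f y + ν ^ 2 * f y := by
    funext y
    rw [b1, bd, ((d1 y).fun_add ((d0 y).const_mul ν)).deriv]
    ring
  have b3 : bd ν (bd ν (bd ν f)) = fun y => iteratedDeriv 3 f y + 3 * ν * iteratedDeriv 2 f y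
      + 3 * ν ^ 2 * deriv f y + ν ^ 3 * f y := by
    funext y
    rw [b2, bd, (((d2 y).fun_add ((d1 y).const_mul _)).fun_add ((d0 y).const_mul _)).deriv]
    ring
  have b4 : bd ν (bd ν (bd ν (bd ν f))) y = iteratedDeriv 4 f y + 4 * ν * iteratedDeriv 3 f y
      + 6 * ν ^ 2 * iteratedDeriv 2 f y + 4 * ν ^ 3 * deriv f y + ν ^ 4 * f y := by
    rw [b3, bd, ((((d3 y).fun_add ((d2 y).const_mul _)).fun_add ((d1 y).const_mul _)).fun_add
      ((d0 y).const_mul _)).deriv]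
    ring
  simp only [blochOp, linOp, bloch₁, bloch₂, bloch₃, Function.iterate_succ, Function.iterate_zero,
    Function.comp_apply, id_eq]
  rw [b4, b3, b2]
  simp only [bd, Complex.coe_algebraMap]
  ring

lemma continuous_iteratedDeriv_four (hf : ContDiff ℝ 4 f) {n : ℕ} (hn : n ≤ 4) :
    Continuous (iteratedDeriv n f) := hf.continuous_iteratedDeriv n (by exact_mod_cast hn)

lemma continuous_bloch₁ (hV : Continuous V) (hf : ContDiff ℝ 4 f) :
    Continuous (bloch₁ δ k c V f) := by
  have c0 := hf.continuous
  have c1 := continuous_iteratedDeriv_four hf (n := 1) (by lia)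
  rw [iteratedDeriv_one] at c1
  have c2 := continuous_iteratedDeriv_four hf (n := 2) (by lia)
  have c3 := continuous_iteratedDeriv_four hf (n := 3) (by lia)
  unfold bloch₁
  fun_prop

lemma continuous_bloch₂ (hf : ContDiff ℝ 4 f) : Continuous (bloch₂ δ k f) := by
  have c0 := hf.continuous
  have c1 := continuous_iteratedDeriv_four hf (n := 1) (by lia)
  rw [iteratedDeriv_one] at c1
  have c2 := continuous_iteratedDeriv_four hf (n := 2) (by lia)
  unfold bloch₂
  fun_prop

lemma continuous_bloch₃ (hf : ContDiff ℝ 4 f) : Continuous (bloch₃ δ k f) := by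
  have c0 := hf.continuous
  have c1 := continuous_iteratedDeriv_four hf (n := 1) (by lia)
  rw [iteratedDeriv_one] at c1
  unfold bloch₃
  fun_prop

lemma continuous_linOp (hV : ContDiff ℝ 1 V) (hf : ContDiff ℝ 4 f) :
    Continuous (linOp δ k c V f) := by
  have c0 := hf.continuous
  have c1 := continuous_iteratedDeriv_four hf (n := 1) (by lia)
  rw [iteratedDeriv_one] at c1
  have c2 := continuous_iteratedDeriv_four hf (n := 2) (by lia)
  have c3 := continuous_iteratedDeriv_four hf (n := 3) (by lia)
  have c4 := continuous_iteratedDeriv_four hf (n := 4) (by lia)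
  have v0 := hV.continuous
  have v1 := hV.continuous_deriv le_rfl
  rw [show linOp δ k c V f = _ from
    funext (linOp_eq (hV.differentiable (by simp)) (hf.differentiable (by simp)))]
  simp only [RCLike.ofReal_eq_complex_ofReal]
  fun_prop

lemma periodic_bloch₁ (hV : Function.Periodic V 1) (hp : Function.Periodic f 1) :
    Function.Periodic (bloch₁ δ k c V f) 1 := fun y => by
  rw [bloch₁, bloch₁, hV y, hp y, periodic_deriv hp y, periodic_iteratedDeriv hp 2 y,
    periodic_iteratedDeriv hp 3 y]

lemma periodic_bloch₂ (hp : Function.Periodic f 1) : Function.Periodic (bloch₂ δ k f) 1 :=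
  fun y => by rw [bloch₂, bloch₂, hp y, periodic_deriv hp y, periodic_iteratedDeriv hp 2 y]

lemma periodic_bloch₃ (hp : Function.Periodic f 1) : Function.Periodic (bloch₃ δ k f) 1 :=
  fun y => by rw [bloch₃, bloch₃, hp y, periodic_deriv hp y]

lemma mean_iteratedDeriv_four (hf : ContDiff ℝ 4 f) (hp : Function.Periodic f 1) {n : ℕ}
    (hn : n + 1 ≤ 4) : mean (iteratedDeriv (n + 1) f) = 0 :=
  mean_iteratedDeriv_succ (hf.of_le (by exact_mod_cast hn)) hp

/-- Averaging removes every derivative of the periodic `f`, leaving only the undifferentiated terms.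
-/
lemma mean_bloch₁ (hV : Continuous V) (hf : ContDiff ℝ 4 f) (hp : Function.Periodic f 1) :
    mean (bloch₁ δ k c V f) = k * (mean (fun y => ((6 * V y : ℝ) : ℂ) * f y) - c * mean f) := by
  have c0 := hf.continuous
  have c1 := continuous_iteratedDeriv_four hf (n := 1) (by lia)
  have m1 := mean_iteratedDeriv_four hf hp (n := 0) (by lia)
  rw [iteratedDeriv_one] at c1 m1
  have c2 := continuous_iteratedDeriv_four hf (n := 2) (by lia)
  have c3 := continuous_iteratedDeriv_four hf (n := 3) (by lia)
  have h : (fun y => ((6 * V y - c : ℝ) : ℂ) * f y)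
      = fun y => ((6 * V y : ℝ) : ℂ) * f y - c * f y := by funext y; push_cast; ring
  unfold bloch₁
  rw [mean_add (by fun_prop) (by fun_prop), mean_add (by fun_prop) (by fun_prop),
    mean_const_mul (k : ℂ), mean_const_mul (3 * (k : ℂ) ^ 3), mean_const_mul (δ : ℂ),
    mean_add (by fun_prop) (by fun_prop), mean_const_mul (2 * (k : ℂ) ^ 2),
    mean_const_mul (4 * (k : ℂ) ^ 4), m1, mean_iteratedDeriv_four hf hp (n := 1) (by lia),
    mean_iteratedDeriv_four hf hp (n := 2) (by lia), h, mean_sub (by fun_prop) (by fun_prop),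
    mean_const_mul (c : ℂ)]
  ring

lemma mean_bloch₂ (hf : ContDiff ℝ 4 f) (hp : Function.Periodic f 1) :
    mean (bloch₂ δ k f) = δ * k ^ 2 * mean f := by
  have c0 := hf.continuous
  have c1 := continuous_iteratedDeriv_four hf (n := 1) (by lia)
  have m1 := mean_iteratedDeriv_four hf hp (n := 0) (by lia)
  rw [iteratedDeriv_one] at c1 m1
  have c2 := continuous_iteratedDeriv_four hf (n := 2) (by lia)
  unfold bloch₂
  rw [mean_add (by fun_prop) (by fun_prop), mean_const_mul (3 * (k : ℂ) ^ 3),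
    mean_const_mul (δ : ℂ), mean_add (by fun_prop) (by fun_prop), mean_const_mul ((k : ℂ) ^ 2),
    mean_const_mul (6 * (k : ℂ) ^ 4), m1, mean_iteratedDeriv_four hf hp (n := 1) (by lia)]
  ring

lemma mean_bloch₃ (hf : ContDiff ℝ 4 f) (hp : Function.Periodic f 1) :
    mean (bloch₃ δ k f) = k ^ 3 * mean f := by
  have c0 := hf.continuous
  have c1 := continuous_iteratedDeriv_four hf (n := 1) (by lia)
  have m1 := mean_iteratedDeriv_four hf hp (n := 0) (by lia)
  rw [iteratedDeriv_one] at c1 m1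
  unfold bloch₃
  rw [mean_add (by fun_prop) (by fun_prop), mean_const_mul ((k : ℂ) ^ 3),
    mean_const_mul (δ : ℂ), mean_const_mul (4 * (k : ℂ) ^ 4), m1]
  ring

end Bloch

/-- The equations satisfied by the coefficients of a Bloch mode at orders `0`, `1`, `2`, with the
solvability condition at order `3`. -/
structure OrderEqs (δ k c : ℝ) (V : ℝ → ℝ) (Λ₀ Λ₁ : ℂ) (u₀ u₁ u₂ : ℝ → ℂ) : Prop where
  zero : ∀ y, linOp δ k c V u₀ y = 0
  one : ∀ y, linOp δ k c V u₁ y + bloch₁ δ k c V u₀ y + k * Λ₀ * u₀ y = 0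
  two : ∀ y, linOp δ k c V u₂ y + bloch₁ δ k c V u₁ y + bloch₂ δ k u₀ y + k * Λ₀ * u₁ y
    + k * Λ₁ * u₀ y = 0
  three : mean (bloch₁ δ k c V u₂) + mean (bloch₂ δ k u₁) + mean (bloch₃ δ k u₀)
    + k * Λ₀ * mean u₂ + k * Λ₁ * mean u₁ = 0

/-! ### Linearity of the Bloch coefficients. -/

section BlochLinear

variable {δ k c : ℝ} {V : ℝ → ℝ} {f g : ℝ → ℂ}

lemma iteratedDeriv_add_four (hf : ContDiff ℝ 4 f) (hg : ContDiff ℝ 4 g) {n : ℕ} (hn : n ≤ 4)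
    (y : ℝ) : iteratedDeriv n (fun z => f z + g z) y = iteratedDeriv n f y + iteratedDeriv n g y :=
  have hn' : (n : ℕ∞ω) ≤ 4 := by exact_mod_cast hn
  iteratedDeriv_fun_add (hf.of_le hn').contDiffAt (hg.of_le hn').contDiffAt

lemma iteratedDeriv_const_mul_four (a : ℂ) (hf : ContDiff ℝ 4 f) {n : ℕ} (hn : n ≤ 4) (y : ℝ) :
    iteratedDeriv n (fun z => a * f z) y = a * iteratedDeriv n f y :=
  have hn' : (n : ℕ∞ω) ≤ 4 := by exact_mod_cast hn
  iteratedDeriv_const_mul a (hf.of_le hn').contDiffAt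

lemma bloch₁_add (hf : ContDiff ℝ 4 f) (hg : ContDiff ℝ 4 g) (y : ℝ) :
    bloch₁ δ k c V (fun z => f z + g z) y = bloch₁ δ k c V f y + bloch₁ δ k c V g y := by
  have h1 := iteratedDeriv_add_four hf hg (n := 1) (by lia) y
  simp only [iteratedDeriv_one] at h1
  simp only [bloch₁, h1, iteratedDeriv_add_four hf hg (n := 2) (by lia),
    iteratedDeriv_add_four hf hg (n := 3) (by lia)]
  ring

lemma bloch₂_add (hf : ContDiff ℝ 4 f) (hg : ContDiff ℝ 4 g) (y : ℝ) :
    bloch₂ δ k (fun z => f z + g z) y = bloch₂ δ k f y + bloch₂ δ k g y := by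
  have h1 := iteratedDeriv_add_four hf hg (n := 1) (by lia) y
  simp only [iteratedDeriv_one] at h1
  simp only [bloch₂, h1, iteratedDeriv_add_four hf hg (n := 2) (by lia)]
  ring

lemma bloch₃_add (hf : ContDiff ℝ 4 f) (hg : ContDiff ℝ 4 g) (y : ℝ) :
    bloch₃ δ k (fun z => f z + g z) y = bloch₃ δ k f y + bloch₃ δ k g y := by
  have h1 := iteratedDeriv_add_four hf hg (n := 1) (by lia) y
  simp only [iteratedDeriv_one] at h1
  simp only [bloch₃, h1]
  ring

lemma bloch₁_const_mul (a : ℂ) (hf : ContDiff ℝ 4 f) (y : ℝ) :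
    bloch₁ δ k c V (fun z => a * f z) y = a * bloch₁ δ k c V f y := by
  have h1 := iteratedDeriv_const_mul_four a hf (n := 1) (by lia) y
  simp only [iteratedDeriv_one] at h1
  simp only [bloch₁, h1, iteratedDeriv_const_mul_four a hf (n := 2) (by lia),
    iteratedDeriv_const_mul_four a hf (n := 3) (by lia)]
  ring

lemma bloch₂_const_mul (a : ℂ) (hf : ContDiff ℝ 4 f) (y : ℝ) :
    bloch₂ δ k (fun z => a * f z) y = a * bloch₂ δ k f y := by
  have h1 := iteratedDeriv_const_mul_four a hf (n := 1) (by lia) y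
  simp only [iteratedDeriv_one] at h1
  simp only [bloch₂, h1, iteratedDeriv_const_mul_four a hf (n := 2) (by lia)]
  ring

lemma bloch₃_const_mul (a : ℂ) (hf : ContDiff ℝ 4 f) (y : ℝ) :
    bloch₃ δ k (fun z => a * f z) y = a * bloch₃ δ k f y := by
  have h1 := iteratedDeriv_const_mul_four a hf (n := 1) (by lia) y
  simp only [iteratedDeriv_one] at h1
  simp only [bloch₃, h1]
  ring

lemma iteratedDeriv_ofReal {f : ℝ → ℝ} (hf : ContDiff ℝ ∞ f) (n : ℕ) (y : ℝ) :
    iteratedDeriv n (fun z => (f z : ℂ)) y = ((iteratedDeriv n f y : ℝ) : ℂ) :=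
  iteratedDeriv_clm_comp Complex.ofRealCLM
    (hf.of_le (WithTop.coe_le_coe.mpr le_top : ((n : ℕ∞) : ℕ∞ω) ≤ ∞)) y

lemma deriv_ofReal {f : ℝ → ℝ} (hf : ContDiff ℝ ∞ f) (y : ℝ) :
    deriv (fun z => (f z : ℂ)) y = ((deriv f y : ℝ) : ℂ) := by
  simpa only [iteratedDeriv_one] using iteratedDeriv_ofReal hf 1 y

lemma contDiff_four_ofReal {f : ℝ → ℝ} (hf : ContDiff ℝ ∞ f) :
    ContDiff ℝ 4 fun y => (f y : ℂ) :=
  Complex.ofRealCLM.contDiff.comp (hf.of_le (WithTop.coe_le_coe.mpr le_top : ((4 : ℕ∞) : ℕ∞ω) ≤ ∞))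

end BlochLinear

/-! ### Residuals of the ansatz `mode₀`, `mode₁`, `mode₂` at each order. -/

namespace IsWaveFamily

variable {δ : ℝ} {K : Set ℝ} {U : ℝ → ℝ → ℝ → ℝ} {c : ℝ → ℝ → ℝ} {k : ℝ}

lemma contDiff_ofReal_deriv_U (hU : IsWaveFamily δ K U c) (hk : k ∈ K) :
    ContDiff ℝ 4 fun y => ((deriv (U k 0) y : ℝ) : ℂ) :=
  contDiff_four_ofReal (hU.contDiff_deriv_U hk 0)

lemma contDiff_ofReal_dkU (hU : IsWaveFamily δ K U c) (hk : k ∈ K) :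
    ContDiff ℝ 4 fun y => ((dkU U k 0 y : ℝ) : ℂ) :=
  contDiff_four_ofReal (hU.contDiff_dkU hk 0)

lemma mode₀_eq (hU : IsWaveFamily δ K U c) (hk : k ∈ K) (M : ℝ) (k₀ : ℂ) :
    mode₀ U k M k₀ = fun y => k₀ / k * ((deriv (U k 0) y : ℝ) : ℂ) := by
  funext y; rw [mode₀, hU.deriv_U hk M]

lemma mode₁_eq (hU : IsWaveFamily δ K U c) (hk : k ∈ K) (M : ℝ) (k₀ M₀ k₁ : ℂ) :
    mode₁ U k M k₀ M₀ k₁ = fun y => (k₀ * ((dkU U k 0 y : ℝ) : ℂ) + M₀ * 1)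
      + k₁ / k * ((deriv (U k 0) y : ℝ) : ℂ) := by
  funext y; rw [mode₁, hU.deriv_U hk M, hU.dkU_eq hk M, hU.dMU_eq hk]; simp

lemma mode₂_eq (hU : IsWaveFamily δ K U c) (hk : k ∈ K) (M : ℝ) (Λ₀ k₀ M₀ k₁ M₁ k₂ : ℂ) :
    mode₂ δ U c k M Λ₀ k₀ M₀ k₁ M₁ k₂ = fun y => (((k₁ * ((dkU U k 0 y : ℝ) : ℂ)
      + (M₁ + k₀ * mean (fk δ U c k M Λ₀) + M₀ * mean (fM δ U c k M Λ₀)) * 1)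
      + -k₀ * fk δ U c k M Λ₀ y) + -M₀ * fM δ U c k M Λ₀ y)
      + k₂ / k * ((deriv (U k 0) y : ℝ) : ℂ) := by
  funext y; rw [mode₂, hU.deriv_U hk M, hU.dkU_eq hk M, hU.dMU_eq hk]; push_cast; ring

lemma contDiff_mode₀ (hU : IsWaveFamily δ K U c) (hk : k ∈ K) (M : ℝ) (k₀ : ℂ) :
    ContDiff ℝ 4 (mode₀ U k M k₀) := by
  rw [hU.mode₀_eq hk]; exact contDiff_const.mul (hU.contDiff_ofReal_deriv_U hk)

lemma contDiff_mode₁ (hU : IsWaveFamily δ K U c) (hk : k ∈ K) (M : ℝ) (k₀ M₀ k₁ : ℂ) :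
    ContDiff ℝ 4 (mode₁ U k M k₀ M₀ k₁) := by
  rw [hU.mode₁_eq hk]
  exact ((contDiff_const.mul (hU.contDiff_ofReal_dkU hk)).add contDiff_const).add
    (contDiff_const.mul (hU.contDiff_ofReal_deriv_U hk))

lemma contDiff_mode₂ (hδ : 0 < δ) (hU : IsWaveFamily δ K U c) (hk : k ∈ K) (M : ℝ)
    (Λ₀ k₀ M₀ k₁ M₁ k₂ : ℂ) : ContDiff ℝ 4 (mode₂ δ U c k M Λ₀ k₀ M₀ k₁ M₁ k₂) := by
  rw [hU.mode₂_eq hk]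
  exact ((((contDiff_const.mul (hU.contDiff_ofReal_dkU hk)).add contDiff_const).add
    (contDiff_const.mul (hU.isCorrector_fk' hδ hk M Λ₀).1)).add
    (contDiff_const.mul (hU.isCorrector_fM' hδ hk M Λ₀).1)).add
    (contDiff_const.mul (hU.contDiff_ofReal_deriv_U hk))

lemma periodic_mode₀ (hU : IsWaveFamily δ K U c) (hk : k ∈ K) (M : ℝ) (k₀ : ℂ) :
    Function.Periodic (mode₀ U k M k₀) 1 := fun y => by
  simp only [hU.mode₀_eq hk, hU.periodic_deriv_U hk 0 y]

lemma periodic_mode₁ (hU : IsWaveFamily δ K U c) (hk : k ∈ K) (M : ℝ) (k₀ M₀ k₁ : ℂ) :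
    Function.Periodic (mode₁ U k M k₀ M₀ k₁) 1 := fun y => by
  simp only [hU.mode₁_eq hk, hU.periodic_deriv_U hk 0 y, hU.periodic_dkU hk 0 y]

lemma periodic_mode₂ (hδ : 0 < δ) (hU : IsWaveFamily δ K U c) (hk : k ∈ K) (M : ℝ)
    (Λ₀ k₀ M₀ k₁ M₁ k₂ : ℂ) :
    Function.Periodic (mode₂ δ U c k M Λ₀ k₀ M₀ k₁ M₁ k₂) 1 := fun y => by
  simp only [hU.mode₂_eq hk, hU.periodic_deriv_U hk 0 y, hU.periodic_dkU hk 0 y,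
    (hU.isCorrector_fk' hδ hk M Λ₀).2.1 y, (hU.isCorrector_fM' hδ hk M Λ₀).2.1 y]

lemma mean_ofReal_deriv_U (hU : IsWaveFamily δ K U c) (hk : k ∈ K) :
    mean (fun y => ((deriv (U k 0) y : ℝ) : ℂ)) = 0 := by
  rw [mean_ofReal, mean_deriv ((hU.contDiff_U hk 0).of_le (by simp)) (hU.periodic k hk 0)]
  simp

lemma mean_ofReal_dkU (hU : IsWaveFamily δ K U c) (hk : k ∈ K) :
    mean (fun y => ((dkU U k 0 y : ℝ) : ℂ)) = 0 := by
  rw [mean_ofReal, hU.mean_dkU hk]; simp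

lemma mean_mode₀ (hU : IsWaveFamily δ K U c) (hk : k ∈ K) (M : ℝ) (k₀ : ℂ) :
    mean (mode₀ U k M k₀) = 0 := by
  rw [hU.mode₀_eq hk, mean_const_mul, hU.mean_ofReal_deriv_U hk, mul_zero]

lemma mean_mode₁ (hU : IsWaveFamily δ K U c) (hk : k ∈ K) (M : ℝ) (k₀ M₀ k₁ : ℂ) :
    mean (mode₁ U k M k₀ M₀ k₁) = M₀ := by
  have hd := (hU.contDiff_ofReal_dkU hk).continuous
  have hu := (hU.contDiff_ofReal_deriv_U hk).continuous
  rw [hU.mode₁_eq hk, mean_add (by fun_prop) (by fun_prop), mean_add (by fun_prop) (by fun_prop),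
    mean_const_mul, mean_const_mul (k₁ / k), hU.mean_ofReal_deriv_U hk, hU.mean_ofReal_dkU hk,
    mean_const]
  ring

lemma mean_mode₂ (hδ : 0 < δ) (hU : IsWaveFamily δ K U c) (hk : k ∈ K) (M : ℝ)
    (Λ₀ k₀ M₀ k₁ M₁ k₂ : ℂ) : mean (mode₂ δ U c k M Λ₀ k₀ M₀ k₁ M₁ k₂) = M₁ := by
  have hd := (hU.contDiff_ofReal_dkU hk).continuous
  have hu := (hU.contDiff_ofReal_deriv_U hk).continuous
  have hF := (hU.isCorrector_fk' hδ hk M Λ₀).1.continuous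
  have hG := (hU.isCorrector_fM' hδ hk M Λ₀).1.continuous
  rw [hU.mode₂_eq hk, mean_add (by fun_prop) (by fun_prop), mean_add (by fun_prop) (by fun_prop),
    mean_add (by fun_prop) (by fun_prop), mean_add (by fun_prop) (by fun_prop),
    mean_const_mul, mean_const_mul (-k₀), mean_const_mul (-M₀), mean_const_mul (k₂ / k),
    hU.mean_ofReal_deriv_U hk, hU.mean_ofReal_dkU hk, mean_const]
  ring

lemma linOp_ofReal_deriv_U (hU : IsWaveFamily δ K U c) (hk : k ∈ K) (M y : ℝ) :
    linOp δ k (c k M) (U k M) (fun y => ((deriv (U k 0) y : ℝ) : ℂ)) y = 0 := by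
  rw [← hU.deriv_U hk M, linOp_ofReal (hU.differentiable_U hk M)
    ((hU.contDiff_deriv_U hk M).of_le (WithTop.coe_le_coe.mpr le_top : ((4 : ℕ∞) : ℕ∞ω) ≤ ∞)),
    hU.linOp_deriv_U hk M y]
  simp

lemma linOp_complex_one (hU : IsWaveFamily δ K U c) (hk : k ∈ K) (M y : ℝ) :
    linOp δ k (c k M) (U k M) (fun _ => (1 : ℂ)) y = 6 * k * ((deriv (U k 0) y : ℝ) : ℂ) := by
  have h := linOp_ofReal (δ := δ) (k := k) (c := c k M) (hU.differentiable_U hk M)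
    (contDiff_const (c := (1 : ℝ))) y
  rw [hU.linOp_one hk M y, hU.deriv_U hk M] at h
  push_cast at h
  exact h

/-- In the profile equation `k` occurs explicitly only through `k d/dx`, and in the Bloch operator
`ν` only through `k (d/dx + ν)`. The explicit `k`-derivative of the differentiated profile equation,
times `k`, is therefore the `ν`-derivative `B₁` applied to `U'`. -/
lemma linOp_ofReal_dkU (hU : IsWaveFamily δ K U c) (hk : k ∈ K) (M y : ℝ) :
    k * linOp δ k (c k M) (U k M) (fun y => ((dkU U k 0 y : ℝ) : ℂ)) y
      + bloch₁ δ k (c k M) (U k M) (fun y => ((deriv (U k 0) y : ℝ) : ℂ)) y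
      = k ^ 2 * dk c k M * ((deriv (U k 0) y : ℝ) : ℂ) := by
  have hu := hU.contDiff_deriv_U hk 0
  rw [← hU.dkU_eq hk M, linOp_ofReal (hU.differentiable_U hk M)
    ((hU.contDiff_dkU hk M).of_le (WithTop.coe_le_coe.mpr le_top : ((4 : ℕ∞) : ℕ∞ω) ≤ ∞)),
    hU.linOp_dkU hk M y, bloch₁, iteratedDeriv_ofReal hu, iteratedDeriv_ofReal hu,
    deriv_ofReal hu, ← iteratedDeriv_succ', ← iteratedDeriv_succ', hU.iteratedDeriv_U hk M 1,
    hU.iteratedDeriv_U hk M 2, hU.iteratedDeriv_U hk M 3, hU.deriv_U hk M]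
  rw [show deriv (deriv (U k 0)) y = iteratedDeriv 2 (U k 0) y by
    simp [iteratedDeriv_succ', iteratedDeriv_zero]]
  push_cast
  ring

/-- The source of `f^k` is, after division by `k`, the order two remainder produced by the `k₀` part
of the leading modes, minus its average. The subtracted constant supplies the `k₀` term of the
second equation of (I). -/
lemma k_mul_vk (hU : IsWaveFamily δ K U c) (hk : k ∈ K) (M : ℝ) (Λ₀ : ℂ) (y : ℝ) :
    k * (k * vk δ U c k M Λ₀ y)
      = k * bloch₁ δ k (c k M) (U k M) (fun y => ((dkU U k 0 y : ℝ) : ℂ)) y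
        + k ^ 2 * Λ₀ * ((dkU U k 0 y : ℝ) : ℂ)
        + bloch₂ δ k (fun y => ((deriv (U k 0) y : ℝ) : ℂ)) y
        - k ^ 2 * dk (meanSq U) k M := by
  have hu := hU.contDiff_deriv_U hk 0
  have hd := hU.contDiff_dkU hk 0
  rw [hU.vk_eq hk, srcX, hU.dk_meanSq hk, bloch₁, bloch₂, iteratedDeriv_ofReal hu,
    deriv_ofReal hu, iteratedDeriv_ofReal hd, iteratedDeriv_ofReal hd, deriv_ofReal hd,
    ← iteratedDeriv_succ', hU.galilean k hk M y]
  rw [show deriv (deriv (U k 0)) y = iteratedDeriv 2 (U k 0) y by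
    simp [iteratedDeriv_succ', iteratedDeriv_zero]]
  push_cast
  ring

/-- The analogue for the constant mode: its order two remainder is the source of `f^M` plus the `M₀`
term of the second equation of (I). -/
lemma k_mul_vM (hU : IsWaveFamily δ K U c) (hk : k ∈ K) (M : ℝ) (Λ₀ : ℂ) (y : ℝ) :
    k * vM U c k M Λ₀ y = bloch₁ δ k (c k M) (U k M) (fun _ => (1 : ℂ)) y + k * Λ₀
      - k * (Λ₀ - c k M + dM (meanSq U) k M) := by
  rw [hU.vM_eq hk, hU.dM_meanSq hk, bloch₁, hU.galilean k hk M y]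
  simp [iteratedDeriv_const]
  ring

/-- The order `1` equation for the leading modes. -/
lemma linOp_mode₁ (hU : IsWaveFamily δ K U c) (hk : k ∈ K) (M : ℝ) (Λ₀ k₀ M₀ k₁ : ℂ) (y : ℝ) :
    linOp δ k (c k M) (U k M) (mode₁ U k M k₀ M₀ k₁) y
      + bloch₁ δ k (c k M) (U k M) (mode₀ U k M k₀) y + k * Λ₀ * mode₀ U k M k₀ y
      = (Λ₀ * k₀ + k * (dk c k M * k₀ + dM c k M * M₀)) * ((deriv (U k 0) y : ℝ) : ℂ) := by
  have hk0 : (k : ℂ) ≠ 0 := Complex.ofReal_ne_zero.mpr (hU.pos k hk).ne'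
  have hV := hU.differentiable_U hk M
  have hu := hU.contDiff_ofReal_deriv_U hk
  have hd := hU.contDiff_ofReal_dkU hk
  have h1 : ContDiff ℝ 4 fun _ : ℝ => (1 : ℂ) := contDiff_const
  rw [hU.mode₁_eq hk, hU.mode₀_eq hk,
    linOp_add hV ((contDiff_const.mul hd).add (contDiff_const.mul h1)) (contDiff_const.mul hu),
    linOp_add hV (contDiff_const.mul hd) (contDiff_const.mul h1), linOp_const_mul hV _ hd,
    linOp_const_mul hV _ h1, linOp_const_mul hV _ hu, bloch₁_const_mul _ hu,
    hU.linOp_ofReal_deriv_U hk, hU.linOp_complex_one hk, hU.dM_speed hk]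
  have h := hU.linOp_ofReal_dkU hk M y
  field_simp
  push_cast
  linear_combination k₀ * h

/-- The order `2` equation for the leading modes. -/
lemma linOp_mode₂ (hδ : 0 < δ) (hU : IsWaveFamily δ K U c) (hk : k ∈ K) (M : ℝ)
    (Λ₀ Λ₁ k₀ M₀ k₁ M₁ k₂ : ℂ) (y : ℝ) :
    linOp δ k (c k M) (U k M) (mode₂ δ U c k M Λ₀ k₀ M₀ k₁ M₁ k₂) y
      + bloch₁ δ k (c k M) (U k M) (mode₁ U k M k₀ M₀ k₁) y
      + bloch₂ δ k (mode₀ U k M k₀) y + k * Λ₀ * mode₁ U k M k₀ M₀ k₁ y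
      + k * Λ₁ * mode₀ U k M k₀ y
      = (Λ₁ * k₀ + Λ₀ * k₁ + k * (dk c k M * k₁ + dM c k M * M₁)
          + 6 * k * (k₀ * mean (fk δ U c k M Λ₀) + M₀ * mean (fM δ U c k M Λ₀)))
          * ((deriv (U k 0) y : ℝ) : ℂ)
        + k * (dk (meanSq U) k M * k₀ + (Λ₀ - c k M + dM (meanSq U) k M) * M₀) := by
  have hk0 : (k : ℂ) ≠ 0 := Complex.ofReal_ne_zero.mpr (hU.pos k hk).ne'
  have hV := hU.differentiable_U hk M
  have hu := hU.contDiff_ofReal_deriv_U hk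
  have hd := hU.contDiff_ofReal_dkU hk
  have h1 : ContDiff ℝ 4 fun _ : ℝ => (1 : ℂ) := contDiff_const
  have hF := hU.isCorrector_fk' hδ hk M Λ₀
  have hG := hU.isCorrector_fM' hδ hk M Λ₀
  have a1 := contDiff_const (c := k₁).mul hd
  have a2 := a1.add (contDiff_const (c := M₁ + k₀ * mean (fk δ U c k M Λ₀)
    + M₀ * mean (fM δ U c k M Λ₀)).mul h1)
  have a3 := a2.add (contDiff_const (c := -k₀).mul hF.1)
  have a4 := a3.add (contDiff_const (c := -M₀).mul hG.1)
  rw [hU.mode₂_eq hk, hU.mode₁_eq hk, hU.mode₀_eq hk,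
    linOp_add hV a4 (contDiff_const.mul hu), linOp_add hV a3 (contDiff_const.mul hG.1),
    linOp_add hV a2 (contDiff_const.mul hF.1), linOp_add hV a1 (contDiff_const.mul h1),
    linOp_const_mul hV _ hd, linOp_const_mul hV _ h1, linOp_const_mul hV _ hF.1,
    linOp_const_mul hV _ hG.1, linOp_const_mul hV _ hu, bloch₂_const_mul _ hu,
    bloch₁_add ((contDiff_const.mul hd).add (contDiff_const.mul h1)) (contDiff_const.mul hu),
    bloch₁_add (contDiff_const.mul hd) (contDiff_const.mul h1), bloch₁_const_mul _ hd,
    bloch₁_const_mul _ h1, bloch₁_const_mul _ hu,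
    hU.linOp_ofReal_deriv_U hk, hU.linOp_complex_one hk, hU.dM_speed hk, hF.2.2.1, hG.2.2.1]
  -- The `k₁` part repeats the order one computation (`e1`), while the correctors cancel the
  -- remainders of the `k₀` and `M₀` parts up to constants (`e2`, `e3`).
  have e1 := hU.linOp_ofReal_dkU hk M y
  have e2 := hU.k_mul_vk (δ := δ) hk M Λ₀ y
  have e3 := hU.k_mul_vM hk M Λ₀ y
  field_simp
  push_cast
  linear_combination k₁ * e1 - k₀ * e2 - k * M₀ * e3

lemma mean_six_U_mul (hU : IsWaveFamily δ K U c) (hk : k ∈ K) (M : ℝ) {f : ℝ → ℂ}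
    (hf : Continuous f) : mean (fun y => ((6 * U k M y : ℝ) : ℂ) * f y)
      = 6 * M * mean f + mean (fun y => ((6 * U k 0 y : ℝ) : ℂ) * f y) := by
  have hc := (hU.contDiff_U hk 0).continuous
  have h : (fun y => ((6 * U k M y : ℝ) : ℂ) * f y)
      = fun y => (6 * M : ℂ) * f y + ((6 * U k 0 y : ℝ) : ℂ) * f y := by
    funext y; rw [hU.galilean k hk M y]; push_cast; ring
  rw [h, mean_add (by fun_prop) (by fun_prop), mean_const_mul]

lemma mean_six_U_dkU (hU : IsWaveFamily δ K U c) (hk : k ∈ K) (M : ℝ) :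
    mean (fun y => ((6 * U k 0 y : ℝ) : ℂ) * ((dkU U k 0 y : ℝ) : ℂ)) = dk (meanSq U) k M := by
  have h : (fun y => ((6 * U k 0 y : ℝ) : ℂ) * ((dkU U k 0 y : ℝ) : ℂ))
      = fun y => ((6 * (U k 0 y * dkU U k 0 y) : ℝ) : ℂ) := by funext y; push_cast; ring
  rw [h, mean_ofReal, mean_const_mul, hU.dk_meanSq hk]

lemma mean_six_U (hU : IsWaveFamily δ K U c) (hk : k ∈ K) :
    mean (fun y => ((6 * U k 0 y : ℝ) : ℂ) * 1) = 0 := by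
  simp only [mul_one]
  rw [mean_ofReal, mean_const_mul 6 (U k 0), hU.mean_U_zero hk]
  simp

lemma mean_six_U_deriv_U (hU : IsWaveFamily δ K U c) (hk : k ∈ K) :
    mean (fun y => ((6 * U k 0 y : ℝ) : ℂ) * ((deriv (U k 0) y : ℝ) : ℂ)) = 0 := by
  have h : (fun y => ((6 * U k 0 y : ℝ) : ℂ) * ((deriv (U k 0) y : ℝ) : ℂ))
      = fun y => ((deriv (fun z => 3 * U k 0 z ^ 2) y : ℝ) : ℂ) := by
    funext y
    have hd := ((hU.differentiable_U hk 0 y).hasDerivAt.fun_pow 2).const_mul 3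
    rw [hd.deriv]; push_cast; ring
  have h2 : ContDiff ℝ 1 fun z => 3 * U k 0 z ^ 2 :=
    contDiff_const.mul (((hU.contDiff_U hk 0).of_le (by simp)).pow 2)
  rw [h, mean_ofReal, mean_deriv h2 (fun y => by simp only [hU.periodic k hk 0 y])]
  simp

/-- The average of the order `2` equation. -/
lemma mean_order_two (hU : IsWaveFamily δ K U c) (hk : k ∈ K) (M : ℝ) (Λ₀ k₀ M₀ k₁ : ℂ) :
    mean (bloch₁ δ k (c k M) (U k M) (mode₁ U k M k₀ M₀ k₁)) + k * Λ₀ * M₀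
      = k * (dk (meanSq U) k M * k₀ + (Λ₀ - c k M + dM (meanSq U) k M) * M₀) := by
  have hc := (hU.contDiff_U hk 0).continuous
  have hd := (hU.contDiff_ofReal_dkU hk).continuous
  have hu := (hU.contDiff_ofReal_deriv_U hk).continuous
  rw [mean_bloch₁ (hU.contDiff_U hk M).continuous (hU.contDiff_mode₁ hk M k₀ M₀ k₁)
    (hU.periodic_mode₁ hk M k₀ M₀ k₁), hU.mean_mode₁ hk,
    hU.mean_six_U_mul hk M (hU.contDiff_mode₁ hk M k₀ M₀ k₁).continuous, hU.mean_mode₁ hk,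
    hU.mode₁_eq hk]
  have h : (fun y => ((6 * U k 0 y : ℝ) : ℂ) * ((k₀ * ((dkU U k 0 y : ℝ) : ℂ) + M₀ * 1)
      + k₁ / k * ((deriv (U k 0) y : ℝ) : ℂ)))
      = fun y => (k₀ * (((6 * U k 0 y : ℝ) : ℂ) * ((dkU U k 0 y : ℝ) : ℂ))
        + M₀ * (((6 * U k 0 y : ℝ) : ℂ) * 1))
        + k₁ / k * (((6 * U k 0 y : ℝ) : ℂ) * ((deriv (U k 0) y : ℝ) : ℂ)) := by
    funext y; ring
  rw [h, mean_add (by fun_prop) (by fun_prop), mean_add (by fun_prop) (by fun_prop),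
    mean_const_mul, mean_const_mul, mean_const_mul, hU.mean_six_U_dkU hk M, hU.mean_six_U hk,
    hU.mean_six_U_deriv_U hk, hU.dM_meanSq hk]
  push_cast
  ring

/-- The average of the order `3` equation. -/
lemma mean_order_three (hδ : 0 < δ) (hU : IsWaveFamily δ K U c) (hk : k ∈ K) (M : ℝ)
    (Λ₀ Λ₁ k₀ M₀ k₁ M₁ k₂ : ℂ) :
    mean (bloch₁ δ k (c k M) (U k M) (mode₂ δ U c k M Λ₀ k₀ M₀ k₁ M₁ k₂))
      + mean (bloch₂ δ k (mode₁ U k M k₀ M₀ k₁)) + mean (bloch₃ δ k (mode₀ U k M k₀))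
      + k * Λ₀ * mean (mode₂ δ U c k M Λ₀ k₀ M₀ k₁ M₁ k₂)
      + k * Λ₁ * mean (mode₁ U k M k₀ M₀ k₁)
      = k * (((Λ₀ - c k M) * M₁ + Λ₁ * M₀ + (dk (meanSq U) k M * k₁ + dM (meanSq U) k M * M₁))
        - (-δ * k * M₀ + fluxMean (U k M) (fk δ U c k M Λ₀) * k₀
          + fluxMean (U k M) (fM δ U c k M Λ₀) * M₀)) := by
  have hc := (hU.contDiff_U hk 0).continuous
  have hd := (hU.contDiff_ofReal_dkU hk).continuous
  have hu := (hU.contDiff_ofReal_deriv_U hk).continuous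
  have hF := (hU.isCorrector_fk' hδ hk M Λ₀).1.continuous
  have hG := (hU.isCorrector_fM' hδ hk M Λ₀).1.continuous
  rw [mean_bloch₂ (hU.contDiff_mode₁ hk M k₀ M₀ k₁) (hU.periodic_mode₁ hk M k₀ M₀ k₁),
    mean_bloch₃ (hU.contDiff_mode₀ hk M k₀) (hU.periodic_mode₀ hk M k₀),
    mean_bloch₁ (hU.contDiff_U hk M).continuous (hU.contDiff_mode₂ hδ hk M Λ₀ k₀ M₀ k₁ M₁ k₂)
    (hU.periodic_mode₂ hδ hk M Λ₀ k₀ M₀ k₁ M₁ k₂), hU.mean_mode₁ hk, hU.mean_mode₀ hk,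
    hU.mean_six_U_mul hk M (hU.contDiff_mode₂ hδ hk M Λ₀ k₀ M₀ k₁ M₁ k₂).continuous,
    hU.mean_mode₂ hδ hk, hU.mode₂_eq hk, hU.fluxMean_eq hk M hF, hU.fluxMean_eq hk M hG]
  set m := M₁ + k₀ * mean (fk δ U c k M Λ₀) + M₀ * mean (fM δ U c k M Λ₀)
  have h : (fun y => ((6 * U k 0 y : ℝ) : ℂ) * ((((k₁ * ((dkU U k 0 y : ℝ) : ℂ) + m * 1)
      + -k₀ * fk δ U c k M Λ₀ y) + -M₀ * fM δ U c k M Λ₀ y)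
      + k₂ / k * ((deriv (U k 0) y : ℝ) : ℂ)))
      = fun y => (((k₁ * (((6 * U k 0 y : ℝ) : ℂ) * ((dkU U k 0 y : ℝ) : ℂ))
        + m * (((6 * U k 0 y : ℝ) : ℂ) * 1))
        + -k₀ * (((6 * U k 0 y : ℝ) : ℂ) * fk δ U c k M Λ₀ y))
        + -M₀ * (((6 * U k 0 y : ℝ) : ℂ) * fM δ U c k M Λ₀ y))
        + k₂ / k * (((6 * U k 0 y : ℝ) : ℂ) * ((deriv (U k 0) y : ℝ) : ℂ)) := by
    funext y; ring
  rw [h, mean_add (by fun_prop) (by fun_prop), mean_add (by fun_prop) (by fun_prop),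
    mean_add (by fun_prop) (by fun_prop), mean_add (by fun_prop) (by fun_prop),
    mean_const_mul, mean_const_mul, mean_const_mul, mean_const_mul, mean_const_mul,
    hU.mean_six_U_dkU hk M, hU.mean_six_U hk, hU.mean_six_U_deriv_U hk, hU.dM_meanSq hk]
  push_cast
  ring

end IsWaveFamily

/-! ### Equivalence of the order equations with the two systems. -/

namespace IsWaveFamily

variable {δ : ℝ} {K : Set ℝ} {U : ℝ → ℝ → ℝ → ℝ} {c : ℝ → ℝ → ℝ} {k : ℝ}

/-- The translation mode is not in the range of `L` restricted to functions of zero mean. -/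
lemma eq_zero_of_linOp_eq (hU : IsWaveFamily δ K U c) (hk : k ∈ K) (M : ℝ) {g : ℝ → ℂ} {s : ℂ}
    (hg : ContDiff ℝ 4 g) (hp : Function.Periodic g 1) (hm : mean g = 0)
    (h : ∀ y, linOp δ k (c k M) (U k M) g y = s * ((deriv (U k 0) y : ℝ) : ℂ)) :
    s = 0 ∧ ∃ a : ℂ, ∀ y, g y = a * ((deriv (U k 0) y : ℝ) : ℂ) := by
  have hk0 : (k : ℂ) ≠ 0 := Complex.ofReal_ne_zero.mpr (hU.pos k hk).ne'
  have h1 : ContDiff ℝ 4 fun _ : ℝ => (1 : ℂ) := contDiff_const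
  have hV := hU.differentiable_U hk M
  obtain ⟨a, ha⟩ := hU.kernel_complex hk M
    -- Since `L 1 = 6 k U'`, subtracting `s / (6k)` moves `g` into the kernel. The result is a
    -- multiple of `U'`, whose average is zero, and comparing averages forces `s = 0`.
    (hg.add (contDiff_const (c := -(s / (6 * k))).mul h1)) (fun y => by simp only [hp y])
    (fun y => by
      rw [linOp_add hV hg (contDiff_const.mul h1), linOp_const_mul hV _ h1, h,
        hU.linOp_complex_one hk]
      field_simp
      ring)
  rw [hU.deriv_U hk M] at ha
  have h2 := mean_add hg.continuous (contDiff_const (c := -(s / (6 * k))).mul h1).continuous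
  rw [funext ha, mean_const_mul, hU.mean_ofReal_deriv_U hk, hm] at h2
  simp only [mul_one, mul_zero, zero_add, mean_const] at h2
  have hs : s = 0 := by
    have h3 := h2
    field_simp at h3
    simpa using h3.symm
  refine ⟨hs, a, fun y => ?_⟩
  rw [← ha y, hs]
  simp

lemma exists_ofReal_deriv_ne_zero (hU : IsWaveFamily δ K U c) (hk : k ∈ K) :
    ∃ y, ((deriv (U k 0) y : ℝ) : ℂ) ≠ 0 := by
  obtain ⟨y, hy⟩ := hU.exists_deriv_ne_zero hk 0
  exact ⟨y, Complex.ofReal_ne_zero.mpr hy⟩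

/-- Order zero puts `u₀` in the kernel. At order one, `u₁` minus the ansatz of the same average has
zero average and is mapped by `L` to a multiple of `U'`, hence is itself a multiple of `U'`. -/
lemma exists_modes_of_orderEqs (hU : IsWaveFamily δ K U c) (hk : k ∈ K) (M : ℝ)
    {Λ₀ Λ₁ : ℂ} {u₀ u₁ u₂ : ℝ → ℂ} (h₀ : ContDiff ℝ 4 u₀) (h₁ : ContDiff ℝ 4 u₁)
    (p₀ : Function.Periodic u₀ 1) (p₁ : Function.Periodic u₁ 1)
    (h : OrderEqs δ k (c k M) (U k M) Λ₀ Λ₁ u₀ u₁ u₂) :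
    ∃ k₀ k₁ : ℂ, u₀ = mode₀ U k M k₀ ∧ u₁ = mode₁ U k M k₀ (mean u₁) k₁ := by
  have hk0 : (k : ℂ) ≠ 0 := Complex.ofReal_ne_zero.mpr (hU.pos k hk).ne'
  have hV := hU.differentiable_U hk M
  obtain ⟨a, ha⟩ := hU.kernel_complex hk M h₀ p₀ h.zero
  rw [hU.deriv_U hk M] at ha
  have e₀ : u₀ = mode₀ U k M (k * a) := by
    funext y; rw [hU.mode₀_eq hk, ha y]; field_simp
  -- The ansatz is taken with `k₁ = 0`; the true `k₁` is read off from the kernel component `b` of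
  -- the difference.
  have hm := hU.contDiff_mode₁ hk M (k * a) (mean u₁) 0
  obtain ⟨-, b, hb⟩ := hU.eq_zero_of_linOp_eq hk M
    (s := -(Λ₀ * (k * a) + k * (dk c k M * (k * a) + dM c k M * mean u₁)))
    (h₁.add (contDiff_const (c := (-1 : ℂ)).mul hm))
    (fun y => by simp only [p₁ y, hU.periodic_mode₁ hk M _ _ _ y])
    (by rw [mean_add h₁.continuous (contDiff_const.mul hm).continuous, mean_const_mul,
          hU.mean_mode₁ hk]; ring)
    (fun y => by
      rw [linOp_add hV h₁ (contDiff_const.mul hm), linOp_const_mul hV _ hm]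
      have e := h.one y
      rw [e₀] at e
      linear_combination e - hU.linOp_mode₁ hk M Λ₀ (k * a) (mean u₁) 0 y)
  refine ⟨k * a, k * b, e₀, funext fun y => ?_⟩
  have e := hb y
  rw [hU.mode₁_eq hk] at e ⊢
  rw [mul_div_cancel_left₀ _ hk0]
  linear_combination e

/-- The four equations have four sources: the coefficient of `U'` at order one (`f1`), the average
at order two (`f2`), the coefficient of `U'` at order two (`hs`), and the average at order three. -/
lemma systems_of_orderEqs (hδ : 0 < δ) (hU : IsWaveFamily δ K U c) (hk : k ∈ K) (M : ℝ)
    {Λ₀ Λ₁ k₀ M₀ k₁ : ℂ} {u₂ : ℝ → ℂ} (h₂ : ContDiff ℝ 4 u₂) (p₂ : Function.Periodic u₂ 1)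
    (h : OrderEqs δ k (c k M) (U k M) Λ₀ Λ₁ (mode₀ U k M k₀) (mode₁ U k M k₀ M₀ k₁) u₂) :
    FirstOrderSystem U c k M Λ₀ k₀ M₀ ∧ SecondOrderSystem δ U c k M Λ₀ k₀ M₀ Λ₁ k₁ (mean u₂) ∧
      ∃ k₂, u₂ = mode₂ δ U c k M Λ₀ k₀ M₀ k₁ (mean u₂) k₂ := by
  have hk0 : (k : ℂ) ≠ 0 := Complex.ofReal_ne_zero.mpr (hU.pos k hk).ne'
  have hV := hU.differentiable_U hk M
  have hVc := hV.continuous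
  have c₀ := hU.contDiff_mode₀ hk M k₀
  have c₁ := hU.contDiff_mode₁ hk M k₀ M₀ k₁
  have f1 : Λ₀ * k₀ + k * (dk c k M * k₀ + dM c k M * M₀) = 0 := by
    obtain ⟨y, hy⟩ := hU.exists_ofReal_deriv_ne_zero hk
    have e := hU.linOp_mode₁ hk M Λ₀ k₀ M₀ k₁ y
    rw [h.one y] at e
    exact (mul_eq_zero.mp e.symm).resolve_right hy
  -- Averaging the order two equation removes `L u₂` and, since `<û₀> = 0`, all terms in `û₀`.
  have f2 : dk (meanSq U) k M * k₀ + (Λ₀ - c k M + dM (meanSq U) k M) * M₀ = 0 := by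
    have e := congrArg mean (funext h.two)
    have l₂ := continuous_linOp (δ := δ) (k := k) (c := c k M)
      ((hU.contDiff_U hk M).of_le (by simp)) h₂
    have b₁ := continuous_bloch₁ (δ := δ) (k := k) (c := c k M) hVc c₁
    have b₂ := continuous_bloch₂ (δ := δ) (k := k) c₀
    have d₀ := c₀.continuous
    have d₁ := c₁.continuous
    rw [mean_add (by fun_prop) (by fun_prop), mean_add (by fun_prop) (by fun_prop),
      mean_add (by fun_prop) (by fun_prop), mean_add (by fun_prop) (by fun_prop),
      mean_const_mul, mean_const_mul, mean_const, hU.mean_linOp hk M h₂ p₂,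
      mean_bloch₂ c₀ (hU.periodic_mode₀ hk M k₀), hU.mean_mode₀ hk, hU.mean_mode₁ hk] at e
    have e' := hU.mean_order_two (δ := δ) hk M Λ₀ k₀ M₀ k₁
    refine (mul_eq_zero.mp (?_ : (k : ℂ) * _ = 0)).resolve_left hk0
    linear_combination e - e'
  -- As at order one, `k₂ = 0` is provisional. The constant in the residual is cancelled by `f2`, so
  -- the difference falls under `eq_zero_of_linOp_eq`.
  have hm := hU.contDiff_mode₂ hδ hk M Λ₀ k₀ M₀ k₁ (mean u₂) 0
  obtain ⟨hs, b, hb⟩ := hU.eq_zero_of_linOp_eq hk M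
    (s := -(Λ₁ * k₀ + Λ₀ * k₁ + k * (dk c k M * k₁ + dM c k M * mean u₂)
          + 6 * k * (k₀ * mean (fk δ U c k M Λ₀) + M₀ * mean (fM δ U c k M Λ₀))))
    (h₂.add (contDiff_const (c := (-1 : ℂ)).mul hm))
    (fun y => by simp only [p₂ y, hU.periodic_mode₂ hδ hk M _ _ _ _ _ _ y])
    (by rw [mean_add h₂.continuous (contDiff_const.mul hm).continuous, mean_const_mul,
          hU.mean_mode₂ hδ hk]; ring)
    (fun y => by
      rw [linOp_add hV h₂ (contDiff_const.mul hm), linOp_const_mul hV _ hm]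
      linear_combination h.two y - hU.linOp_mode₂ hδ hk M Λ₀ Λ₁ k₀ M₀ k₁ (mean u₂) 0 y - k * f2)
  have e₂ : u₂ = mode₂ δ U c k M Λ₀ k₀ M₀ k₁ (mean u₂) (k * b) := by
    funext y
    have e := hb y
    rw [hU.mode₂_eq hk] at e ⊢
    rw [mul_div_cancel_left₀ _ hk0]
    linear_combination e
  refine ⟨⟨f1, f2⟩, ⟨?_, ?_⟩, _, e₂⟩
  · linear_combination -hs
  · have e' := hU.mean_order_three hδ hk M Λ₀ Λ₁ k₀ M₀ k₁ (mean u₂) (k * b)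
    rw [← e₂, h.three] at e'
    exact sub_eq_zero.mp ((mul_eq_zero.mp e'.symm).resolve_left hk0)

lemma orderEqs_of_systems (hδ : 0 < δ) (hU : IsWaveFamily δ K U c) (hk : k ∈ K) (M : ℝ)
    {Λ₀ Λ₁ k₀ M₀ k₁ M₁ : ℂ} (h₀ : FirstOrderSystem U c k M Λ₀ k₀ M₀)
    (h₁ : SecondOrderSystem δ U c k M Λ₀ k₀ M₀ Λ₁ k₁ M₁) (k₂ : ℂ) :
    OrderEqs δ k (c k M) (U k M) Λ₀ Λ₁ (mode₀ U k M k₀) (mode₁ U k M k₀ M₀ k₁)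
      (mode₂ δ U c k M Λ₀ k₀ M₀ k₁ M₁ k₂) where
  zero y := by
    rw [hU.mode₀_eq hk, linOp_const_mul (hU.differentiable_U hk M) _
      (hU.contDiff_ofReal_deriv_U hk), hU.linOp_ofReal_deriv_U hk, mul_zero]
  one y := by rw [hU.linOp_mode₁ hk, h₀.1, zero_mul]
  two y := by
    rw [hU.linOp_mode₂ hδ hk, h₀.2]
    linear_combination ((deriv (U k 0) y : ℝ) : ℂ) * h₁.1
  three := by rw [hU.mean_order_three hδ hk, h₁.2, sub_self, mul_zero]

end IsWaveFamily

/-! ### Second order expansions in `ν`. -/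

/-- `a(ν) = a₀ + ν a₁ + ν² a₂ + O(ν³)`. -/
def QuadExpansion (a : ℝ → ℂ) (a₀ a₁ a₂ : ℂ) : Prop :=
  (fun ξ : ℝ => a ξ - (a₀ + Complex.I * ξ * a₁ + (Complex.I * ξ) ^ 2 * a₂))
    =O[𝓝[≠] (0 : ℝ)] fun ξ => ξ ^ 3

lemma isBigO_one_of_continuous {f : ℝ → ℂ} (hf : Continuous f) :
    f =O[𝓝[≠] (0 : ℝ)] fun _ => (1 : ℝ) :=
  ((hf.tendsto (0 : ℝ)).isBigO_one ℝ).mono nhdsWithin_le_nhds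

lemma isBigO_pow_of_le {m n : ℕ} (h : m ≤ n) :
    (fun ξ : ℝ => ξ ^ n) =O[𝓝[≠] (0 : ℝ)] fun ξ => ξ ^ m := by
  obtain ⟨d, rfl⟩ := Nat.exists_eq_add_of_le h
  have h1 : (fun ξ : ℝ => ξ ^ d) =O[𝓝[≠] (0 : ℝ)] fun _ => (1 : ℝ) :=
    (((continuous_pow d).tendsto (0 : ℝ)).isBigO_one ℝ).mono nhdsWithin_le_nhds
  exact ((isBigO_refl (fun ξ : ℝ => ξ ^ m) _).mul h1).congr (fun ξ => by ring) fun ξ => by ring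

namespace QuadExpansion

variable {a b : ℝ → ℂ} {a₀ a₁ a₂ b₀ b₁ b₂ : ℂ}

lemma const (z : ℂ) : QuadExpansion (fun _ => z) z 0 0 := by
  simpa [QuadExpansion] using isBigO_zero _ _

lemma nu : QuadExpansion (fun ξ => Complex.I * ξ) 0 1 0 := by
  simpa [QuadExpansion] using isBigO_zero _ _

lemma add (ha : QuadExpansion a a₀ a₁ a₂) (hb : QuadExpansion b b₀ b₁ b₂) :
    QuadExpansion (fun ξ => a ξ + b ξ) (a₀ + b₀) (a₁ + b₁) (a₂ + b₂) :=
  (IsBigO.add ha hb).congr_left fun ξ => by ring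

lemma isBigO_one (ha : QuadExpansion a a₀ a₁ a₂) :
    a =O[𝓝[≠] (0 : ℝ)] fun _ => (1 : ℝ) := by
  have h1 := isBigO_pow_of_le (zero_le : 0 ≤ 3)
  simp only [pow_zero] at h1
  have h2 := isBigO_one_of_continuous
    (f := fun ξ : ℝ => a₀ + Complex.I * ξ * a₁ + (Complex.I * ξ) ^ 2 * a₂) (by fun_prop)
  exact ((ha.trans h1).add h2).congr_left fun ξ => by ring

lemma mul (ha : QuadExpansion a a₀ a₁ a₂) (hb : QuadExpansion b b₀ b₁ b₂) :
    QuadExpansion (fun ξ => a ξ * b ξ) (a₀ * b₀) (a₀ * b₁ + a₁ * b₀)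
      (a₀ * b₂ + a₁ * b₁ + a₂ * b₀) := by
  have h2 := isBigO_one_of_continuous
    (f := fun ξ : ℝ => a₀ + Complex.I * ξ * a₁ + (Complex.I * ξ) ^ 2 * a₂) (by fun_prop)
  have h3 := isBigO_one_of_continuous
    (f := fun ξ : ℝ => Complex.I ^ 3 * ((a₁ * b₂ + a₂ * b₁) + Complex.I * ξ * (a₂ * b₂)))
    (by fun_prop)
  have e1 := IsBigO.mul ha hb.isBigO_one
  have e2 := IsBigO.mul h2 hb
  have e3 := (AmplitudeExpansion.isBigO_ofReal_pow (l := 𝓝[≠] (0 : ℝ)) 3).mul h3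
  simp only [mul_one, one_mul] at e1 e2 e3
  exact ((e1.add e2).add e3).congr_left fun ξ => by ring

lemma congr (ha : QuadExpansion a a₀ a₁ a₂)
    (h : ∀ᶠ ξ in 𝓝[≠] (0 : ℝ), a ξ = b ξ) : QuadExpansion b a₀ a₁ a₂ :=
  IsBigO.congr' ha (h.mono fun ξ hξ => by simp only [hξ]) EventuallyEq.rfl

/-- The quotient by `ν`. -/
lemma div_nu (ha : QuadExpansion a 0 a₁ a₂) :
    AmplitudeExpansion (fun ξ => a ξ / (Complex.I * ξ)) a₁ a₂ := by
  have h : EigenvalueExpansion 1 a a₁ a₂ := IsBigO.congr_left ha fun ξ => by push_cast; ring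
  simpa using AmplitudeExpansion.of_eigenvalue h

lemma toAmplitude (ha : QuadExpansion a a₀ a₁ a₂) : AmplitudeExpansion a a₀ a₁ := by
  have h := (AmplitudeExpansion.isBigO_ofReal_pow (l := 𝓝[≠] (0 : ℝ)) 2).const_mul_left
    (Complex.I ^ 2 * a₂)
  exact ((ha.trans (isBigO_pow_of_le (by lia : 2 ≤ 3))).add h).congr_left fun ξ => by ring

lemma eq_zero_of_isBigO (ha : QuadExpansion a a₀ a₁ a₂)
    (h : a =O[𝓝[≠] (0 : ℝ)] fun ξ => ξ ^ 3) : a₀ = 0 ∧ a₁ = 0 ∧ a₂ = 0 := by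
  obtain ⟨h0, h1⟩ := ha.toAmplitude.isBigO_sq_iff.mp
    (h.trans (isBigO_pow_of_le (by lia : 2 ≤ 3)))
  subst h0 h1
  have hinv : (fun ξ : ℝ => (Complex.I * ξ)⁻¹) =O[𝓝[≠] (0 : ℝ)] fun ξ => ξ⁻¹ :=
    IsBigO.of_bound 1 (Eventually.of_forall fun ξ => by simp)
  have h2 : (fun ξ => a ξ / (Complex.I * ξ)) =O[𝓝[≠] (0 : ℝ)] fun ξ => ξ ^ 2 := by
    refine (h.mul hinv).congr' (Eventually.of_forall fun ξ => by simp only [div_eq_mul_inv]) ?_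
    filter_upwards [self_mem_nhdsWithin] with ξ hξ
    have hξ' : ξ ≠ 0 := hξ
    field_simp
  exact ⟨rfl, rfl, (ha.div_nu.isBigO_sq_iff.mp h2).2⟩

end QuadExpansion

lemma EigenvalueExpansion.quadExpansion {k : ℝ} {l : ℝ → ℂ} {Λ₀ Λ₁ : ℂ}
    (h : EigenvalueExpansion k l Λ₀ Λ₁) : QuadExpansion l 0 (k * Λ₀) (k * Λ₁) :=
  IsBigO.congr_left h fun ξ => by ring

/-- A bound that is uniform in the phase passes to weighted averages. -/
lemma isBigO_mean_mul {w : ℝ → ℂ} (hw : Continuous w) {r : ℝ → ℝ → ℂ} {n : ℕ} {C : ℝ}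
    (h : ∀ᶠ ξ : ℝ in 𝓝[≠] (0 : ℝ), ∀ x, ‖r ξ x‖ ≤ C * |ξ| ^ n) :
    (fun ξ => mean fun x => w x * r ξ x) =O[𝓝[≠] (0 : ℝ)] fun ξ => ξ ^ n := by
  obtain ⟨B, hB⟩ := (isCompact_uIcc (a := (0 : ℝ)) (b := 1)).exists_bound_of_continuousOn
    hw.continuousOn
  refine IsBigO.of_bound (B * C) (h.mono fun ξ hξ => ?_)
  have h1 := intervalIntegral.norm_integral_le_of_norm_le_const (a := (0 : ℝ)) (b := 1)
    (f := fun x => w x * r ξ x) (C := B * (C * |ξ| ^ n)) fun x hx => by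
      rw [norm_mul]
      have hb := hB x (Set.uIoc_subset_uIcc hx)
      exact mul_le_mul hb (hξ x) (norm_nonneg _) ((norm_nonneg _).trans hb)
  rw [norm_pow, Real.norm_eq_abs]
  simpa [mean, mul_assoc] using h1

/-! ### Exact spectral curves and quasi-modes treated together as approximate curves. -/

/-- A curve of approximate Bloch modes, with a residual of order `4`. -/
structure IsApproxCurve (δ k c : ℝ) (V : ℝ → ℝ) (l : ℝ → ℂ) (u : ℝ → ℝ → ℂ) (Λ₀ Λ₁ : ℂ)
    (u₀ u₁ u₂ : ℝ → ℂ) : Prop where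
  mode_smooth : ∀ᶠ ξ : ℝ in 𝓝[≠] (0 : ℝ), ContDiff ℝ 4 (u ξ)
  mode_periodic : ∀ᶠ ξ : ℝ in 𝓝[≠] (0 : ℝ), Function.Periodic (u ξ) 1
  residual : ∃ C : ℝ, ∀ᶠ ξ : ℝ in 𝓝[≠] (0 : ℝ), ∀ x,
    ‖blochOp δ k c V (Complex.I * ξ) (u ξ) x + l ξ * u ξ x‖ ≤ C * |ξ| ^ 4
  coeff_smooth : ContDiff ℝ 4 u₀ ∧ ContDiff ℝ 4 u₁ ∧ ContDiff ℝ 4 u₂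
  coeff_periodic :
    Function.Periodic u₀ 1 ∧ Function.Periodic u₁ 1 ∧ Function.Periodic u₂ 1
  eigenvalue : EigenvalueExpansion k l Λ₀ Λ₁
  eigenvector : ∀ j ≤ 4, ∃ C : ℝ, ∀ᶠ ξ : ℝ in 𝓝[≠] (0 : ℝ), ∀ x,
    ‖iteratedDeriv j (fun z => u ξ z
      - (u₀ z + Complex.I * ξ * u₁ z + (Complex.I * ξ) ^ 2 * u₂ z)) x‖ ≤ C * |ξ| ^ 3

namespace IsApproxCurve

variable {δ k c : ℝ} {V : ℝ → ℝ} {l : ℝ → ℂ} {u : ℝ → ℝ → ℂ} {Λ₀ Λ₁ : ℂ} {u₀ u₁ u₂ : ℝ → ℂ}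

lemma quadExpansion_iteratedDeriv (h : IsApproxCurve δ k c V l u Λ₀ Λ₁ u₀ u₁ u₂) {j : ℕ}
    (hj : j ≤ 4) (y : ℝ) : QuadExpansion (fun ξ => iteratedDeriv j (u ξ) y)
      (iteratedDeriv j u₀ y) (iteratedDeriv j u₁ y) (iteratedDeriv j u₂ y) := by
  obtain ⟨C, hC⟩ := h.eigenvector j hj
  obtain ⟨c₀, c₁, c₂⟩ := h.coeff_smooth
  refine IsBigO.of_bound C ?_
  filter_upwards [hC, h.mode_smooth] with ξ hξ hs
  have e := hξ y
  have m₁ : ContDiff ℝ 4 fun z => Complex.I * ξ * u₁ z := contDiff_const.mul c₁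
  have m₂ : ContDiff ℝ 4 fun z => (Complex.I * ξ) ^ 2 * u₂ z := contDiff_const.mul c₂
  have m : ContDiff ℝ 4 fun z => (-1 : ℂ) * (u₀ z + Complex.I * ξ * u₁ z
    + (Complex.I * ξ) ^ 2 * u₂ z) := contDiff_const.mul ((c₀.add m₁).add m₂)
  rw [show (fun z => u ξ z - (u₀ z + Complex.I * ξ * u₁ z + (Complex.I * ξ) ^ 2 * u₂ z))
      = fun z => u ξ z + (-1 : ℂ) * (u₀ z + Complex.I * ξ * u₁ z + (Complex.I * ξ) ^ 2 * u₂ z) by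
    funext z; ring, iteratedDeriv_add_four hs m hj, iteratedDeriv_const_mul_four _ ((c₀.add m₁).add m₂) hj,
    iteratedDeriv_add_four (c₀.add m₁) m₂ hj, iteratedDeriv_add_four c₀ m₁ hj,
    iteratedDeriv_const_mul_four _ c₁ hj, iteratedDeriv_const_mul_four _ c₂ hj] at e
  rw [norm_pow, Real.norm_eq_abs]
  simpa [sub_eq_add_neg] using e

lemma quadExpansion_apply (h : IsApproxCurve δ k c V l u Λ₀ Λ₁ u₀ u₁ u₂) (y : ℝ) :
    QuadExpansion (fun ξ => u ξ y) (u₀ y) (u₁ y) (u₂ y) := by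
  simpa only [iteratedDeriv_zero] using h.quadExpansion_iteratedDeriv (zero_le : 0 ≤ 4) y

lemma quadExpansion_mean_mul (h : IsApproxCurve δ k c V l u Λ₀ Λ₁ u₀ u₁ u₂) {w : ℝ → ℂ}
    (hw : Continuous w) : QuadExpansion (fun ξ => mean fun x => w x * u ξ x)
      (mean fun x => w x * u₀ x) (mean fun x => w x * u₁ x) (mean fun x => w x * u₂ x) := by
  obtain ⟨C, hC⟩ := h.eigenvector 0 (by lia)
  simp only [iteratedDeriv_zero] at hC
  obtain ⟨c₀, c₁, c₂⟩ := h.coeff_smooth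
  have d₀ := c₀.continuous
  have d₁ := c₁.continuous
  have d₂ := c₂.continuous
  refine (isBigO_mean_mul hw hC).congr' ?_ EventuallyEq.rfl
  filter_upwards [h.mode_smooth] with ξ hs
  have ds := hs.continuous
  have e : (fun x => w x * (u ξ x
      - (u₀ x + Complex.I * ξ * u₁ x + (Complex.I * ξ) ^ 2 * u₂ x)))
      = fun x => w x * u ξ x - ((w x * u₀ x + (Complex.I * ξ) * (w x * u₁ x))
        + (Complex.I * ξ) ^ 2 * (w x * u₂ x)) := by funext x; ring
  rw [e, mean_sub (by fun_prop) (by fun_prop), mean_add (by fun_prop) (by fun_prop),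
    mean_add (by fun_prop) (by fun_prop), mean_const_mul (Complex.I * (ξ : ℂ)),
    mean_const_mul ((Complex.I * (ξ : ℂ)) ^ 2)]

lemma quadExpansion_mean (h : IsApproxCurve δ k c V l u Λ₀ Λ₁ u₀ u₁ u₂) :
    QuadExpansion (fun ξ => mean (u ξ)) (mean u₀) (mean u₁) (mean u₂) := by
  simpa only [one_mul] using h.quadExpansion_mean_mul (continuous_const (y := (1 : ℂ)))

/-- The pointwise equations at orders `0`, `1`, `2`. -/
lemma pointwise (h : IsApproxCurve δ k c V l u Λ₀ Λ₁ u₀ u₁ u₂) (hV : Differentiable ℝ V) (y : ℝ) :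
    linOp δ k c V u₀ y = 0 ∧
    linOp δ k c V u₁ y + bloch₁ δ k c V u₀ y + k * Λ₀ * u₀ y = 0 ∧
    linOp δ k c V u₂ y + bloch₁ δ k c V u₁ y + bloch₂ δ k u₀ y + k * Λ₀ * u₁ y
      + k * Λ₁ * u₀ y = 0 := by
  have C := QuadExpansion.const
  have ν := QuadExpansion.nu
  have q0 := h.quadExpansion_apply y
  have q1 := h.quadExpansion_iteratedDeriv (by lia : 1 ≤ 4) y
  simp only [iteratedDeriv_one] at q1
  have q2 := h.quadExpansion_iteratedDeriv (by lia : 2 ≤ 4) y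
  have q3 := h.quadExpansion_iteratedDeriv (by lia : 3 ≤ 4) y
  have q4 := h.quadExpansion_iteratedDeriv (by lia : 4 ≤ 4) y
  have hL := ((C k).mul (((C ((6 * deriv V y : ℝ) : ℂ)).mul q0).add
      ((C ((6 * V y - c : ℝ) : ℂ)).mul q1))).add ((C ((k : ℂ) ^ 3)).mul q3)
    |>.add ((C δ).mul (((C ((k : ℂ) ^ 2)).mul q2).add ((C ((k : ℂ) ^ 4)).mul q4)))
  have h1 := (((C k).mul ((C ((6 * V y - c : ℝ) : ℂ)).mul q0)).add
      ((C (3 * (k : ℂ) ^ 3)).mul q2)).add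
    ((C δ).mul (((C (2 * (k : ℂ) ^ 2)).mul q1).add ((C (4 * (k : ℂ) ^ 4)).mul q3)))
  have h2 := ((C (3 * (k : ℂ) ^ 3)).mul q1).add
    ((C δ).mul (((C ((k : ℂ) ^ 2)).mul q0).add ((C (6 * (k : ℂ) ^ 4)).mul q2)))
  have h3 := ((C ((k : ℂ) ^ 3)).mul q0).add ((C δ).mul ((C (4 * (k : ℂ) ^ 4)).mul q1))
  -- The whole Bloch equation at a fixed phase is assembled as an expansion in `ν`, so that
  -- `QuadExpansion.mul` computes its three coefficients; the residual `O(ν⁴)` makes them vanish.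
  have hB := ((((hL.add (ν.mul h1)).add ((ν.mul ν).mul h2)).add (((ν.mul ν).mul ν).mul h3)).add
    ((((ν.mul ν).mul ν).mul ν).mul ((C (δ * (k : ℂ) ^ 4)).mul q0))).add
    (h.eigenvalue.quadExpansion.mul q0)
  obtain ⟨B, hres⟩ := h.residual
  have hz := (hB.congr (b := fun ξ => blochOp δ k c V (Complex.I * ξ) (u ξ) y + l ξ * u ξ y)
    (by
      filter_upwards [h.mode_smooth] with ξ hs
      rw [blochOp_eq hs, linOp_eq hV (hs.differentiable (by simp)), bloch₁, bloch₂, bloch₃]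
      simp only [RCLike.ofReal_eq_complex_ofReal]
      ring)).eq_zero_of_isBigO (by
    refine IsBigO.trans (IsBigO.of_bound B (hres.mono fun ξ hξ => ?_))
      (isBigO_pow_of_le (by lia : 3 ≤ 4))
    rw [norm_pow, Real.norm_eq_abs]
    exact hξ y)
  obtain ⟨z0, z1, z2⟩ := hz
  obtain ⟨c₀, c₁, c₂⟩ := h.coeff_smooth
  rw [linOp_eq hV (c₀.differentiable (by simp)), linOp_eq hV (c₁.differentiable (by simp)),
    linOp_eq hV (c₂.differentiable (by simp)), bloch₁, bloch₁, bloch₂]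
  simp only [RCLike.ofReal_eq_complex_ofReal]
  refine ⟨?_, ?_, ?_⟩
  · linear_combination z0
  · linear_combination z1
  · linear_combination z2

end IsApproxCurve

namespace IsWaveFamily

variable {δ : ℝ} {K : Set ℝ} {U : ℝ → ℝ → ℝ → ℝ} {c : ℝ → ℝ → ℝ} {k : ℝ}

/-- The pointwise equations stop at order two because the mode is known up to `O(ν³)`. After
averaging, `L` is gone and every remaining operator term carries a factor `ν`; in `λ <u>` both
factors are `O(ν)`, as `<u₀> = 0`. So the averaged equation is determined up to `O(ν⁴)`, and the
next coefficient of `λ` cannot enter at order three. -/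
lemma orderEqs_of_isApproxCurve (hU : IsWaveFamily δ K U c) (hk : k ∈ K) (M : ℝ) {l : ℝ → ℂ}
    {u : ℝ → ℝ → ℂ} {Λ₀ Λ₁ : ℂ} {u₀ u₁ u₂ : ℝ → ℂ}
    (h : IsApproxCurve δ k (c k M) (U k M) l u Λ₀ Λ₁ u₀ u₁ u₂) :
    OrderEqs δ k (c k M) (U k M) Λ₀ Λ₁ u₀ u₁ u₂ := by
  have hV := hU.differentiable_U hk M
  have hV1 : ContDiff ℝ 1 (U k M) := (hU.contDiff_U hk M).of_le (by simp)
  have hVc := hV.continuous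
  obtain ⟨c₀, c₁, c₂⟩ := h.coeff_smooth
  obtain ⟨p₀, p₁, p₂⟩ := h.coeff_periodic
  have pw := h.pointwise hV
  have m₀ : mean u₀ = 0 := by
    obtain ⟨a, ha⟩ := hU.kernel_complex hk M c₀ p₀ fun y => (pw y).1
    rw [funext ha, mean_const_mul, hU.deriv_U hk M, hU.mean_ofReal_deriv_U hk, mul_zero]
  -- The averaged order one equation shows that `<B₁ u>` has no leading term, which allows the
  -- division by `ν` below.
  have mb₀ : mean (bloch₁ δ k (c k M) (U k M) u₀) = 0 := by
    have e := congrArg mean (funext fun y => (pw y).2.1)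
    have cl := continuous_linOp (δ := δ) (k := k) (c := c k M) hV1 c₁
    have cb := continuous_bloch₁ (δ := δ) (k := k) (c := c k M) hVc c₀
    have d₀ := c₀.continuous
    rw [mean_add (by fun_prop) (by fun_prop), mean_add (by fun_prop) (by fun_prop),
      hU.mean_linOp hk M c₁ p₁, mean_const_mul, m₀, mean_const] at e
    linear_combination e
  rw [mean_bloch₁ hVc c₀ p₀, m₀] at mb₀
  refine ⟨fun y => (pw y).1, fun y => (pw y).2.1, fun y => (pw y).2.2, ?_⟩
  rw [mean_bloch₁ hVc c₂ p₂, mean_bloch₂ c₁ p₁, mean_bloch₃ c₀ p₀, m₀]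
  have qm := h.quadExpansion_mean
  rw [m₀] at qm
  have qn := h.quadExpansion_mean_mul (w := fun x => ((6 * U k M x : ℝ) : ℂ)) (by fun_prop)
  have C := QuadExpansion.const
  have qs := (C k).mul (qn.add ((C (-(c k M))).mul qm))
  have zs : (k : ℂ) * ((mean fun x => ((6 * U k M x : ℝ) : ℂ) * u₀ x) + -(c k M) * 0) = 0 := by
    linear_combination mb₀
  rw [zs] at qs
  have A := AmplitudeExpansion.const
  have ν := AmplitudeExpansion.nu
  have am := qm.toAmplitude
  -- This is the averaged Bloch equation divided by `ν²`; its coefficient of `ν` is the order three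
  -- condition, and the averaged residual becomes `O(ν²)`.
  have hT := (((qs.div_nu.add ((A (δ * k ^ 2)).mul am)).add (ν.mul ((A (k ^ 3)).mul am))).add
    ((ν.mul ν).mul ((A (δ * k ^ 4)).mul am))).add (h.eigenvalue.quadExpansion.div_nu.mul qm.div_nu)
  obtain ⟨B, hB⟩ := h.residual
  have hr := isBigO_mean_mul (continuous_const (y := (1 : ℂ))) hB
  simp only [one_mul] at hr
  have hinv : (fun ξ : ℝ => ((Complex.I * ξ) ^ 2)⁻¹) =O[𝓝[≠] (0 : ℝ)] fun ξ => (ξ ^ 2)⁻¹ :=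
    IsBigO.of_bound 1 (Eventually.of_forall fun ξ => by simp)
  obtain ⟨-, z⟩ := hT.isBigO_sq_iff.mp (by
    refine (hr.mul hinv).congr' ?_ ?_
    · filter_upwards [h.mode_smooth, h.mode_periodic, self_mem_nhdsWithin] with ξ hs hp hξ
      have hξ' : (ξ : ℂ) ≠ 0 := Complex.ofReal_ne_zero.mpr hξ
      have ds := hs.continuous
      have cl := continuous_linOp (δ := δ) (k := k) (c := c k M) hV1 hs
      have cb₁ := continuous_bloch₁ (δ := δ) (k := k) (c := c k M) hVc hs
      have cb₂ := continuous_bloch₂ (δ := δ) (k := k) hs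
      have cb₃ := continuous_bloch₃ (δ := δ) (k := k) hs
      simp only [blochOp_eq hs]
      rw [mean_add (by fun_prop) (by fun_prop), mean_add (by fun_prop) (by fun_prop),
        mean_add (by fun_prop) (by fun_prop), mean_add (by fun_prop) (by fun_prop),
        mean_add (by fun_prop) (by fun_prop), mean_const_mul, mean_const_mul, mean_const_mul,
        mean_const_mul, mean_const_mul, mean_const_mul, hU.mean_linOp hk M hs hp,
        mean_bloch₁ hVc hs hp, mean_bloch₂ hs hp, mean_bloch₃ hs hp]
      field_simp
      ring
    · filter_upwards [self_mem_nhdsWithin] with ξ hξ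
      have hξ' : ξ ≠ 0 := hξ
      field_simp)
  linear_combination z

end IsWaveFamily

lemma IsSpectralCurve.isApproxCurve {δ : ℝ} {U : ℝ → ℝ → ℝ → ℝ} {c : ℝ → ℝ → ℝ} {k M : ℝ}
    {l : ℝ → ℂ} {u : ℝ → ℝ → ℂ} {Λ₀ Λ₁ : ℂ} {u₀ u₁ u₂ : ℝ → ℂ}
    (h : IsSpectralCurve δ U c k M l u Λ₀ Λ₁ u₀ u₁ u₂) :
    IsApproxCurve δ k (c k M) (U k M) l u Λ₀ Λ₁ u₀ u₁ u₂ where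
  mode_smooth := h.mode_smooth
  mode_periodic := h.mode_periodic
  residual := ⟨0, h.mode_eq.mono fun ξ hξ x => by rw [hξ x]; simp⟩
  coeff_smooth := h.coeff_smooth
  coeff_periodic := h.coeff_periodic
  eigenvalue := h.eigenvalue
  eigenvector := h.eigenvector

lemma exists_bound_of_periodic {f : ℝ → ℂ} (hf : Continuous f) (hp : Function.Periodic f 1) :
    ∃ B : ℝ, 0 ≤ B ∧ ∀ x, ‖f x‖ ≤ B := by
  obtain ⟨B, hB⟩ := (hp.isBounded_of_continuous one_ne_zero hf).exists_norm_le
  exact ⟨B, (norm_nonneg _).trans (hB (f 0) ⟨0, rfl⟩), fun x => hB _ ⟨x, rfl⟩⟩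

/-- The terms `ν³ u₃` and `ν³ l₂` are absorbed in the `O(ν³)` errors of the expansions, while the
residual keeps its order `4`. -/
lemma isApproxCurve_of_isQuasiMode {δ : ℝ} {U : ℝ → ℝ → ℝ → ℝ} {c : ℝ → ℝ → ℝ} {k M : ℝ}
    {Λ₀ Λ₁ l₂ : ℂ} {u₀ u₁ u₂ u₃ : ℝ → ℂ} (c₀ : ContDiff ℝ 4 u₀) (c₁ : ContDiff ℝ 4 u₁)
    (c₂ : ContDiff ℝ 4 u₂) (c₃ : ContDiff ℝ 4 u₃) (p₀ : Function.Periodic u₀ 1)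
    (p₁ : Function.Periodic u₁ 1) (p₂ : Function.Periodic u₂ 1) (p₃ : Function.Periodic u₃ 1)
    (h : IsQuasiMode δ U c k M Λ₀ Λ₁ l₂ u₀ u₁ u₂ u₃) :
    IsApproxCurve δ k (c k M) (U k M)
      (fun ξ => Complex.I * ξ * (k * Λ₀) + (Complex.I * ξ) ^ 2 * (k * Λ₁)
        + (Complex.I * ξ) ^ 3 * l₂)
      (fun ξ z => u₀ z + Complex.I * ξ * u₁ z + (Complex.I * ξ) ^ 2 * u₂ z
        + (Complex.I * ξ) ^ 3 * u₃ z) Λ₀ Λ₁ u₀ u₁ u₂ where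
  mode_smooth := Eventually.of_forall fun ξ => by fun_prop
  mode_periodic := Eventually.of_forall fun ξ y => by simp only [p₀ y, p₁ y, p₂ y, p₃ y]
  residual := h
  coeff_smooth := ⟨c₀, c₁, c₂⟩
  coeff_periodic := ⟨p₀, p₁, p₂⟩
  eigenvalue :=
    ((AmplitudeExpansion.isBigO_ofReal_pow 3).const_mul_left (Complex.I ^ 3 * l₂)).congr_left
      fun ξ => by ring
  eigenvector j hj := by
    obtain ⟨B, -, hB⟩ := exists_bound_of_periodic (continuous_iteratedDeriv_four c₃ hj)
      (periodic_iteratedDeriv p₃ j)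
    refine ⟨B, Eventually.of_forall fun ξ x => ?_⟩
    rw [show (fun z => u₀ z + Complex.I * ξ * u₁ z + (Complex.I * ξ) ^ 2 * u₂ z
        + (Complex.I * ξ) ^ 3 * u₃ z - (u₀ z + Complex.I * ξ * u₁ z
        + (Complex.I * ξ) ^ 2 * u₂ z)) = fun z => (Complex.I * ξ) ^ 3 * u₃ z by
      funext z; ring, iteratedDeriv_const_mul_four _ c₃ hj, norm_mul, norm_pow, norm_mul,
      Complex.norm_I, one_mul, Complex.norm_real, Real.norm_eq_abs, mul_comm]
    exact mul_le_mul_of_nonneg_right (hB x) (by positivity)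

namespace IsWaveFamily

variable {δ : ℝ} {K : Set ℝ} {U : ℝ → ℝ → ℝ → ℝ} {c : ℝ → ℝ → ℝ} {k : ℝ}

/-- The averaged order three condition is exactly the solvability condition for `u₃`. The eigenvalue
coefficient at order three may be taken to be `0`, because it would multiply only `u₀` there, whose
contribution is not needed for solvability. -/
lemma exists_isQuasiMode_of_orderEqs (hδ : 0 < δ) (hU : IsWaveFamily δ K U c) (hk : k ∈ K) (M : ℝ)
    {Λ₀ Λ₁ : ℂ} {u₀ u₁ u₂ : ℝ → ℂ} (c₀ : ContDiff ℝ 4 u₀) (c₁ : ContDiff ℝ 4 u₁)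
    (c₂ : ContDiff ℝ 4 u₂) (p₀ : Function.Periodic u₀ 1)
    (p₁ : Function.Periodic u₁ 1) (p₂ : Function.Periodic u₂ 1)
    (h : OrderEqs δ k (c k M) (U k M) Λ₀ Λ₁ u₀ u₁ u₂) :
    ∃ u₃ : ℝ → ℂ, ContDiff ℝ 4 u₃ ∧ Function.Periodic u₃ 1 ∧
      IsQuasiMode δ U c k M Λ₀ Λ₁ 0 u₀ u₁ u₂ u₃ := by
  have hV := hU.differentiable_U hk M
  have hVc := hV.continuous
  have hVp := hU.periodic k hk M
  have d₀ := c₀.continuous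
  have d₁ := c₁.continuous
  have d₂ := c₂.continuous
  have b₁ {f : ℝ → ℂ} (hf : ContDiff ℝ 4 f) :=
    continuous_bloch₁ (δ := δ) (k := k) (c := c k M) hVc hf
  have b₂ {f : ℝ → ℂ} (hf : ContDiff ℝ 4 f) := continuous_bloch₂ (δ := δ) (k := k) hf
  have b₃ {f : ℝ → ℂ} (hf : ContDiff ℝ 4 f) := continuous_bloch₃ (δ := δ) (k := k) hf
  have q₁ {f : ℝ → ℂ} (hf : Function.Periodic f 1) :=
    periodic_bloch₁ (δ := δ) (k := k) (c := c k M) hVp hf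
  have q₂ {f : ℝ → ℂ} (hf : Function.Periodic f 1) := periodic_bloch₂ (δ := δ) (k := k) hf
  have q₃ {f : ℝ → ℂ} (hf : Function.Periodic f 1) := periodic_bloch₃ (δ := δ) (k := k) hf
  have b₁₂ := b₁ c₂
  have b₂₁ := b₂ c₁
  have b₃₀ := b₃ c₀
  obtain ⟨u₃, ⟨c₃, p₃, e₃, -⟩, -⟩ := hU.existsUnique_complex hδ hk M
    (r := fun y => (-1 : ℂ) * (bloch₁ δ k (c k M) (U k M) u₂ y + bloch₂ δ k u₁ y + bloch₃ δ k u₀ y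
      + k * Λ₀ * u₂ y + k * Λ₁ * u₁ y)) (by fun_prop)
    (fun y => by simp only [q₁ p₂ y, q₂ p₁ y, q₃ p₀ y, p₂ y, p₁ y])
    (by
      rw [mean_const_mul, mean_add (by fun_prop) (by fun_prop),
        mean_add (by fun_prop) (by fun_prop), mean_add (by fun_prop) (by fun_prop),
        mean_add (by fun_prop) (by fun_prop), mean_const_mul, mean_const_mul, h.three, mul_zero])
  refine ⟨u₃, c₃, p₃, ?_⟩
  have d₃ := c₃.continuous
  have b₁₃ := b₁ c₃
  have b₂₂ := b₂ c₂
  have b₃₁ := b₃ c₁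
  have b₂₃ := b₂ c₃
  have b₃₂ := b₃ c₂
  have b₃₃ := b₃ c₃
  -- The four bounds are for the coefficients of `ν⁴` to `ν⁷` in the residual, each continuous and
  -- periodic; for `|ξ| < 1` their sum is a valid constant.
  obtain ⟨B₄, n₄, h₄⟩ := exists_bound_of_periodic
    (f := fun y => bloch₁ δ k (c k M) (U k M) u₃ y + bloch₂ δ k u₂ y + bloch₃ δ k u₁ y
      + δ * k ^ 4 * u₀ y + k * Λ₀ * u₃ y + k * Λ₁ * u₂ y) (by fun_prop)
    (fun y => by simp only [q₁ p₃ y, q₂ p₂ y, q₃ p₁ y, p₀ y, p₃ y, p₂ y])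
  obtain ⟨B₅, n₅, h₅⟩ := exists_bound_of_periodic
    (f := fun y => bloch₂ δ k u₃ y + bloch₃ δ k u₂ y + δ * k ^ 4 * u₁ y + k * Λ₁ * u₃ y)
    (by fun_prop) (fun y => by simp only [q₂ p₃ y, q₃ p₂ y, p₁ y, p₃ y])
  obtain ⟨B₆, n₆, h₆⟩ := exists_bound_of_periodic
    (f := fun y => bloch₃ δ k u₃ y + δ * k ^ 4 * u₂ y)
    (by fun_prop) (fun y => by simp only [q₃ p₃ y, p₂ y])
  obtain ⟨B₇, n₇, h₇⟩ := exists_bound_of_periodic (f := fun y => δ * k ^ 4 * u₃ y)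
    (by fun_prop) (fun y => by simp only [p₃ y])
  refine ⟨B₄ + B₅ + B₆ + B₇, ?_⟩
  have hsmall : ∀ᶠ ξ : ℝ in 𝓝[≠] (0 : ℝ), |ξ| < 1 :=
    (continuous_abs.tendsto' (0 : ℝ) 0 abs_zero).eventually_lt_const one_pos
      |>.filter_mono nhdsWithin_le_nhds
  filter_upwards [hsmall] with ξ hξ x
  simp only
  set ν : ℂ := Complex.I * ξ
  have hν : ‖ν‖ = |ξ| := by simp [ν]
  have m₁ : ContDiff ℝ 4 fun z => ν * u₁ z := contDiff_const.mul c₁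
  have m₂ : ContDiff ℝ 4 fun z => ν ^ 2 * u₂ z := contDiff_const.mul c₂
  have m₃ : ContDiff ℝ 4 fun z => ν ^ 3 * u₃ z := contDiff_const.mul c₃
  have s₁ := c₀.add m₁
  have s₂ := s₁.add m₂
  have key : blochOp δ k (c k M) (U k M) ν
        (fun z => u₀ z + ν * u₁ z + ν ^ 2 * u₂ z + ν ^ 3 * u₃ z) x
      + (ν * (k * Λ₀) + ν ^ 2 * (k * Λ₁) + ν ^ 3 * 0)
        * (u₀ x + ν * u₁ x + ν ^ 2 * u₂ x + ν ^ 3 * u₃ x)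
      = ν ^ 4 * ((bloch₁ δ k (c k M) (U k M) u₃ x + bloch₂ δ k u₂ x + bloch₃ δ k u₁ x
          + δ * k ^ 4 * u₀ x + k * Λ₀ * u₃ x + k * Λ₁ * u₂ x)
        + ν * (bloch₂ δ k u₃ x + bloch₃ δ k u₂ x + δ * k ^ 4 * u₁ x + k * Λ₁ * u₃ x)
        + ν ^ 2 * (bloch₃ δ k u₃ x + δ * k ^ 4 * u₂ x) + ν ^ 3 * (δ * k ^ 4 * u₃ x)) := by
    rw [blochOp_eq (s₂.add m₃), linOp_add hV s₂ m₃, linOp_add hV s₁ m₂, linOp_add hV c₀ m₁,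
      linOp_const_mul hV _ c₁, linOp_const_mul hV _ c₂, linOp_const_mul hV _ c₃,
      bloch₁_add s₂ m₃, bloch₁_add s₁ m₂, bloch₁_add c₀ m₁, bloch₁_const_mul _ c₁,
      bloch₁_const_mul _ c₂, bloch₁_const_mul _ c₃,
      bloch₂_add s₂ m₃, bloch₂_add s₁ m₂, bloch₂_add c₀ m₁, bloch₂_const_mul _ c₁,
      bloch₂_const_mul _ c₂, bloch₂_const_mul _ c₃,
      bloch₃_add s₂ m₃, bloch₃_add s₁ m₂, bloch₃_add c₀ m₁, bloch₃_const_mul _ c₁,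
      bloch₃_const_mul _ c₂, bloch₃_const_mul _ c₃]
    linear_combination h.zero x + ν * h.one x + ν ^ 2 * h.two x + ν ^ 3 * e₃ x
  rw [key, norm_mul, norm_pow, hν, mul_comm]
  refine mul_le_mul_of_nonneg_right ?_ (by positivity)
  have bd {z : ℂ} {B : ℝ} (hz : ‖z‖ ≤ B) (n : ℕ) : ‖ν ^ n * z‖ ≤ B := by
    rw [norm_mul, norm_pow, hν]
    exact (mul_le_of_le_one_left (norm_nonneg z) (pow_le_one₀ (abs_nonneg ξ) hξ.le)).trans hz
  refine (norm_add_le_of_le (norm_add_le_of_le (norm_add_le_of_le (h₄ x) ?_) (bd (h₆ x) 2))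
    (bd (h₇ x) 3))
  simpa using bd (h₅ x) 1

lemma exists_isQuasiMode_iff (hδ : 0 < δ) (hU : IsWaveFamily δ K U c) (hk : k ∈ K) (M : ℝ)
    (Λ₀ Λ₁ k₀ M₀ k₁ M₁ : ℂ) :
    (∃ (l₂ : ℂ) (u₂ u₃ : ℝ → ℂ), ContDiff ℝ 4 u₂ ∧ ContDiff ℝ 4 u₃ ∧
      Function.Periodic u₂ 1 ∧ Function.Periodic u₃ 1 ∧ mean u₂ = M₁ ∧
      IsQuasiMode δ U c k M Λ₀ Λ₁ l₂ (mode₀ U k M k₀) (mode₁ U k M k₀ M₀ k₁) u₂ u₃) ↔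
    FirstOrderSystem U c k M Λ₀ k₀ M₀ ∧ SecondOrderSystem δ U c k M Λ₀ k₀ M₀ Λ₁ k₁ M₁ := by
  have c₀ := hU.contDiff_mode₀ hk M k₀
  have c₁ := hU.contDiff_mode₁ hk M k₀ M₀ k₁
  have p₀ := hU.periodic_mode₀ hk M k₀
  have p₁ := hU.periodic_mode₁ hk M k₀ M₀ k₁
  constructor
  · rintro ⟨l₂, u₂, u₃, c₂, c₃, p₂, p₃, rfl, h⟩
    obtain ⟨h₀, h₁, -⟩ := hU.systems_of_orderEqs hδ hk M c₂ p₂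
      (hU.orderEqs_of_isApproxCurve hk M (isApproxCurve_of_isQuasiMode c₀ c₁ c₂ c₃ p₀ p₁ p₂ p₃ h))
    exact ⟨h₀, h₁⟩
  · rintro ⟨h₀, h₁⟩
    -- The coefficient `k₂` of the kernel direction is free at these orders; `0` is chosen.
    have c₂ := hU.contDiff_mode₂ hδ hk M Λ₀ k₀ M₀ k₁ M₁ 0
    have p₂ := hU.periodic_mode₂ hδ hk M Λ₀ k₀ M₀ k₁ M₁ 0
    obtain ⟨u₃, c₃, p₃, h⟩ := hU.exists_isQuasiMode_of_orderEqs hδ hk M c₀ c₁ c₂ p₀ p₁ p₂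
      (hU.orderEqs_of_systems hδ hk M h₀ h₁ 0)
    exact ⟨0, _, u₃, c₂, c₃, p₂, p₃, hU.mean_mode₂ hδ hk M Λ₀ k₀ M₀ k₁ M₁ 0, h⟩

lemma spectralCurve_coefficients (hδ : 0 < δ) (hU : IsWaveFamily δ K U c) (hk : k ∈ K) (M : ℝ)
    {l : ℝ → ℂ} {u : ℝ → ℝ → ℂ} {Λ₀ Λ₁ : ℂ} {u₀ u₁ u₂ : ℝ → ℂ}
    (h : IsSpectralCurve δ U c k M l u Λ₀ Λ₁ u₀ u₁ u₂) :
    ∃ k₀ M₀ k₁ M₁ k₂ : ℂ,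
      u₀ = mode₀ U k M k₀ ∧ u₁ = mode₁ U k M k₀ M₀ k₁ ∧ mean u₁ = M₀ ∧
      u₂ = mode₂ δ U c k M Λ₀ k₀ M₀ k₁ M₁ k₂ ∧ mean u₂ = M₁ ∧
      FirstOrderSystem U c k M Λ₀ k₀ M₀ ∧
      SecondOrderSystem δ U c k M Λ₀ k₀ M₀ Λ₁ k₁ M₁ := by
  have ho := hU.orderEqs_of_isApproxCurve hk M h.isApproxCurve
  obtain ⟨c₀, c₁, c₂⟩ := h.coeff_smooth
  obtain ⟨p₀, p₁, p₂⟩ := h.coeff_periodic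
  obtain ⟨k₀, k₁, e₀, e₁⟩ := hU.exists_modes_of_orderEqs hk M c₀ c₁ p₀ p₁ ho
  have ho' := ho
  rw [e₀, e₁] at ho'
  obtain ⟨h₀, h₁, k₂, e₂⟩ := hU.systems_of_orderEqs hδ hk M c₂ p₂ ho'
  exact ⟨k₀, mean u₁, k₁, mean u₂, k₂, e₀, e₁, rfl, e₂, rfl, h₀, h₁⟩

/-- At a simple root of the dispersion relation the second order system determines `Λ₁`. -/
lemma eq_of_secondOrderSystem (hU : IsWaveFamily δ K U c) (hk : k ∈ K) (M : ℝ)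
    {Λ₀ Λ₁ Λ₁' k₀ M₀ k₁ M₁ k₀' M₀' k₁' M₁' : ℂ} (hs : IsSimpleDispersionRoot U c k M Λ₀)
    (h₀ : FirstOrderSystem U c k M Λ₀ k₀ M₀)
    (h₁ : SecondOrderSystem δ U c k M Λ₀ k₀ M₀ Λ₁ k₁ M₁) (hk₀ : k₀ ≠ 0)
    (h₀' : FirstOrderSystem U c k M Λ₀ k₀' M₀')
    (h₁' : SecondOrderSystem δ U c k M Λ₀ k₀' M₀' Λ₁' k₁' M₁') (hne : (k₀', M₀') ≠ (0, 0)) :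
    Λ₁' = Λ₁ := by
  have hk0 : (k : ℂ) ≠ 0 := Complex.ofReal_ne_zero.mpr (hU.pos k hk).ne'
  obtain ⟨hD, hD'⟩ := hs
  have hder : HasDerivAt (fun Λ : ℂ => (Λ + (k : ℂ) * (dk c k M : ℂ))
        * (Λ - (c k M : ℂ) + (dM (meanSq U) k M : ℂ))
      - (k : ℂ) * (dM c k M : ℂ) * (dk (meanSq U) k M : ℂ))
      (1 * (Λ₀ - (c k M : ℂ) + (dM (meanSq U) k M : ℂ))
        + (Λ₀ + (k : ℂ) * (dk c k M : ℂ)) * 1) Λ₀ :=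
    ((((hasDerivAt_id' Λ₀).add_const _).fun_mul
      (((hasDerivAt_id' Λ₀).sub_const _).add_const _)).sub_const _)
  rw [hder.deriv] at hD'
  obtain ⟨a, b⟩ := h₀
  obtain ⟨a', b'⟩ := h₀'
  obtain ⟨e, f⟩ := h₁
  obtain ⟨e', f'⟩ := h₁'
  simp only [hU.dM_speed hk] at hD a a' e e'
  push_cast at hD a a' e e'
  generalize fluxMean (U k M) (fk δ U c k M Λ₀) = F at f f'
  generalize fluxMean (U k M) (fM δ U c k M Λ₀) = G at f f'
  generalize mean (fk δ U c k M Λ₀) = A at e e'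
  generalize mean (fM δ U c k M Λ₀) = B at e e'
  set q : ℂ := 6 * k
  -- Here `q = k ∂_M c`. Its nonvanishing lets the first equation of (I) express `M₀` through `k₀`,
  -- so a nonzero solution of (I) has `k₀ ≠ 0`.
  have hq : q ≠ 0 := mul_ne_zero (by norm_num) hk0
  set r : ℂ := (dk (meanSq U) k M : ℂ)
  set s : ℂ := Λ₀ - (c k M : ℂ) + (dM (meanSq U) k M : ℂ) with hs
  set p : ℂ := Λ₀ + (k : ℂ) * (dk c k M : ℂ) with hp
  have hM : M₀ = -p * k₀ / q := by
    rw [eq_div_iff hq, hp]; simp only [q]; linear_combination a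
  have hM' : M₀' = -p * k₀' / q := by
    rw [eq_div_iff hq, hp]; simp only [q]; linear_combination a'
  have hk₀' : k₀' ≠ 0 := fun h => hne (by rw [hM', h]; simp)
  -- The matrix of (I) has rows `(p, q)` and `(r, s)`, and at the root `(s, -q)` is a left null
  -- vector. Pairing it with (II) eliminates `κ₁`, `m₁` and multiplies `Λ κ` by `s + p`, the
  -- derivative of the determinant at `Λ₀`. After cancelling `κ`, the equation for `Λ` no longer
  -- depends on the solution chosen.
  have key : ∀ {Λ κ m κ₁ m₁ : ℂ}, κ ≠ 0 → m = -p * κ / q →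
      Λ * κ + Λ₀ * κ₁ + k * (dk c k M * κ₁ + 6 * m₁) = -6 * k * (κ * A + m * B) →
      (Λ₀ - c k M) * m₁ + Λ * m + (r * κ₁ + dM (meanSq U) k M * m₁)
        = -δ * k * m + F * κ + G * m →
      Λ * (1 * s + p * 1)
        = s * (-q * (A - p / q * B)) - q * (δ * k * (p / q) + F - G * (p / q)) := by
    intro Λ κ m κ₁ m₁ hκ hm h1 h2
    refine mul_right_cancel₀ hκ ?_
    have hm' : m = -(p / q) * κ := by rw [hm]; ring
    have e3 : p / q * q = p := div_mul_cancel₀ p hq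
    have h1' : Λ * κ + p * κ₁ + q * m₁ = -q * (κ * A + m * B) := by
      simp only [hp, q]; linear_combination h1
    have h2' : Λ * m + r * κ₁ + s * m₁ = -δ * k * m + F * κ + G * m := by
      rw [hs]; linear_combination h2
    have hD2 : p * s = q * r := by
      simp only [q]; linear_combination hD
    rw [hm'] at h1' h2'
    generalize p / q = t at *
    clear_value q s p
    linear_combination s * h1' - q * h2' - κ₁ * hD2 - Λ * κ * e3
  have e1 := key hk₀ hM e f
  have e2 := key hk₀' hM' e' f'
  exact mul_right_cancel₀ hD' (e2.trans e1.symm)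

end IsWaveFamily

end GKS

/-! ### The main theorem. -/

theorem mainTheorem3 (δ : ℝ) (hδ : 0 < δ) (K : Set ℝ) (U : ℝ → ℝ → ℝ → ℝ) (c : ℝ → ℝ → ℝ)
    (hU : GKS.IsWaveFamily δ K U c) (k M : ℝ) (hk : k ∈ K) :
    -- the functions `f`, `f^k`, `f^M` are well defined
    (∀ k' ∈ K, ∀ M' kT kX MT MX : ℝ,
      ∃! f : ℝ → ℝ, GKS.IsCorrector δ U c k' M' (GKS.whithamSource δ U k' M' kT kX MT MX) f) ∧
    (∀ Λ₀ : ℂ,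
      (∃! f : ℝ → ℂ, GKS.IsCorrector δ U c k M (fun y => (k : ℂ) * GKS.vk δ U c k M Λ₀ y) f) ∧
      (∃! f : ℝ → ℂ, GKS.IsCorrector δ U c k M (fun y => (k : ℂ) * GKS.vM U c k M Λ₀ y) f)) ∧
    -- the viscous Whitham system can be linearized about the constant state `(k, M)`
    DifferentiableAt ℝ (GKS.fluxK δ U c) (k, M, 0, 0, 0, 0) ∧
    DifferentiableAt ℝ (GKS.fluxM δ U c) (k, M, 0, 0, 0, 0) ∧
    -- coefficients of spectral curves, with the eigenvector corrections, solve the two systems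
    (∀ (l : ℝ → ℂ) (u : ℝ → ℝ → ℂ) (Λ₀ Λ₁ : ℂ) (u₀ u₁ u₂ : ℝ → ℂ),
      GKS.IsSpectralCurve δ U c k M l u Λ₀ Λ₁ u₀ u₁ u₂ →
      ∃ k₀ M₀ k₁ M₁ k₂ : ℂ,
        u₀ = GKS.mode₀ U k M k₀ ∧
        u₁ = GKS.mode₁ U k M k₀ M₀ k₁ ∧ GKS.mean u₁ = M₀ ∧
        u₂ = GKS.mode₂ δ U c k M Λ₀ k₀ M₀ k₁ M₁ k₂ ∧ GKS.mean u₂ = M₁ ∧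
        GKS.FirstOrderSystem U c k M Λ₀ k₀ M₀ ∧
        GKS.SecondOrderSystem δ U c k M Λ₀ k₀ M₀ Λ₁ k₁ M₁) ∧
    -- conversely, the two systems are all that the spectral problem imposes at these orders
    (∀ Λ₀ Λ₁ k₀ M₀ k₁ M₁ : ℂ,
      (∃ (l₂ : ℂ) (u₂ u₃ : ℝ → ℂ), ContDiff ℝ 4 u₂ ∧ ContDiff ℝ 4 u₃ ∧
        Function.Periodic u₂ 1 ∧ Function.Periodic u₃ 1 ∧ GKS.mean u₂ = M₁ ∧
        GKS.IsQuasiMode δ U c k M Λ₀ Λ₁ l₂ (GKS.mode₀ U k M k₀) (GKS.mode₁ U k M k₀ M₀ k₁)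
          u₂ u₃) ↔
      GKS.FirstOrderSystem U c k M Λ₀ k₀ M₀ ∧
        GKS.SecondOrderSystem δ U c k M Λ₀ k₀ M₀ Λ₁ k₁ M₁) ∧
    -- the plane wave analysis of the linearized viscous Whitham system gives the same systems
    (∀ (l kh Mh : ℝ → ℂ) (Λ₀ Λ₁ k₀ M₀ k₁ M₁ : ℂ),
      GKS.EigenvalueExpansion k l Λ₀ Λ₁ → GKS.AmplitudeExpansion kh k₀ k₁ →
      GKS.AmplitudeExpansion Mh M₀ M₁ →
      (GKS.WhithamPlaneWave δ U c k M l kh Mh ↔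
        GKS.FirstOrderSystem U c k M Λ₀ k₀ M₀ ∧
          GKS.SecondOrderSystem δ U c k M Λ₀ k₀ M₀ Λ₁ k₁ M₁)) ∧
    -- hence spectral curves and Whitham plane waves have the same second order coefficient
    (∀ (l : ℝ → ℂ) (u : ℝ → ℝ → ℂ) (Λ₀ Λ₁ : ℂ) (u₀ u₁ u₂ : ℝ → ℂ) (lw kh Mh : ℝ → ℂ)
        (Λ₁' k₀' M₀' k₁' M₁' : ℂ),
      GKS.IsSimpleDispersionRoot U c k M Λ₀ →
      GKS.IsSpectralCurve δ U c k M l u Λ₀ Λ₁ u₀ u₁ u₂ → u₀ ≠ 0 →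
      GKS.EigenvalueExpansion k lw Λ₀ Λ₁' → GKS.AmplitudeExpansion kh k₀' k₁' →
      GKS.AmplitudeExpansion Mh M₀' M₁' → GKS.WhithamPlaneWave δ U c k M lw kh Mh →
      (k₀', M₀') ≠ (0, 0) →
      Λ₁' = Λ₁ ∧ (fun ξ : ℝ => l ξ - lw ξ) =O[𝓝[≠] (0 : ℝ)] fun ξ => ξ ^ 3) := by
  refine ⟨fun k' hk' M' kT kX MT MX => hU.existsUnique_whithamF hδ hk' M' kT kX MT MX,
    fun Λ₀ => ⟨hU.existsUnique_fk hδ hk M Λ₀, hU.existsUnique_fM hδ hk M Λ₀⟩,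
    (hU.fluxK_linear hδ hk M).1, (hU.fluxM_linear hδ hk M).1,
    fun l u Λ₀ Λ₁ u₀ u₁ u₂ h => hU.spectralCurve_coefficients hδ hk M h,
    fun Λ₀ Λ₁ k₀ M₀ k₁ M₁ => hU.exists_isQuasiMode_iff hδ hk M Λ₀ Λ₁ k₀ M₀ k₁ M₁,
    fun l kh Mh Λ₀ Λ₁ k₀ M₀ k₁ M₁ hl hkh hMh => hU.whithamPlaneWave_iff hδ hk M hl hkh hMh, ?_⟩
  intro l u Λ₀ Λ₁ u₀ u₁ u₂ lw kh Mh Λ₁' k₀' M₀' k₁' M₁' hs h hu₀ hl hkh hMh hw hne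
  obtain ⟨k₀, M₀, k₁, M₁, k₂, e₀, -, -, -, -, h₀, h₁⟩ := hU.spectralCurve_coefficients hδ hk M h
  obtain ⟨h₀', h₁'⟩ := (hU.whithamPlaneWave_iff hδ hk M hl hkh hMh).mp hw
  -- A nontrivial leading mode is a nonzero multiple of `U'`, so its wavenumber amplitude cannot
  -- vanish.
  have hk₀ : k₀ ≠ 0 := by
    rintro rfl
    exact hu₀ (e₀.trans (funext fun x => by simp [GKS.mode₀]))
  have hΛ : Λ₁' = Λ₁ := hU.eq_of_secondOrderSystem hk M hs h₀ h₁ hk₀ h₀' h₁' hne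
  subst hΛ
  exact ⟨rfl, (h.eigenvalue.sub hl).congr_left fun ξ => by ring⟩
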